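/- Consider two agents who decide in turn on a binary state $H\in\{0,1\}$ with true prior $P(H=0)=p_0\in(0,1)$. Their private signals $Y_1,Y_2$ are conditionally independent given $H$, each with law $N(0,\sigma^2)$ if $H=0$ and $N(h_1,\sigma^2)$ if $H=1$, where $\sigma,h_1>0$; write $f(\cdot\mid h)$ for the density of a signal given $H=h$. A false alarm (deciding $1$ when $H=0$) costs $c_{10}>0$, a missed detection (deciding $0$ when $H=1$) costs $c_{01}>0$, and correct decisions cost nothing. An agent with current belief $q\in(0,1)$ in $H=0$ and signal $y$ decides $1$ if $\frac{f(y\mid 1)}{f(y\mid 0)}>\frac{c_{10}q}{c_{01}(1-q)}$ and $0$ otherwise; let $p_q(d\mid h)$ be the probability that such an agent decides $d$ when $H=h$. The agents do not know $p_0$ and have prior beliefs $q_1,q_2\in(0,1)$. The first agent applies this test to $Y_1$ with belief $q_1$ and announces her decision $d$. The second agent, who assumes that the first agent's prior belief was $q_2$, updates his belief to $$q_2^{d}=\frac{q_2\,p_{q_2}(d\mid 0)}{q_2\,p_{q_2}(d\mid 0)+(1-q_2)\,p_{q_2}(d\mid 1)}$$ and applies the test to $Y_2$ with belief $q_2^{d}$,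 which gives the final decision $\widehat H_2$. Its true Bayes risk is $$R_2(q_1,q_2)=c_{10}\,p_0\,P(\widehat H_2=1\mid H=0)+c_{01}\,(1-p_0)\,P(\widehat H_2=0\mid H=1).$$ Call $q_1^\ast\in(0,1)$ an optimal prior belief of the first agent if $\inf_{q_2\in(0,1)}R_2(q_1^\ast,q_2)=\inf_{q_1,q_2\in(0,1)}R_2(q_1,q_2)$; this holds in particular if $(q_1^\ast,q_2^\ast)$ minimizes $R_2$ over $(0,1)^2$ for some $q_2^\ast$. Then an optimal prior belief of the first agent exists, and every such $q_1^\ast$ satisfies: - if $p_0<\frac{c_{01}}{c_{10}+c_{01}}$, then $p_0<q_1^\ast<\frac{c_{01}}{c_{10}+c_{01}}$; - if $p_0=\frac{c_{01}}{c_{10}+c_{01}}$, then $q_1^\ast=p_0$; - if $p_0>\frac{c_{01}}{c_{10}+c_{01}}$, then $\frac{c_{01}}{c_{10}+c_{01}}<q_1^\ast<p_0$. -/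

import Mathlib

namespace TwoAgents

noncomputable section

open MeasureTheory ProbabilityTheory

/-- Mean of a private signal under state `h`: it is `0` under `H = 0` and `h₁` under `H = 1`. -/
def signalMean (h₁ : ℝ) (h : Fin 2) : ℝ := if h = 0 then 0 else h₁

/-- The likelihood `f(y | h)`: the density of `N(0, σ²)` for `h = 0` and of `N(h₁, σ²)` for
`h = 1`. -/
def likelihood (h₁ σ : ℝ) (h : Fin 2) (y : ℝ) : ℝ :=
  gaussianPDFReal (signalMean h₁ h) (Real.toNNReal (σ ^ 2)) y

/-- The law of one private signal given the state `h`. -/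
def signalLaw (h₁ σ : ℝ) (h : Fin 2) : Measure ℝ :=
  gaussianReal (signalMean h₁ h) (Real.toNNReal (σ ^ 2))

/-- The likelihood ratio test of an agent whose current belief (probability of `H = 0`) is `q`:
decide `1` if `f(y | 1) / f(y | 0) > c₁₀ q / (c₀₁ (1 - q))`, and `0` otherwise. -/
def lrtDecision (c₁₀ c₀₁ h₁ σ q y : ℝ) : Fin 2 :=
  if c₁₀ * q / (c₀₁ * (1 - q)) < likelihood h₁ σ 1 y / likelihood h₁ σ 0 y then 1 else 0

/-- The conditional probability, given state `h`, that an agent who tests with belief `q` on her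
private signal alone announces `d`. -/
def decisionProb (c₁₀ c₀₁ h₁ σ q : ℝ) (d h : Fin 2) : ℝ :=
  (signalLaw h₁ σ h).real {y | lrtDecision c₁₀ c₀₁ h₁ σ q y = d}

/-- The second agent's belief after seeing the first decision `d`. Not knowing the first agent's
belief, he applies Bayes' rule as if it were equal to his own prior belief `q`. -/
def updatedBelief (c₁₀ c₀₁ h₁ σ q : ℝ) (d : Fin 2) : ℝ :=
  q * decisionProb c₁₀ c₀₁ h₁ σ q d 0 /
    (q * decisionProb c₁₀ c₀₁ h₁ σ q d 0 + (1 - q) * decisionProb c₁₀ c₀₁ h₁ σ q d 1)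

/-- The second (final) decision as a function of the two private signals `y = (y₁, y₂)`, when the
agents have prior beliefs `q₁` and `q₂`: the first agent tests on `y₁` with belief `q₁`, and the
second one tests on `y₂` with the belief updated from `q₂` by the first decision. -/
def finalDecision (c₁₀ c₀₁ h₁ σ q₁ q₂ : ℝ) (y : ℝ × ℝ) : Fin 2 :=
  lrtDecision c₁₀ c₀₁ h₁ σ
    (updatedBelief c₁₀ c₀₁ h₁ σ q₂ (lrtDecision c₁₀ c₀₁ h₁ σ q₁ y.1)) y.2

/-- The Bayes risk `R₂` of the final decision. The signals are conditionally i.i.d. given the state,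
`p₀` is the true probability of `H = 0`, false alarms cost `c₁₀`, missed detections `c₀₁`. -/
def bayesRisk (c₁₀ c₀₁ p₀ h₁ σ q₁ q₂ : ℝ) : ℝ :=
  c₁₀ * p₀ * ((signalLaw h₁ σ 0).prod (signalLaw h₁ σ 0)).real
      {y | finalDecision c₁₀ c₀₁ h₁ σ q₁ q₂ y = 1} +
    c₀₁ * (1 - p₀) * ((signalLaw h₁ σ 1).prod (signalLaw h₁ σ 1)).real
      {y | finalDecision c₁₀ c₀₁ h₁ σ q₁ q₂ y = 0}

/-- The least Bayes risk (an infimum) that a second agent with a suitable prior belief reaches after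
a first agent with prior belief `q₁`. -/
def bestRisk (c₁₀ c₀₁ p₀ h₁ σ q₁ : ℝ) : ℝ :=
  ⨅ q₂ : Set.Ioo (0 : ℝ) 1, bayesRisk c₁₀ c₀₁ p₀ h₁ σ q₁ q₂

/-- `q₁` is an optimal prior belief of the first agent: together with optimal prior beliefs of the
second agent it reaches the infimum of the Bayes risk over all pairs of prior beliefs. The second
agent's optimum is an infimum because for extreme `p₀` it is only approached, as `q₂` tends to an
end point of `(0, 1)`. -/
def IsOptimalFirstBelief (c₁₀ c₀₁ p₀ h₁ σ q₁ : ℝ) : Prop :=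
  q₁ ∈ Set.Ioo (0 : ℝ) 1 ∧
    ∀ q ∈ Set.Ioo (0 : ℝ) 1, bestRisk c₁₀ c₀₁ p₀ h₁ σ q₁ ≤ bestRisk c₁₀ c₀₁ p₀ h₁ σ q

/-- The first coordinate of a minimizer `(q₁, q₂)` of the Bayes risk is optimal in this sense. -/
theorem isOptimalFirstBelief_of_forall_le {c₁₀ c₀₁ p₀ h₁ σ q₁ q₂ : ℝ}
    (hq₁ : q₁ ∈ Set.Ioo (0 : ℝ) 1) (hq₂ : q₂ ∈ Set.Ioo (0 : ℝ) 1)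
    (hmin : ∀ q ∈ Set.Ioo (0 : ℝ) 1, ∀ q' ∈ Set.Ioo (0 : ℝ) 1,
      bayesRisk c₁₀ c₀₁ p₀ h₁ σ q₁ q₂ ≤ bayesRisk c₁₀ c₀₁ p₀ h₁ σ q q') :
    IsOptimalFirstBelief c₁₀ c₀₁ p₀ h₁ σ q₁ := by
  refine ⟨hq₁, fun q hq => ?_⟩
  have : Nonempty (Set.Ioo (0 : ℝ) 1) := ⟨⟨q, hq⟩⟩
  have hbdd : BddBelow (Set.range fun q' : Set.Ioo (0 : ℝ) 1 =>
      bayesRisk c₁₀ c₀₁ p₀ h₁ σ q₁ q') :=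
    ⟨bayesRisk c₁₀ c₀₁ p₀ h₁ σ q₁ q₂, by
      rintro _ ⟨q', rfl⟩
      exact hmin q₁ hq₁ q' q'.2⟩
  exact (ciInf_le hbdd ⟨q₂, hq₂⟩).trans (le_ciInf fun q' => hmin q hq q' q'.2)

end

end TwoAgents

/-!
The signals are normalised to `(Y - h₁ / 2) / σ`, with the laws `N(-m, 1)` and `N(m, 1)` for
`m = h₁ / (2 σ)`. A belief `q` then amounts to a threshold in `ℝ` (`threshold`), increasing in `q`,
and `c₀₁ / (c₁₀ + c₀₁)` corresponds to `0`. If `g` is the threshold of `p₀`, `a` the one of `q₁` and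
`b` the one of `q₂`, then the Bayes risk is a positive multiple of `curveRisk m g a b`, and its
infimum over `q₂` the same multiple of `infRisk m g a` (`bayesRisk_eq`, `bestRisk_eq`). The claim is
that minimizers of `infRisk m g` exist and lie strictly between `0` and `g`. By the symmetry
`infRisk_neg` it suffices to treat `g ≥ 0`.

The effect of a threshold move on the risk is a positive number times the difference of two
exponentials, and its sign is decided by comparing a sum of log likelihood ratios of intervals with
`g` (`risk_sub_one`, `risk_sub_zero`, `risk_sub_first`). So the first threshold should be raised
when the log likelihood ratio `curveLlr m b` of the interval between the two thresholds of the second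
agent is small, and lowered when it is large. The proofs use the monotonicity of the log likelihood
ratio `llr m x y` in `x` and `y` and the fact that shifting the interval by `t ≥ 0` raises it by at
most `t`.

Thresholds `a ≥ g > 0` are not optimal (`exists_infRisk_lt_of_ge`): the risk with optimal second
thresholds increases in `a ≥ g`, at `a = g` the second agent with `b = g` attains it, and since
`curveLlr m g > 0`, lowering `a` with `b` kept fixed reduces the risk. The same monotonicity gives
the case `g = 0` (`infRisk_zero_lt_of_pos`).

The main part is that thresholds `a ≤ 0` are not optimal for `g > 0`. Put `l = tailLlr m 0`, the log
likelihood ratio of a positive signal. If `l < g`, then `curveLlr m b ≤ l < g` for every `b`, and a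
small positive first threshold is better than every `a ≤ 0`, uniformly in `b`
(`exists_infRisk_lt_of_nonpos_of_lt`). If `g ≤ l`, this still works for those `b` for which the
second agent's threshold after the decision `0` is at most some `S`. For the other `b`, the risk is
at least the one of the thresholds `0`, `g - l` and `S` (`risk_zero_le_risk_of_nonpos`), even though
the last two need not come from any `b`, and a path of threshold moves leads from there to a smaller
risk that is attained with a first threshold in `(0, g)` (`infRisk_lt_risk_zero`). A suitable `S`
and the intermediate thresholds exist if certain inequalities between values of `llr` and `tailLlr`
hold (`exists_infRisk_lt_of_nonpos`).

These inequalities hold with little room, and they are verified with explicit thresholds. The log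
likelihood ratio of an interval with centre `c` and half length `L` is `c` minus a mean slope of the
cumulant generating function of the normal law restricted to `(-L, L)`, which is bounded on both
sides (`le_llr_center_sq`, `le_llr_center_div`, `llr_center_le_of_sq_le`). The derivative of
`tailLlr` is a difference quotient of the hazard rate of the normal distribution; its even and odd
part are controlled through Owen's integral for `Φ(y) Φ(-y)` (`hazardEven_eq`, `two_mul_hazardOdd`).
With these bounds the inequalities turn into polynomial ones in `m` and `g / l`, which are checked
on finitely many cells, one family of which reaches to `m = ∞` (`exists_infRisk_lt_of_nonpos_of_le`).

Existence follows by continuity of `infRisk m g` and compactness of `[0, g]` (`infRisk_minimizers`).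
-/

noncomputable section

open MeasureTheory ProbabilityTheory Set Filter Topology

namespace TwoAgents

/-! ### The standard normal distribution -/

/-- The standard normal density. -/
def nphi (x : ℝ) : ℝ := (√(2 * Real.pi))⁻¹ * Real.exp (-x ^ 2 / 2)

/-- The standard normal distribution function, written as an integral from `0`. -/
def ncdf (x : ℝ) : ℝ := 1 / 2 + ∫ t in (0 : ℝ)..x, nphi t

lemma nphi_pos (x : ℝ) : 0 < nphi x := by unfold nphi; positivity

lemma nphi_neg (x : ℝ) : nphi (-x) = nphi x := by simp [nphi]

lemma continuous_nphi : Continuous nphi := by unfold nphi; fun_prop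

lemma nphi_eq_gaussianPDFReal (x : ℝ) : nphi x = gaussianPDFReal 0 1 x := by
  simp [nphi, gaussianPDFReal]

lemma hasDerivAt_nphi (x : ℝ) : HasDerivAt nphi (-x * nphi x) x := by
  have h : HasDerivAt (fun y : ℝ => -y ^ 2 / 2) (-x) x := by
    have := ((hasDerivAt_pow 2 x).neg).div_const 2
    exact this.congr_deriv (by push_cast; ring)
  have := (h.exp).const_mul (√(2 * Real.pi))⁻¹
  exact this.congr_deriv (by unfold nphi; ring)

lemma hasDerivAt_ncdf (x : ℝ) : HasDerivAt ncdf (nphi x) x := by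
  have := intervalIntegral.integral_hasDerivAt_right
    (continuous_nphi.intervalIntegrable 0 x)
    (continuous_nphi.stronglyMeasurableAtFilter _ _) continuous_nphi.continuousAt
  exact this.const_add (1 / 2)

lemma continuous_ncdf : Continuous ncdf :=
  continuous_iff_continuousAt.2 fun x => (hasDerivAt_ncdf x).continuousAt

lemma integral_nphi (a b : ℝ) : ∫ t in a..b, nphi t = ncdf b - ncdf a :=
  intervalIntegral.integral_eq_sub_of_hasDerivAt (fun x _ => hasDerivAt_ncdf x)
    (continuous_nphi.intervalIntegrable a b)

lemma strictMono_ncdf : StrictMono ncdf :=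
  strictMono_of_hasDerivAt_pos hasDerivAt_ncdf nphi_pos

lemma ncdf_neg (x : ℝ) : ncdf (-x) = 1 - ncdf x := by
  have h := intervalIntegral.integral_comp_neg (a := 0) (b := x) nphi
  simp only [nphi_neg, neg_zero] at h
  have h2 : ∫ t in (-x)..0, nphi t = -∫ t in (0 : ℝ)..(-x), nphi t :=
    intervalIntegral.integral_symm _ _
  unfold ncdf
  linarith

lemma integrable_nphi : Integrable nphi := by
  have := integrable_gaussianPDFReal 0 1
  exact this.congr (Eventually.of_forall fun x => (nphi_eq_gaussianPDFReal x).symm)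

lemma integral_Iic_nphi (x : ℝ) : ∫ t in Iic x, nphi t = ncdf x := by
  have htot : ∫ t, nphi t = 1 := by
    simp_rw [nphi_eq_gaussianPDFReal]
    exact integral_gaussianPDFReal_eq_one 0 one_ne_zero
  have hsym : ∫ t in Iic (0 : ℝ), nphi t = ∫ t in Ioi (0 : ℝ), nphi t := by
    have := integral_comp_neg_Iic (0 : ℝ) nphi
    simpa [nphi_neg] using this
  have hsplit : (∫ t in Iic (0 : ℝ), nphi t) + ∫ t in Ioi (0 : ℝ), nphi t = 1 := by
    rw [← htot, ← compl_Iic]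
    exact integral_add_compl measurableSet_Iic integrable_nphi
  have := intervalIntegral.integral_Iic_sub_Iic (a := 0) (b := x)
    integrable_nphi.integrableOn integrable_nphi.integrableOn
  unfold ncdf
  linarith

lemma ncdf_pos (x : ℝ) : 0 < ncdf x := by
  have h : 0 ≤ ncdf (x - 1) := by
    rw [← integral_Iic_nphi]
    exact integral_nonneg fun t => (nphi_pos t).le
  exact h.trans_lt (strictMono_ncdf (by linarith))

lemma ncdf_lt_one (x : ℝ) : ncdf x < 1 := by
  have h := ncdf_pos (-x)
  rw [ncdf_neg] at h
  linarith

lemma ncdf_zero : ncdf 0 = 1 / 2 := by simp [ncdf]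

lemma tendsto_ncdf_atTop : Tendsto ncdf atTop (𝓝 1) := by
  have h := (tendsto_cdf_atTop (gaussianReal 0 1))
  refine h.congr fun x => ?_
  rw [cdf_eq_real, measureReal_def, gaussianReal_apply_eq_integral 0 one_ne_zero,
    ENNReal.toReal_ofReal (integral_nonneg fun t => gaussianPDFReal_nonneg _ _ _),
    ← integral_Iic_nphi]
  simp_rw [nphi_eq_gaussianPDFReal]

lemma nphi_mul_exp (m y : ℝ) : nphi (y - m) = Real.exp (2 * m * y) * nphi (y + m) := by
  unfold nphi
  rw [mul_left_comm, ← Real.exp_add]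
  congr 2
  ring

/-! ### Interval masses and their log likelihood ratios -/

/-- The mass of the interval `(a, b)` under `N(m, 1)`. -/
def mass (m a b : ℝ) : ℝ := ncdf (b - m) - ncdf (a - m)

/-- The log likelihood ratio of the event that a signal lies in `(a, b)`, for `N(m, 1)` against
`N(-m, 1)`, in the unit in which a single observation `y` has log likelihood ratio `y`. -/
def llr (m a b : ℝ) : ℝ := (Real.log (mass m a b) - Real.log (mass (-m) a b)) / (2 * m)

/-- The log likelihood ratio of the event that a signal exceeds `x`, in the same unit. -/
def tailLlr (m x : ℝ) : ℝ := (Real.log (ncdf (m - x)) - Real.log (ncdf (-m - x))) / (2 * m)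

lemma mass_pos {a b : ℝ} (m : ℝ) (h : a < b) : 0 < mass m a b :=
  sub_pos.2 (strictMono_ncdf (by linarith))

lemma mass_nonneg {a b : ℝ} (m : ℝ) (h : a ≤ b) : 0 ≤ mass m a b :=
  sub_nonneg.2 (strictMono_ncdf.monotone (by linarith))

lemma mass_add (m a b c : ℝ) : mass m a b + mass m b c = mass m a c := by unfold mass; ring

lemma mass_neg (m a b : ℝ) : mass (-m) (-b) (-a) = mass m a b := by
  unfold mass
  rw [show -a - -m = -(a - m) by ring, show -b - -m = -(b - m) by ring, ncdf_neg, ncdf_neg]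
  ring

lemma mass_eq_integral (m a b : ℝ) : mass m a b = ∫ y in a..b, nphi (y - m) := by
  rw [intervalIntegral.integral_comp_sub_right (fun y => nphi y), integral_nphi, mass]

lemma mass_neg_eq_integral (m a b : ℝ) : mass (-m) a b = ∫ y in a..b, nphi (y + m) := by
  simp [mass_eq_integral]

lemma mass_eq_integral_exp (m a b : ℝ) :
    mass m a b = ∫ y in a..b, Real.exp (2 * m * y) * nphi (y + m) := by
  rw [mass_eq_integral]
  simp_rw [nphi_mul_exp]

lemma tendsto_mass_atTop (m a : ℝ) : Tendsto (fun b => mass m a b) atTop (𝓝 (ncdf (m - a))) := by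
  have h : Tendsto (fun b => ncdf (b - m)) atTop (𝓝 1) :=
    tendsto_ncdf_atTop.comp (tendsto_atTop_add_const_right _ (-m) tendsto_id)
  have h2 := h.sub_const (ncdf (a - m))
  rwa [show (1 : ℝ) - ncdf (a - m) = ncdf (m - a) by rw [← ncdf_neg]; ring_nf] at h2

lemma continuous_nphi_add (m : ℝ) : Continuous fun y => nphi (y + m) :=
  continuous_nphi.comp (by fun_prop)

lemma mass_le_exp_mul {m a b : ℝ} (hm : 0 < m) (h : a ≤ b) :
    mass m a b ≤ Real.exp (2 * m * b) * mass (-m) a b := by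
  rw [mass_eq_integral_exp, mass_neg_eq_integral, ← intervalIntegral.integral_const_mul]
  have hc := continuous_nphi_add m
  refine intervalIntegral.integral_mono_on h ?_ ?_ fun y hy => ?_
  · exact Continuous.intervalIntegrable (by fun_prop) _ _
  · exact Continuous.intervalIntegrable (by fun_prop) _ _
  · have := (nphi_pos (y + m)).le
    have := hy.2
    gcongr

lemma exp_mul_le_mass {m a b : ℝ} (hm : 0 < m) (h : a ≤ b) :
    Real.exp (2 * m * a) * mass (-m) a b ≤ mass m a b := by
  rw [mass_neg_eq_integral, mass_eq_integral_exp m, ← intervalIntegral.integral_const_mul]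
  have hc := continuous_nphi_add m
  refine intervalIntegral.integral_mono_on h ?_ ?_ fun y hy => ?_
  · exact Continuous.intervalIntegrable (by fun_prop) _ _
  · exact Continuous.intervalIntegrable (by fun_prop) _ _
  · have := (nphi_pos (y + m)).le
    have := hy.1
    gcongr

lemma exp_mul_le_tail {m : ℝ} (hm : 0 < m) (x : ℝ) :
    Real.exp (2 * m * x) * ncdf (-m - x) ≤ ncdf (m - x) := by
  refine le_of_tendsto_of_tendsto ((tendsto_mass_atTop (-m) x).const_mul _)
    (tendsto_mass_atTop m x) ?_
  filter_upwards [eventually_ge_atTop x] with b hb using exp_mul_le_mass hm hb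

lemma llr_le_iff {m a b : ℝ} (hm : 0 < m) (h : a < b) (g : ℝ) :
    llr m a b ≤ g ↔ mass m a b ≤ Real.exp (2 * m * g) * mass (-m) a b := by
  have h1 := mass_pos m h
  have h0 := mass_pos (-m) h
  rw [llr, div_le_iff₀ (by positivity), ← Real.log_le_log_iff h1 (by positivity),
    Real.log_mul (by positivity) h0.ne', Real.log_exp, sub_le_iff_le_add, mul_comm g]

lemma le_llr_iff {m a b : ℝ} (hm : 0 < m) (h : a < b) (g : ℝ) :
    g ≤ llr m a b ↔ Real.exp (2 * m * g) * mass (-m) a b ≤ mass m a b := by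
  have h1 := mass_pos m h
  have h0 := mass_pos (-m) h
  rw [llr, le_div_iff₀ (by positivity), ← Real.log_le_log_iff (by positivity) h1,
    Real.log_mul (by positivity) h0.ne', Real.log_exp, le_sub_iff_add_le, mul_comm g]

lemma exp_llr_mul {m a b : ℝ} (hm : 0 < m) (h : a < b) :
    Real.exp (2 * m * llr m a b) * mass (-m) a b = mass m a b :=
  le_antisymm ((le_llr_iff hm h _).1 le_rfl) ((llr_le_iff hm h _).1 le_rfl)

lemma exp_tailLlr_mul {m : ℝ} (hm : 0 < m) (x : ℝ) :
    Real.exp (2 * m * tailLlr m x) * ncdf (-m - x) = ncdf (m - x) := by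
  have h1 := ncdf_pos (m - x)
  have h0 := ncdf_pos (-m - x)
  have h : 2 * m * tailLlr m x = Real.log (ncdf (m - x) / ncdf (-m - x)) := by
    rw [tailLlr, Real.log_div h1.ne' h0.ne']
    field_simp
  rw [h, Real.exp_log (by positivity)]
  field_simp

lemma le_tailLlr_iff {m : ℝ} (hm : 0 < m) (x g : ℝ) :
    g ≤ tailLlr m x ↔ Real.exp (2 * m * g) * ncdf (-m - x) ≤ ncdf (m - x) := by
  rw [← exp_tailLlr_mul hm x, mul_le_mul_iff_left₀ (ncdf_pos _), Real.exp_le_exp,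
    mul_le_mul_iff_right₀ (by positivity)]

lemma llr_le_right {m a b : ℝ} (hm : 0 < m) (h : a < b) : llr m a b ≤ b :=
  (llr_le_iff hm h b).2 (mass_le_exp_mul hm h.le)

lemma left_le_llr {m a b : ℝ} (hm : 0 < m) (h : a < b) : a ≤ llr m a b :=
  (le_llr_iff hm h a).2 (exp_mul_le_mass hm h.le)

lemma le_tailLlr {m : ℝ} (hm : 0 < m) (x : ℝ) : x ≤ tailLlr m x :=
  (le_tailLlr_iff hm x x).2 (exp_mul_le_tail hm x)

lemma exp_mul_le_exp_mul {m g k x : ℝ} (hm : 0 < m) (hg : g ≤ k) (hx : 0 ≤ x) :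
    Real.exp (2 * m * g) * x ≤ Real.exp (2 * m * k) * x := by gcongr

/-- Extending an interval to the right increases the log likelihood ratio. -/
lemma llr_mono_right {m a b c : ℝ} (hm : 0 < m) (h : a < b) (hbc : b ≤ c) :
    llr m a b ≤ llr m a c := by
  rw [le_llr_iff hm (h.trans_le hbc), ← mass_add m a b c, ← mass_add (-m) a b c, mul_add,
    exp_llr_mul hm h]
  have h2 := exp_mul_le_mass hm hbc
  have h3 := exp_mul_le_exp_mul hm (llr_le_right hm h) (mass_nonneg (-m) hbc)
  linarith

lemma llr_mono_left {m a b c : ℝ} (hm : 0 < m) (hab : a ≤ b) (h : b < c) :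
    llr m a c ≤ llr m b c := by
  rw [llr_le_iff hm (hab.trans_lt h), ← mass_add m a b c, ← mass_add (-m) a b c, mul_add,
    exp_llr_mul hm h]
  have h2 := mass_le_exp_mul hm hab
  have h3 := exp_mul_le_exp_mul hm (left_le_llr hm h) (mass_nonneg (-m) hab)
  linarith

lemma llr_mono {m a b a' b' : ℝ} (hm : 0 < m) (h : a < b) (h' : a' < b') (ha : a ≤ a')
    (hb : b ≤ b') : llr m a b ≤ llr m a' b' :=
  (llr_mono_right hm h hb).trans (llr_mono_left hm ha h')

lemma llr_le_tailLlr {m a b : ℝ} (hm : 0 < m) (h : a < b) : llr m a b ≤ tailLlr m a := by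
  rw [le_tailLlr_iff hm]
  refine le_of_tendsto_of_tendsto ((tendsto_mass_atTop (-m) a).const_mul _)
    (tendsto_mass_atTop m a) ?_
  filter_upwards [eventually_ge_atTop b] with c hc
  exact (le_llr_iff hm (h.trans_le hc) _).1 (llr_mono_right hm h hc)

lemma llr_neg {m : ℝ} (a b : ℝ) : llr m (-b) (-a) = -llr m a b := by
  have h1 := mass_neg m a b
  have h2 := mass_neg (-m) a b
  rw [neg_neg] at h2
  rw [llr, llr, h1, h2]
  ring

/-- Chebyshev's integral inequality for two increasing functions and a positive weight. -/
lemma integral_mul_integral_le {a b : ℝ} (hab : a ≤ b) {f g v : ℝ → ℝ} (hf : Continuous f)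
    (hg : Continuous g) (hv : Continuous v) (hv0 : ∀ x ∈ Icc a b, 0 ≤ v x)
    (hfg : ∀ x ∈ Icc a b, ∀ y ∈ Icc a b, 0 ≤ (f x - f y) * (g x - g y)) :
    (∫ x in a..b, f x * v x) * (∫ x in a..b, g x * v x) ≤
      (∫ x in a..b, v x) * ∫ x in a..b, f x * g x * v x := by
  have key : 0 ≤ ∫ x in a..b, ∫ y in a..b, (f x - f y) * (g x - g y) * (v x * v y) := by
    refine intervalIntegral.integral_nonneg hab fun x hx =>
      intervalIntegral.integral_nonneg hab fun y hy =>
        mul_nonneg (hfg x hx y hy) (mul_nonneg (hv0 x hx) (hv0 y hy))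
  have inner : ∀ x, ∫ y in a..b, (f x - f y) * (g x - g y) * (v x * v y) =
      (f x * g x * v x) * (∫ y in a..b, v y) - (f x * v x) * (∫ y in a..b, g y * v y)
        - (g x * v x) * (∫ y in a..b, f y * v y) + v x * ∫ y in a..b, f y * g y * v y := by
    intro x
    simp only [← intervalIntegral.integral_const_mul]
    rw [← intervalIntegral.integral_sub, ← intervalIntegral.integral_sub,
      ← intervalIntegral.integral_add]
    · refine intervalIntegral.integral_congr fun y _ => ?_
      ring
    all_goals exact Continuous.intervalIntegrable (by fun_prop) _ _
  simp only [inner] at key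
  rw [intervalIntegral.integral_add, intervalIntegral.integral_sub,
    intervalIntegral.integral_sub] at key
  · simp only [intervalIntegral.integral_mul_const] at key
    linarith
  all_goals exact Continuous.intervalIntegrable (by fun_prop) _ _

/-- Shifting an interval by `s ≥ 0` raises its log likelihood ratio by at most `s`. -/
lemma llr_shift {m a b s : ℝ} (hm : 0 < m) (h : a < b) (hs : 0 ≤ s) :
    llr m (a + s) (b + s) ≤ llr m a b + s := by
  rw [llr_le_iff hm (by linarith), mul_add, Real.exp_add]
  have h0 := mass_pos (-m) h
  rw [← mul_le_mul_iff_left₀ h0]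
  have e : Real.exp (2 * m * llr m a b) * Real.exp (2 * m * s) * mass (-m) (a + s) (b + s) *
      mass (-m) a b = Real.exp (2 * m * s) * (mass (-m) (a + s) (b + s) * mass m a b) := by
    rw [← exp_llr_mul hm h]; ring
  rw [e]
  set v : ℝ → ℝ := fun y => nphi (y + s + m) with hv
  have hvc : Continuous v := continuous_nphi.comp (by fun_prop)
  have key := integral_mul_integral_le h.le (f := fun y => Real.exp (2 * m * y))
    (g := fun y => Real.exp (s * y)) (v := v) (by fun_prop) (by fun_prop) hvc
    (fun x _ => (nphi_pos _).le) (fun x _ y _ => by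
      rcases le_total x y with hxy | hxy
      · refine mul_nonneg_of_nonpos_of_nonpos ?_ ?_ <;>
          refine sub_nonpos.2 (Real.exp_le_exp.2 ?_) <;> gcongr
      · refine mul_nonneg ?_ ?_ <;>
          refine sub_nonneg.2 (Real.exp_le_exp.2 ?_) <;> gcongr)
  have i1 : mass m (a + s) (b + s) =
      Real.exp (2 * m * s) * ∫ y in a..b, Real.exp (2 * m * y) * v y := by
    rw [mass_eq_integral_exp, ← intervalIntegral.integral_comp_add_right
      (fun y => Real.exp (2 * m * y) * nphi (y + m)), ← intervalIntegral.integral_const_mul]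
    refine intervalIntegral.integral_congr fun y _ => ?_
    simp only [hv]
    rw [← mul_assoc, ← Real.exp_add]
    ring_nf
  have i2 : mass (-m) (a + s) (b + s) = ∫ y in a..b, v y := by
    rw [mass_neg_eq_integral, ← intervalIntegral.integral_comp_add_right
      (fun y => nphi (y + m))]
  have sh : ∀ y, nphi (y + m) = Real.exp (s * m + s ^ 2 / 2) * (Real.exp (s * y) * v y) := by
    intro y
    simp only [hv, nphi]
    rw [mul_left_comm (Real.exp (s * y)), ← Real.exp_add, mul_left_comm, ← Real.exp_add]
    congr 2
    ring
  have i3 : mass (-m) a b =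
      Real.exp (s * m + s ^ 2 / 2) * ∫ y in a..b, Real.exp (s * y) * v y := by
    rw [mass_neg_eq_integral, ← intervalIntegral.integral_const_mul]
    simp_rw [sh]
  have i4 : mass m a b = Real.exp (s * m + s ^ 2 / 2) *
      ∫ y in a..b, Real.exp (2 * m * y) * Real.exp (s * y) * v y := by
    rw [mass_eq_integral_exp, ← intervalIntegral.integral_const_mul]
    refine intervalIntegral.integral_congr fun y _ => ?_
    simp only [sh]
    ring
  rw [i1, i2, i3, i4]
  have := mul_le_mul_of_nonneg_left key
    (by positivity : 0 ≤ Real.exp (2 * m * s) * Real.exp (s * m + s ^ 2 / 2))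
  linarith

lemma tendsto_llr_atTop {m : ℝ} (a : ℝ) :
    Tendsto (fun b => llr m a b) atTop (𝓝 (tailLlr m a)) := by
  unfold llr tailLlr
  refine Tendsto.div_const (Tendsto.sub ?_ ?_) _
  · exact (tendsto_mass_atTop m a).log (ncdf_pos _).ne'
  · exact (tendsto_mass_atTop (-m) a).log (ncdf_pos _).ne'

lemma tailLlr_shift {m s : ℝ} (hm : 0 < m) (x : ℝ) (hs : 0 ≤ s) :
    tailLlr m (x + s) ≤ tailLlr m x + s := by
  refine le_of_tendsto_of_tendsto
    ((tendsto_llr_atTop (m := m) (x + s)).comp (tendsto_atTop_add_const_right _ s tendsto_id))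
    ((tendsto_llr_atTop (m := m) x).add_const s) ?_
  filter_upwards [eventually_gt_atTop x] with b hb using llr_shift hm hb hs

lemma monotone_tailLlr {m : ℝ} (hm : 0 < m) : Monotone (tailLlr m) := by
  intro x y hxy
  refine le_of_tendsto_of_tendsto (tendsto_llr_atTop x) (tendsto_llr_atTop y) ?_
  filter_upwards [eventually_gt_atTop y] with b hb using llr_mono_left hm hxy hb

/-! ### Intervals described by centre and half length -/

/-- A comparison of increments by means of derivatives. -/
lemma sub_le_sub_of_deriv_le {f g f' g' : ℝ → ℝ} {a b : ℝ} (hab : a ≤ b)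
    (hf : ∀ x ∈ Icc a b, HasDerivAt f (f' x) x) (hg : ∀ x ∈ Icc a b, HasDerivAt g (g' x) x)
    (h : ∀ x ∈ Ioo a b, f' x ≤ g' x) : f b - f a ≤ g b - g a := by
  have hm : MonotoneOn (fun x => g x - f x) (Icc a b) := by
    refine monotoneOn_of_deriv_nonneg (convex_Icc a b) ?_ ?_ ?_
    · exact fun x hx => ((hg x hx).sub (hf x hx)).continuousAt.continuousWithinAt
    · intro x hx
      rw [interior_Icc] at hx
      have hx' := Ioo_subset_Icc_self hx
      exact ((hg x hx').sub (hf x hx')).differentiableAt.differentiableWithinAt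
    · intro x hx
      rw [interior_Icc] at hx
      have hx' := Ioo_subset_Icc_self hx
      have e : deriv (fun x => g x - f x) x = _ := ((hg x hx').sub (hf x hx')).deriv
      rw [e]
      linarith [h x hx]
  have := hm (left_mem_Icc.2 hab) (right_mem_Icc.2 hab) hab
  simp only at this
  linarith

lemma nonneg_of_deriv_nonneg {f f' : ℝ → ℝ} (h0 : 0 ≤ f 0) (hf : ∀ x, HasDerivAt f (f' x) x)
    (h : ∀ x, 0 < x → 0 ≤ f' x) {x : ℝ} (hx : 0 ≤ x) : 0 ≤ f x := by
  have := sub_le_sub_of_deriv_le hx (fun y _ => hasDerivAt_const y (0 : ℝ)) (fun y _ => hf y)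
    (fun y hy => h y hy.1)
  linarith

lemma hasDerivAt_integral_param {f f' : ℝ → ℝ → ℝ} {a b x : ℝ}
    (hf : ∀ x, Continuous (f x)) (hf' : Continuous fun p : ℝ × ℝ => f' p.1 p.2)
    (h : ∀ x s, HasDerivAt (fun x => f x s) (f' x s) x) :
    HasDerivAt (fun x => ∫ s in a..b, f x s) (∫ s in a..b, f' x s) x := by
  obtain ⟨C, hC⟩ := ((isCompact_closedBall x 1).prod
    (isCompact_uIcc (a := a) (b := b))).exists_bound_of_continuousOn
    hf'.continuousOn
  refine (intervalIntegral.hasDerivAt_integral_of_dominated_loc_of_deriv_le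
    (s := Metric.closedBall x 1) (bound := fun _ => C) (Metric.closedBall_mem_nhds x one_pos)
    (Eventually.of_forall fun y => (hf y).aestronglyMeasurable) ((hf x).intervalIntegrable a b)
    ?_ ?_ (by simp) ?_).2
  · exact (hf'.comp (by fun_prop : Continuous fun s : ℝ => (x, s))).aestronglyMeasurable
  · exact Eventually.of_forall fun s hs y hy => hC (y, s) ⟨hy, uIoc_subset_uIcc hs⟩
  · exact Eventually.of_forall fun s _ y _ => h y s

/-- The integral `∫₀ᴸ cosh (x s) exp (-s² / 2) ds`; its logarithm is, as a function of `x` and up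
to a constant, the cumulant generating function of the normal law restricted to `(-L, L)`. -/
def coshInt (L x : ℝ) : ℝ := ∫ s in (0 : ℝ)..L, Real.cosh (x * s) * Real.exp (-s ^ 2 / 2)

/-- The derivative of `coshInt` in its second argument. -/
def sinhInt (L x : ℝ) : ℝ := ∫ s in (0 : ℝ)..L, s * Real.sinh (x * s) * Real.exp (-s ^ 2 / 2)

lemma hasDerivAt_coshInt (L x : ℝ) : HasDerivAt (coshInt L) (sinhInt L x) x := by
  refine hasDerivAt_integral_param (f := fun x s => Real.cosh (x * s) * Real.exp (-s ^ 2 / 2))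
    (f' := fun x s => s * Real.sinh (x * s) * Real.exp (-s ^ 2 / 2)) (fun x => ?_) ?_
    fun x s => ?_
  · fun_prop
  · fun_prop
  · have h := ((hasDerivAt_id x).mul_const s).cosh.mul_const (Real.exp (-s ^ 2 / 2))
    exact h.congr_deriv (by simp; ring)

lemma coshInt_pos {L : ℝ} (hL : 0 < L) (x : ℝ) : 0 < coshInt L x :=
  intervalIntegral.intervalIntegral_pos_of_pos
    (Continuous.intervalIntegrable (by fun_prop) _ _)
    (fun s => mul_pos (Real.cosh_pos _) (Real.exp_pos _)) hL

lemma coshInt_neg (L x : ℝ) : coshInt L (-x) = coshInt L x := by simp [coshInt]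

lemma mass_center (m c L : ℝ) : mass m (c - L) (c + L) =
    2 * (√(2 * Real.pi))⁻¹ * Real.exp (-(m - c) ^ 2 / 2) * coshInt L (m - c) := by
  have h1 : mass m (c - L) (c + L) = ∫ s in (-L)..L, nphi (s - (m - c)) := by
    have := intervalIntegral.integral_comp_add_right (a := -L) (b := L) (fun s => nphi (s - m)) c
    rw [show -L + c = c - L by ring, show L + c = c + L by ring] at this
    rw [mass_eq_integral, ← this]
    refine intervalIntegral.integral_congr fun s _ => ?_
    ring_nf
  have hc : Continuous fun s => nphi (s - (m - c)) := continuous_nphi.comp (by fun_prop)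
  have hc' : Continuous fun s => nphi (-s - (m - c)) := continuous_nphi.comp (by fun_prop)
  have h2 : ∫ s in (-L)..0, nphi (s - (m - c)) = ∫ s in (0 : ℝ)..L, nphi (-s - (m - c)) := by
    have := intervalIntegral.integral_comp_neg (a := 0) (b := L) fun s => nphi (s - (m - c))
    simpa using this.symm
  rw [h1, ← intervalIntegral.integral_add_adjacent_intervals (b := 0)
    (hc.intervalIntegrable _ _) (hc.intervalIntegrable _ _), h2,
    ← intervalIntegral.integral_add (hc'.intervalIntegrable _ _) (hc.intervalIntegrable _ _),
    coshInt, ← intervalIntegral.integral_const_mul]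
  refine intervalIntegral.integral_congr fun s _ => ?_
  simp only [nphi]
  rw [Real.cosh_eq, show -(-s - (m - c)) ^ 2 / 2 =
      -(m - c) ^ 2 / 2 + (-((m - c) * s)) + -s ^ 2 / 2 by ring,
    show -(s - (m - c)) ^ 2 / 2 = -(m - c) ^ 2 / 2 + (m - c) * s + -s ^ 2 / 2 by ring]
  simp only [Real.exp_add]
  ring

/-- The log likelihood ratio of an interval falls short of its centre `c` by a difference quotient
of the (even, convex) function `log (coshInt L ·)`. -/
lemma llr_center {m L : ℝ} (hm : 0 < m) (hL : 0 < L) (c : ℝ) : llr m (c - L) (c + L) =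
    c - (Real.log (coshInt L (m + c)) - Real.log (coshInt L |m - c|)) / (2 * m) := by
  have e1 : coshInt L |m - c| = coshInt L (m - c) := by
    rcases abs_choice (m - c) with h | h <;> rw [h]
    rw [coshInt_neg]
  have e2 : coshInt L (-m - c) = coshInt L (m + c) := by
    rw [← coshInt_neg]; ring_nf
  have p1 := coshInt_pos hL (m - c)
  have p2 := coshInt_pos hL (m + c)
  have hpi : 0 < 2 * (√(2 * Real.pi))⁻¹ := by positivity
  rw [e1, llr, mass_center, mass_center, e2,
    Real.log_mul (by positivity) p1.ne', Real.log_mul (by positivity) p2.ne',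
    Real.log_mul hpi.ne' (Real.exp_pos _).ne', Real.log_mul hpi.ne' (Real.exp_pos _).ne',
    Real.log_exp, Real.log_exp]
  field_simp
  ring

lemma hasDerivAt_log_coshInt {L : ℝ} (hL : 0 < L) (x : ℝ) :
    HasDerivAt (fun x => Real.log (coshInt L x)) (sinhInt L x / coshInt L x) x :=
  (hasDerivAt_coshInt L x).log (coshInt_pos hL x).ne'

lemma sinh_le_mul_cosh {x : ℝ} (hx : 0 ≤ x) : Real.sinh x ≤ x * Real.cosh x := by
  have := nonneg_of_deriv_nonneg (f := fun x => x * Real.cosh x - Real.sinh x)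
    (f' := fun x => x * Real.sinh x) (by simp) (fun x => by
      have := ((hasDerivAt_id x).mul (Real.hasDerivAt_cosh x)).sub (Real.hasDerivAt_sinh x)
      exact this.congr_deriv (by simp))
    (fun x hx => mul_nonneg hx.le (Real.sinh_nonneg_iff.2 hx.le)) hx
  linarith

lemma mul_cosh_le {x : ℝ} (hx : 0 ≤ x) :
    x * Real.cosh x - Real.sinh x ≤ x ^ 2 * Real.sinh x / 3 := by
  have := nonneg_of_deriv_nonneg
    (f := fun x => x ^ 2 * Real.sinh x / 3 - (x * Real.cosh x - Real.sinh x))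
    (f' := fun x => x * (x * Real.cosh x - Real.sinh x) / 3) (by simp) (fun x => by
      have := ((((hasDerivAt_pow 2 x).mul (Real.hasDerivAt_sinh x)).div_const 3)).sub
        (((hasDerivAt_id x).mul (Real.hasDerivAt_cosh x)).sub (Real.hasDerivAt_sinh x))
      exact this.congr_deriv (by simp; ring))
    (fun x hx => by
      have := sinh_le_mul_cosh hx.le
      have : 0 ≤ x * Real.cosh x - Real.sinh x := by linarith
      positivity) hx
  linarith

/-- An upper bound for `1 / sinh² X` in terms of `coth X`, cleared of denominators. -/
lemma two_mul_sinh_sq_le {x : ℝ} (hx : 0 ≤ x) :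
    2 * Real.sinh x ^ 2 ≤ x ^ 2 + x * Real.sinh x * Real.cosh x := by
  have h2 : ∀ y : ℝ, 0 ≤ y → 0 ≤ 1 / 2 - Real.cosh y / 2 + y * Real.sinh y / 4 := fun y hy =>
    nonneg_of_deriv_nonneg (f := fun y => 1 / 2 - Real.cosh y / 2 + y * Real.sinh y / 4)
      (f' := fun y => (y * Real.cosh y - Real.sinh y) / 4) (by simp) (fun y => by
        have := (((Real.hasDerivAt_cosh y).div_const 2).const_sub (1 / 2)).add
          (((hasDerivAt_id y).mul (Real.hasDerivAt_sinh y)).div_const 4)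
        exact this.congr_deriv (by simp; ring))
      (fun y hy => by linarith [sinh_le_mul_cosh hy.le]) hy
  have h1 : ∀ y : ℝ, 0 ≤ y → 0 ≤ y / 2 - 3 / 4 * Real.sinh y + y * Real.cosh y / 4 := fun y hy =>
    nonneg_of_deriv_nonneg (f := fun y => y / 2 - 3 / 4 * Real.sinh y + y * Real.cosh y / 4)
      (f' := fun y => 1 / 2 - Real.cosh y / 2 + y * Real.sinh y / 4) (by simp) (fun y => by
        have := (((hasDerivAt_id y).div_const 2).sub ((Real.hasDerivAt_sinh y).const_mul
          (3 / 4))).add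
          (((hasDerivAt_id y).mul (Real.hasDerivAt_cosh y)).div_const 4)
        exact this.congr_deriv (by simp; ring))
      (fun y hy => h2 y hy.le) hy
  have h0 : ∀ y : ℝ, 0 ≤ y → 0 ≤ y ^ 2 / 4 + y * Real.sinh y / 4 - Real.cosh y + 1 := fun y hy =>
    nonneg_of_deriv_nonneg (f := fun y => y ^ 2 / 4 + y * Real.sinh y / 4 - Real.cosh y + 1)
      (f' := fun y => y / 2 - 3 / 4 * Real.sinh y + y * Real.cosh y / 4) (by simp) (fun y => by
        have := (((((hasDerivAt_pow 2 y).div_const 4)).add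
          (((hasDerivAt_id y).mul (Real.hasDerivAt_sinh y)).div_const 4)).sub
          (Real.hasDerivAt_cosh y)).add_const 1
        exact this.congr_deriv (by simp; ring))
      (fun y hy => h1 y hy.le) hy
  have := h0 (2 * x) (by linarith)
  rw [Real.sinh_two_mul, Real.cosh_two_mul, Real.cosh_sq] at this
  linarith

/-- `X coth X ≥ √(X² + 9/4) - 1/2`, cleared of denominators. -/
lemma sqrt_sub_half_mul_sinh_le {x : ℝ} (hx : 0 ≤ x) :
    (√(x ^ 2 + 9 / 4) - 1 / 2) * Real.sinh x ≤ x * Real.cosh x := by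
  have hs := Real.sinh_nonneg_iff.2 hx
  have hc := Real.cosh_pos x
  have h : √(x ^ 2 + 9 / 4) * Real.sinh x ≤ x * Real.cosh x + Real.sinh x / 2 := by
    refine le_of_sq_le_sq ?_ (by positivity)
    rw [mul_pow, Real.sq_sqrt (by positivity)]
    have := two_mul_sinh_sq_le hx
    have e := Real.cosh_sq x
    have e2 : (x * Real.cosh x + Real.sinh x / 2) ^ 2 = x ^ 2 * (Real.cosh x ^ 2)
      + x * Real.sinh x * Real.cosh x + Real.sinh x ^ 2 / 4 := by ring
    rw [e2, e]
    nlinarith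
  linarith

lemma sinhInt_le_mul_coshInt {L x : ℝ} (hL : 0 ≤ L) : sinhInt L x ≤ L * coshInt L x := by
  rw [coshInt, ← intervalIntegral.integral_const_mul]
  refine intervalIntegral.integral_mono_on hL (Continuous.intervalIntegrable (by fun_prop) _ _)
    (Continuous.intervalIntegrable (by fun_prop) _ _) fun s hs => ?_
  rw [← mul_assoc]
  have h := (Real.sinh_lt_cosh (x * s)).le
  have h1 := Real.cosh_pos (x * s)
  have h2 : s * Real.sinh (x * s) ≤ L * Real.cosh (x * s) :=
    (mul_le_mul_of_nonneg_left h hs.1).trans (mul_le_mul_of_nonneg_right hs.2 h1.le)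
  gcongr

lemma integral_cosh_mul {x : ℝ} (hx : x ≠ 0) (L : ℝ) :
    ∫ s in (0 : ℝ)..L, Real.cosh (x * s) = Real.sinh (x * L) / x := by
  have h : ∀ s ∈ uIcc 0 L, HasDerivAt (fun s => Real.sinh (x * s) / x) (Real.cosh (x * s)) s := by
    intro s _
    have := (((hasDerivAt_id s).const_mul x).sinh).div_const x
    exact this.congr_deriv (by simp; field_simp)
  rw [intervalIntegral.integral_eq_sub_of_hasDerivAt h
    (Continuous.intervalIntegrable (by fun_prop) _ _)]
  simp

lemma hasDerivAt_coshInt_left (L x : ℝ) :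
    HasDerivAt (fun L => coshInt L x) (Real.cosh (x * L) * Real.exp (-L ^ 2 / 2)) L := by
  have hc : Continuous fun s : ℝ => Real.cosh (x * s) * Real.exp (-s ^ 2 / 2) := by fun_prop
  exact intervalIntegral.integral_hasDerivAt_right (hc.intervalIntegrable 0 L)
    (hc.stronglyMeasurableAtFilter _ _) hc.continuousAt

lemma hasDerivAt_sinhInt_left (L x : ℝ) :
    HasDerivAt (fun L => sinhInt L x) (L * Real.sinh (x * L) * Real.exp (-L ^ 2 / 2)) L := by
  have hc : Continuous fun s : ℝ => s * Real.sinh (x * s) * Real.exp (-s ^ 2 / 2) := by fun_prop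
  exact intervalIntegral.integral_hasDerivAt_right (hc.intervalIntegrable 0 L)
    (hc.stronglyMeasurableAtFilter _ _) hc.continuousAt

lemma exp_mul_sinh_le_coshInt {L x : ℝ} (hL : 0 ≤ L) (hx : 0 < x) :
    Real.exp (-L ^ 2 / 2) * Real.sinh (x * L) ≤ x * coshInt L x := by
  have h := integral_cosh_mul hx.ne' L
  have h2 : Real.exp (-L ^ 2 / 2) * ∫ s in (0 : ℝ)..L, Real.cosh (x * s) ≤ coshInt L x := by
    rw [coshInt, ← intervalIntegral.integral_const_mul]
    refine intervalIntegral.integral_mono_on hL (Continuous.intervalIntegrable (by fun_prop) _ _)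
      (Continuous.intervalIntegrable (by fun_prop) _ _) fun s hs => ?_
    rw [mul_comm]
    have h1 := Real.cosh_pos (x * s)
    have := hs.1
    have := hs.2
    gcongr
  rw [h] at h2
  have := mul_le_mul_of_nonneg_left h2 hx.le
  calc _ = x * (Real.exp (-L ^ 2 / 2) * (Real.sinh (x * L) / x)) := by field_simp
    _ ≤ _ := this

lemma sinhInt_le_sq_mul_coshInt {L x : ℝ} (hL : 0 ≤ L) (hx : 0 < x) :
    sinhInt L x ≤ L ^ 2 * x / 3 * coshInt L x := by
  have key := nonneg_of_deriv_nonneg (f := fun L => L ^ 2 * x / 3 * coshInt L x - sinhInt L x)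
    (f' := fun L => 2 * L * x / 3 * coshInt L x + L ^ 2 * x / 3 *
      (Real.cosh (x * L) * Real.exp (-L ^ 2 / 2)) - L * Real.sinh (x * L) * Real.exp (-L ^ 2 / 2))
    (by simp [sinhInt]) (fun L => by
      have := ((((hasDerivAt_pow 2 L).mul_const x).div_const 3).mul
        (hasDerivAt_coshInt_left L x)).sub (hasDerivAt_sinhInt_left L x)
      exact this.congr_deriv (by simp))
    (fun L hL => by
      have h1 := mul_le_mul_of_nonneg_left (exp_mul_sinh_le_coshInt hL.le hx)
        (by positivity : 0 ≤ 2 * L / 3)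
      have h2 := mul_le_mul_of_nonneg_left (sinh_le_mul_cosh (by positivity : 0 ≤ x * L))
        (by positivity : 0 ≤ L / 3 * Real.exp (-L ^ 2 / 2))
      linarith) hL
  linarith

lemma sinhInt_eq {L x : ℝ} :
    sinhInt L x = x * coshInt L x - Real.exp (-L ^ 2 / 2) * Real.sinh (x * L) := by
  have h : ∀ s ∈ uIcc 0 L, HasDerivAt (fun s => -(Real.exp (-s ^ 2 / 2) * Real.sinh (x * s)))
      (s * Real.sinh (x * s) * Real.exp (-s ^ 2 / 2) -
        x * (Real.cosh (x * s) * Real.exp (-s ^ 2 / 2))) s := by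
    intro s _
    have := ((((hasDerivAt_pow 2 s).neg.div_const 2).exp).mul
      (((hasDerivAt_id s).const_mul x).sinh)).neg
    exact this.congr_deriv (by simp; ring)
  have := intervalIntegral.integral_eq_sub_of_hasDerivAt h
    (Continuous.intervalIntegrable (by fun_prop) _ _)
  rw [intervalIntegral.integral_sub (Continuous.intervalIntegrable (by fun_prop) _ _)
    (Continuous.intervalIntegrable (by fun_prop) _ _),
    intervalIntegral.integral_const_mul] at this
  simp only [mul_zero, Real.sinh_zero, neg_zero, sub_zero] at this
  unfold sinhInt coshInt
  linarith

lemma integral_sq_mul_cosh {x : ℝ} (hx : x ≠ 0) (L : ℝ) :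
    ∫ s in (0 : ℝ)..L, s ^ 2 * Real.cosh (x * s) =
      L ^ 2 * Real.sinh (x * L) / x - 2 * L * Real.cosh (x * L) / x ^ 2
        + 2 * Real.sinh (x * L) / x ^ 3 := by
  have h : ∀ s ∈ uIcc 0 L, HasDerivAt (fun s => s ^ 2 * Real.sinh (x * s) / x
      - 2 * s * Real.cosh (x * s) / x ^ 2 + 2 * Real.sinh (x * s) / x ^ 3)
      (s ^ 2 * Real.cosh (x * s)) s := by
    intro s _
    have hl := (hasDerivAt_id s).const_mul x
    have := ((((hasDerivAt_pow 2 s).mul hl.sinh).div_const x).sub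
      ((((hasDerivAt_id s).const_mul 2).mul hl.cosh).div_const (x ^ 2))).add
      ((hl.sinh.const_mul 2).div_const (x ^ 3))
    exact this.congr_deriv (by simp; field_simp; ring)
  rw [intervalIntegral.integral_eq_sub_of_hasDerivAt h
    (Continuous.intervalIntegrable (by fun_prop) _ _)]
  simp

/-- Jensen's inequality for `exp` under the weight `cosh (x s)` on `(0, L)`. -/
lemma exp_mul_sinh_le {L x k : ℝ} (hL : 0 < L) (hx : 0 < x)
    (hk : k * (x ^ 2 * Real.sinh (x * L)) ≤ x * L * Real.cosh (x * L) - Real.sinh (x * L)) :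
    Real.exp (-L ^ 2 / 2) * Real.sinh (x * L) ≤ Real.exp (-k) * (x * coshInt L x) := by
  have hsin : 0 < Real.sinh (x * L) := Real.sinh_pos_iff.2 (by positivity)
  have h1 : Real.exp (k - L ^ 2 / 2) *
      (∫ s in (0 : ℝ)..L, ((1 - k + L ^ 2 / 2) * Real.cosh (x * s) -
        1 / 2 * (s ^ 2 * Real.cosh (x * s)))) ≤ coshInt L x := by
    rw [coshInt, ← intervalIntegral.integral_const_mul]
    refine intervalIntegral.integral_mono_on hL.le
      (Continuous.intervalIntegrable (by fun_prop) _ _)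
      (Continuous.intervalIntegrable (by fun_prop) _ _) fun s _ => ?_
    have h2 := Real.add_one_le_exp ((L ^ 2 - s ^ 2) / 2 - k)
    have h3 : Real.exp (-s ^ 2 / 2) =
        Real.exp (k - L ^ 2 / 2) * Real.exp ((L ^ 2 - s ^ 2) / 2 - k) := by
      rw [← Real.exp_add]; ring_nf
    have h4 := mul_le_mul_of_nonneg_left h2
      (mul_pos (Real.exp_pos (k - L ^ 2 / 2)) (Real.cosh_pos (x * s))).le
    rw [h3]
    linarith
  rw [intervalIntegral.integral_sub (Continuous.intervalIntegrable (by fun_prop) _ _)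
    (Continuous.intervalIntegrable (by fun_prop) _ _), intervalIntegral.integral_const_mul,
    intervalIntegral.integral_const_mul, integral_cosh_mul hx.ne',
    integral_sq_mul_cosh hx.ne'] at h1
  have h5 : Real.sinh (x * L) ≤ x * ((1 - k + L ^ 2 / 2) * (Real.sinh (x * L) / x) -
      1 / 2 * (L ^ 2 * Real.sinh (x * L) / x - 2 * L * Real.cosh (x * L) / x ^ 2
        + 2 * Real.sinh (x * L) / x ^ 3)) := by
    have e : x * ((1 - k + L ^ 2 / 2) * (Real.sinh (x * L) / x) -
      1 / 2 * (L ^ 2 * Real.sinh (x * L) / x - 2 * L * Real.cosh (x * L) / x ^ 2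
        + 2 * Real.sinh (x * L) / x ^ 3)) = Real.sinh (x * L) + (x * L * Real.cosh (x * L)
        - Real.sinh (x * L) - k * (x ^ 2 * Real.sinh (x * L))) / x ^ 2 := by
      field_simp; ring
    rw [e]
    have : 0 ≤ (x * L * Real.cosh (x * L)
        - Real.sinh (x * L) - k * (x ^ 2 * Real.sinh (x * L))) / x ^ 2 :=
      div_nonneg (by linarith) (by positivity)
    linarith
  have h6 : Real.exp (-L ^ 2 / 2) = Real.exp (-k) * Real.exp (k - L ^ 2 / 2) := by
    rw [← Real.exp_add]; ring_nf
  rw [h6, mul_assoc]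
  refine mul_le_mul_of_nonneg_left ?_ (Real.exp_pos _).le
  calc _ ≤ Real.exp (k - L ^ 2 / 2) * (x * _) :=
        mul_le_mul_of_nonneg_left h5 (Real.exp_pos _).le
    _ = x * (Real.exp (k - L ^ 2 / 2) * _) := by ring
    _ ≤ _ := mul_le_mul_of_nonneg_left h1 hx.le

lemma exp_neg_le_div {k : ℝ} (h0 : 0 ≤ k) (h1 : k ≤ 1) :
    Real.exp (-k) ≤ 1 - k / (1 + 3 / 5 * k) := by
  have h := Real.sum_le_exp_of_nonneg h0 4
  norm_num [Finset.sum_range_succ, Nat.factorial] at h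
  rw [Real.exp_neg, show 1 - k / (1 + 3 / 5 * k) = (1 - 2 / 5 * k) / (1 + 3 / 5 * k) by
    field_simp; ring, inv_le_comm₀ (Real.exp_pos k) (div_pos (by linarith) (by linarith)),
    inv_div, div_le_iff₀ (by linarith)]
  have h2 : 0 ≤ 1 / 10 - k / 30 - k ^ 2 / 15 := by nlinarith
  have h3 : 0 ≤ k ^ 2 * (1 / 10 - k / 30 - k ^ 2 / 15) := by positivity
  have h4 := mul_le_mul_of_nonneg_right h (by linarith : 0 ≤ 1 - 2 / 5 * k)
  linarith

/-- A lower bound for the derivative of `log (coshInt L ·)`, in a form that is nearly sharp both for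
small `x`, where the restricted normal law is almost symmetric, and for large `x`, where its mass
concentrates at `L`. -/
lemma le_sinhInt {L x : ℝ} (hL : 0 < L) (hx : 0 < x) (h : L ^ 2 ≤ 3 ∨ L ≤ x) :
    L ^ 2 * x / (3 / 2 + 3 / 5 * L ^ 2 + √(L ^ 2 * x ^ 2 + 9 / 4)) * coshInt L x ≤
      sinhInt L x := by
  set u := √(L ^ 2 * x ^ 2 + 9 / 4) with hu
  have hu0 : 0 ≤ u := Real.sqrt_nonneg _
  have hu2 : u ^ 2 = L ^ 2 * x ^ 2 + 9 / 4 := Real.sq_sqrt (by positivity)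
  have hsin : 0 < Real.sinh (x * L) := Real.sinh_pos_iff.2 (by positivity)
  set k := (x * L * Real.cosh (x * L) - Real.sinh (x * L)) / (x ^ 2 * Real.sinh (x * L)) with hk
  have hkl : L ^ 2 / (u + 3 / 2) ≤ k := by
    rw [hk, div_le_div_iff₀ (by positivity) (by positivity)]
    have h2 := sqrt_sub_half_mul_sinh_le (by positivity : 0 ≤ x * L)
    rw [show (x * L) ^ 2 + 9 / 4 = L ^ 2 * x ^ 2 + 9 / 4 by ring, ← hu] at h2
    have h3 := mul_le_mul_of_nonneg_right h2 (by positivity : 0 ≤ u + 3 / 2)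
    have h4 : L ^ 2 * (x ^ 2 * Real.sinh (x * L)) = (u ^ 2 - 9 / 4) * Real.sinh (x * L) := by
      rw [hu2]; ring
    rw [h4]
    linarith
  have hk1 : k ≤ 1 := by
    rw [hk, div_le_one (by positivity)]
    rcases h with h | h
    · have := mul_cosh_le (by positivity : 0 ≤ x * L)
      have h2 : (x * L) ^ 2 * Real.sinh (x * L) / 3 ≤ x ^ 2 * Real.sinh (x * L) := by
        have := mul_le_mul_of_nonneg_right h (by positivity : 0 ≤ x ^ 2 * Real.sinh (x * L))
        linarith
      linarith
    · have h1 : x * L * (Real.cosh (x * L) - Real.sinh (x * L)) ≤ Real.sinh (x * L) := by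
        rw [Real.cosh_sub_sinh, Real.sinh_eq]
        have h3 := Real.add_one_le_exp (2 * (x * L))
        have h4 : Real.exp (x * L) = Real.exp (2 * (x * L)) * Real.exp (-(x * L)) := by
          rw [← Real.exp_add]; ring_nf
        rw [h4]
        have := mul_le_mul_of_nonneg_right h3 (Real.exp_pos (-(x * L))).le
        linarith
      have h2 : x * L * Real.sinh (x * L) ≤ x ^ 2 * Real.sinh (x * L) := by
        have := mul_le_mul_of_nonneg_left h (by positivity : 0 ≤ x * Real.sinh (x * L))
        linarith
      linarith
  have hk0 : 0 < k := lt_of_lt_of_le (by positivity) hkl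
  have hkA : L ^ 2 / (3 / 2 + 3 / 5 * L ^ 2 + u) ≤ k / (1 + 3 / 5 * k) := by
    rw [div_le_iff₀ (by positivity)] at hkl
    rw [div_le_div_iff₀ (by positivity) (by positivity)]
    linarith
  have hC := coshInt_pos hL x
  have hJ := exp_mul_sinh_le hL hx (k := k) (by rw [hk]; field_simp; rfl)
  have hE := mul_le_mul_of_nonneg_right (exp_neg_le_div hk0.le hk1)
    (by positivity : 0 ≤ x * coshInt L x)
  have hF := mul_le_mul_of_nonneg_right hkA (by positivity : 0 ≤ x * coshInt L x)
  have e : L ^ 2 * x / (3 / 2 + 3 / 5 * L ^ 2 + u) * coshInt L x =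
      L ^ 2 / (3 / 2 + 3 / 5 * L ^ 2 + u) * (x * coshInt L x) := by ring
  rw [sinhInt_eq, e]
  linarith

lemma abs_sub_le_add {m c : ℝ} (hm : 0 < m) (hc : 0 ≤ c) : |m - c| ≤ m + c :=
  abs_le.2 ⟨by linarith, by linarith⟩

/-- The log likelihood ratio of an interval with centre `c ≥ 0` is at most `c`; the deficit is the
mean slope of `log (coshInt L ·)` between `|m - c|` and `m + c`, by `llr_center`. -/
lemma llr_center_le {m c L : ℝ} (hm : 0 < m) (hc : 0 ≤ c) (hL : 0 < L) :
    llr m (c - L) (c + L) ≤ c := by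
  rw [llr_center hm hL]
  have h := sub_le_sub_of_deriv_le (abs_sub_le_add hm hc)
    (fun x _ => hasDerivAt_const x (0 : ℝ)) (fun x _ => hasDerivAt_log_coshInt hL x)
    fun x hx => by
      have hx0 : 0 < x := (abs_nonneg _).trans_lt hx.1
      refine div_nonneg ?_ (coshInt_pos hL x).le
      refine intervalIntegral.integral_nonneg hL.le fun s hs => ?_
      have := hs.1
      have := Real.sinh_nonneg_iff.2 (mul_nonneg hx0.le hs.1)
      positivity
  have : 0 ≤ (Real.log (coshInt L (m + c)) - Real.log (coshInt L |m - c|)) / (2 * m) :=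
    div_nonneg (by linarith) (by positivity)
  linarith

lemma le_llr_center_sq {m c L : ℝ} (hm : 0 < m) (hc : 0 ≤ c) (hL : 0 < L) :
    c * (1 - L ^ 2 / 3) ≤ llr m (c - L) (c + L) := by
  rw [llr_center hm hL]
  have h := sub_le_sub_of_deriv_le (abs_sub_le_add hm hc)
    (fun x _ => hasDerivAt_log_coshInt hL x)
    (fun x _ => ((hasDerivAt_pow 2 x).const_mul (L ^ 2 / 6)))
    fun x hx => by
      have hx0 : 0 < x := (abs_nonneg _).trans_lt hx.1
      rw [div_le_iff₀ (coshInt_pos hL x)]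
      refine (sinhInt_le_sq_mul_coshInt hL.le hx0).trans_eq ?_
      push_cast
      ring
  have h2 : (Real.log (coshInt L (m + c)) - Real.log (coshInt L |m - c|)) / (2 * m) ≤
      c * (L ^ 2 / 3) := by
    rw [div_le_iff₀ (by positivity)]
    rw [sq_abs] at h
    linarith
  linarith

lemma le_llr_center_div {m c L : ℝ} (hm : 0 < m) (hc : 0 ≤ c) (hL : 0 < L) :
    c * (1 - L / m) ≤ llr m (c - L) (c + L) := by
  rw [llr_center hm hL]
  have h := sub_le_sub_of_deriv_le (abs_sub_le_add hm hc)
    (fun x _ => hasDerivAt_log_coshInt hL x)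
    (fun x _ => ((hasDerivAt_id x).const_mul L))
    fun x hx => by
      rw [div_le_iff₀ (coshInt_pos hL x)]
      refine (sinhInt_le_mul_coshInt hL.le).trans_eq ?_
      ring
  have h2 : (Real.log (coshInt L (m + c)) - Real.log (coshInt L |m - c|)) / (2 * m) ≤
      c * (L / m) := by
    rw [div_le_iff₀ (by positivity)]
    have h3 : L * (m + c - |m - c|) ≤ L * (2 * c) := by
      refine mul_le_mul_of_nonneg_left ?_ hL.le
      linarith [le_abs_self (m - c)]
    have : c * (L / m) * (2 * m) = L * (2 * c) := by field_simp
    simp only [id] at h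
    linarith
  linarith

/-- An upper bound for the log likelihood ratio of an interval with centre `c`. The auxiliary
number `q` makes the condition polynomial. -/
lemma llr_center_le_of_sq_le {m c L q : ℝ} (hm : 0 < m) (hc : 0 ≤ c) (hL : 0 < L) (hq : 0 < q)
    (hLm : L ^ 2 ≤ 3 ∨ c + L ≤ m) (h : m ^ 2 + c ^ 2 + 3 * q ≤ L ^ 2 * q ^ 2) :
    llr m (c - L) (c + L) ≤ c * (1 - 1 / (q + 3 / 5)) := by
  rw [llr_center hm hL]
  set A := 3 / 2 + 3 / 5 * L ^ 2 with hA
  set v := √(L ^ 2 * (m ^ 2 + c ^ 2) + 9 / 4) with hv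
  have hv2 : v ^ 2 = L ^ 2 * (m ^ 2 + c ^ 2) + 9 / 4 := Real.sq_sqrt (by positivity)
  have hv0 : 0 < v := Real.sqrt_pos.2 (by positivity)
  have hA0 : 0 < A := by positivity
  -- the tangent of `1 / (A + ·)` at `v`, and the bound `u ≤ (u² + v²) / (2 v)`
  have htan : ∀ u : ℝ, 0 ≤ u →
      2 / (A + v) - (A + (u ^ 2 + v ^ 2) / (2 * v)) / (A + v) ^ 2 ≤ 1 / (A + u) := by
    intro u hu
    have h1 : u ≤ (u ^ 2 + v ^ 2) / (2 * v) := by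
      rw [le_div_iff₀ (by positivity)]; nlinarith [sq_nonneg (u - v)]
    have h2 : 2 / (A + v) - (A + u) / (A + v) ^ 2 ≤ 1 / (A + u) := by
      rw [← sub_nonneg]
      have : 1 / (A + u) - (2 / (A + v) - (A + u) / (A + v) ^ 2) =
          (u - v) ^ 2 / ((A + u) * (A + v) ^ 2) := by field_simp; ring
      rw [this]; positivity
    have h3 : (A + u) / (A + v) ^ 2 ≤ (A + (u ^ 2 + v ^ 2) / (2 * v)) / (A + v) ^ 2 := by gcongr
    linarith
  set α := 2 / (A + v) - (A + (9 / 4 + v ^ 2) / (2 * v)) / (A + v) ^ 2 with hα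
  set β := L ^ 2 / (2 * v * (A + v) ^ 2) with hβ
  have hαβ : ∀ x : ℝ, α - β * x ^ 2 =
      2 / (A + v) - (A + (L ^ 2 * x ^ 2 + 9 / 4 + v ^ 2) / (2 * v)) / (A + v) ^ 2 := by
    intro x; rw [hα, hβ]; field_simp; ring
  have hinc := sub_le_sub_of_deriv_le (abs_sub_le_add hm hc)
    (fun x _ => (((hasDerivAt_pow 2 x).const_mul (L ^ 2 * α / 2))).sub
      ((hasDerivAt_pow 4 x).const_mul (L ^ 2 * β / 4)))
    (fun x _ => hasDerivAt_log_coshInt hL x)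
    fun x hx => by
      have hx0 : 0 < x := (abs_nonneg _).trans_lt hx.1
      have hLx : L ^ 2 ≤ 3 ∨ L ≤ x := hLm.imp id fun h => by
        linarith [le_abs_self (m - c), hx.1]
      rw [le_div_iff₀ (coshInt_pos hL x)]
      refine le_trans ?_ (le_sinhInt hL hx0 hLx)
      refine mul_le_mul_of_nonneg_right ?_ (coshInt_pos hL x).le
      have h1 := htan (√(L ^ 2 * x ^ 2 + 9 / 4)) (Real.sqrt_nonneg _)
      rw [Real.sq_sqrt (by positivity), ← hαβ] at h1
      have h2 := mul_le_mul_of_nonneg_left h1 (by positivity : 0 ≤ L ^ 2 * x)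
      rw [← hA]
      calc _ = L ^ 2 * x * (α - β * x ^ 2) := by push_cast; ring
        _ ≤ _ := h2
        _ = _ := by ring
  have hval : α - β * (m ^ 2 + c ^ 2) = 1 / (A + v) := by
    rw [hα, hβ]
    have : L ^ 2 * (m ^ 2 + c ^ 2) = v ^ 2 - 9 / 4 := by linarith
    have e : L ^ 2 / (2 * v * (A + v) ^ 2) * (m ^ 2 + c ^ 2) =
        (v ^ 2 - 9 / 4) / (2 * v * (A + v) ^ 2) := by rw [← this]; ring
    rw [e]; field_simp; ring
  have hq2 : 1 / (q + 3 / 5) ≤ L ^ 2 / (A + v) := by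
    rw [div_le_div_iff₀ (by positivity) (by positivity)]
    have hLq : 3 ≤ L ^ 2 * q := by
      have : 3 * q ≤ L ^ 2 * q * q := by nlinarith [sq_nonneg m, sq_nonneg c]
      exact le_of_mul_le_mul_right this hq
    have : v ≤ L ^ 2 * q - 3 / 2 := by
      refine le_of_sq_le_sq ?_ (by linarith)
      rw [hv2]
      have := mul_le_mul_of_nonneg_left h (sq_nonneg L)
      linarith
    rw [hA]; linarith
  have habs4 : |m - c| ^ 4 = (m - c) ^ 4 := by
    rw [show (4 : ℕ) = 2 * 2 from rfl, pow_mul, pow_mul, sq_abs]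
  simp only [Pi.sub_apply, sq_abs, habs4] at hinc
  have hmain : c * (L ^ 2 / (A + v)) ≤
      (Real.log (coshInt L (m + c)) - Real.log (coshInt L |m - c|)) / (2 * m) := by
    rw [le_div_iff₀ (by positivity)]
    calc c * (L ^ 2 / (A + v)) * (2 * m) = c * L ^ 2 * (2 * m) * (α - β * (m ^ 2 + c ^ 2)) := by
          rw [hval]; ring
      _ = _ := by ring
      _ ≤ _ := hinc
  have := mul_le_mul_of_nonneg_left hq2 hc
  linarith

/-! ### The hazard rate of the normal distribution -/

/-- The hazard rate (inverse Mills ratio) of the standard normal distribution. -/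
def hazard (y : ℝ) : ℝ := nphi y / ncdf (-y)

lemma hazard_pos (y : ℝ) : 0 < hazard y := div_pos (nphi_pos y) (ncdf_pos _)

lemma hazard_mul (y : ℝ) : hazard y * ncdf (-y) = nphi y := by
  unfold hazard; field_simp [(ncdf_pos (-y)).ne']

lemma hasDerivAt_ncdf_neg (y : ℝ) : HasDerivAt (fun y => ncdf (-y)) (-nphi y) y := by
  have := (hasDerivAt_ncdf (-y)).comp y (hasDerivAt_neg y)
  exact this.congr_deriv (by rw [nphi_neg]; ring)

lemma hasDerivAt_hazard (y : ℝ) : HasDerivAt hazard (hazard y * (hazard y - y)) y := by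
  have h0 := (ncdf_pos (-y)).ne'
  have := (hasDerivAt_nphi y).div (hasDerivAt_ncdf_neg y) h0
  refine this.congr_deriv ?_
  unfold hazard
  field_simp
  ring

lemma tendsto_nphi_atTop : Tendsto nphi atTop (𝓝 0) := by
  have h : Tendsto (fun x : ℝ => -x ^ 2 / 2) atTop atBot := by
    have : Tendsto (fun x : ℝ => x ^ 2 / 2) atTop atTop :=
      (tendsto_pow_atTop two_ne_zero).atTop_div_const two_pos
    refine (tendsto_neg_atTop_atBot.comp this).congr fun x => ?_
    simp; ring
  have := (Real.tendsto_exp_atBot.comp h).const_mul (√(2 * Real.pi))⁻¹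
  rw [mul_zero] at this
  exact this

lemma tendsto_ncdf_neg : Tendsto (fun y => ncdf (-y)) atTop (𝓝 0) := by
  simp only [ncdf_neg]
  simpa using tendsto_ncdf_atTop.const_sub 1

/-- An upper bound for the normal tail by a supersolution. -/
lemma ncdf_neg_le {R R' : ℝ → ℝ} {y : ℝ} (hR : ∀ t, y ≤ t → HasDerivAt R (R' t) t)
    (h0 : ∀ t, y ≤ t → 0 ≤ R t) (h : ∀ t, y ≤ t → 1 ≤ t * R t - R' t) :
    ncdf (-y) ≤ nphi y * R y := by
  have key : ∀ b, y ≤ b → ncdf b - ncdf y ≤ nphi y * R y := by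
    intro b hb
    have := sub_le_sub_of_deriv_le hb (fun x _ => hasDerivAt_ncdf x)
      (fun x hx => ((hasDerivAt_nphi x).mul (hR x hx.1)).neg) fun x hx => by
        have := mul_le_mul_of_nonneg_left (h x hx.1.le) (nphi_pos x).le
        linarith
    have h2 := mul_nonneg (nphi_pos b).le (h0 b hb)
    simp only [Pi.neg_apply, Pi.mul_apply] at this
    linarith
  rw [ncdf_neg]
  refine le_of_tendsto (tendsto_ncdf_atTop.sub_const (ncdf y)) ?_
  filter_upwards [eventually_ge_atTop y] with b hb using key b hb

/-- A lower bound for the normal tail by a subsolution. -/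
lemma le_ncdf_neg {R R' : ℝ → ℝ} {y : ℝ} (hR : ∀ t, y ≤ t → HasDerivAt R (R' t) t)
    (h1 : ∀ t, y ≤ t → R t ≤ 1) (h : ∀ t, y ≤ t → t * R t - R' t ≤ 1) :
    nphi y * R y ≤ ncdf (-y) := by
  have key : ∀ b, y ≤ b → nphi y * R y - nphi b ≤ ncdf b - ncdf y := by
    intro b hb
    have := sub_le_sub_of_deriv_le hb
      (fun x hx => ((hasDerivAt_nphi x).mul (hR x hx.1)).neg) (fun x _ => hasDerivAt_ncdf x)
      fun x hx => by
        have := mul_le_mul_of_nonneg_left (h x hx.1.le) (nphi_pos x).le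
        linarith
    have h2 := mul_le_mul_of_nonneg_left (h1 b hb) (nphi_pos b).le
    simp only [Pi.neg_apply, Pi.mul_apply] at this
    linarith
  rw [ncdf_neg]
  refine le_of_tendsto_of_tendsto (f := fun b => nphi y * R y - nphi b) ?_
    (tendsto_ncdf_atTop.sub_const (ncdf y)) ?_
  · simpa using tendsto_nphi_atTop.const_sub (nphi y * R y)
  · filter_upwards [eventually_ge_atTop y] with b hb using key b hb

lemma le_hazard {y : ℝ} (hy : 0 < y) : y + y / (y ^ 2 + 2) ≤ hazard y := by
  have h := ncdf_neg_le (y := y) (R := fun t => (t ^ 2 + 2) / (t ^ 3 + 3 * t))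
    (R' := fun t => (2 * t * (t ^ 3 + 3 * t) - (t ^ 2 + 2) * (3 * t ^ 2 + 3)) / (t ^ 3 + 3 * t) ^ 2)
    (fun t ht => by
      have h0 : 0 < t := hy.trans_le ht
      have := ((hasDerivAt_pow 2 t).add_const 2).div
        ((hasDerivAt_pow 3 t).add ((hasDerivAt_id t).const_mul 3))
        (by simp only [id, Pi.add_apply]; positivity)
      exact this.congr_deriv (by simp))
    (fun t ht => by have h0 : 0 < t := hy.trans_le ht
                    positivity)
    (fun t ht => by
      have h0 : 0 < t := hy.trans_le ht
      have e : t * ((t ^ 2 + 2) / (t ^ 3 + 3 * t)) - (2 * t * (t ^ 3 + 3 * t) -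
          (t ^ 2 + 2) * (3 * t ^ 2 + 3)) / (t ^ 3 + 3 * t) ^ 2 =
          1 + 6 / (t ^ 3 + 3 * t) ^ 2 := by
        field_simp; ring
      rw [e]
      have : 0 ≤ 6 / (t ^ 3 + 3 * t) ^ 2 := by positivity
      linarith)
  rw [hazard, le_div_iff₀ (ncdf_pos _)]
  have h2 := mul_le_mul_of_nonneg_left h (by positivity : 0 ≤ y + y / (y ^ 2 + 2))
  refine h2.trans_eq ?_
  field_simp
  ring

lemma hazard_le {y : ℝ} (hy : 0 < y) : hazard y ≤ y + 1 / y := by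
  have h := le_ncdf_neg (y := y) (R := fun t => t / (1 + t ^ 2))
    (R' := fun t => (1 * (1 + t ^ 2) - t * (2 * t)) / (1 + t ^ 2) ^ 2)
    (fun t ht => by
      have := (hasDerivAt_id t).div ((hasDerivAt_pow 2 t).const_add 1) (by positivity)
      exact this.congr_deriv (by simp))
    (fun t ht => by
      rw [div_le_one (by positivity)]
      nlinarith [sq_nonneg (t - 1)])
    (fun t ht => by
      have e : t * (t / (1 + t ^ 2)) - (1 * (1 + t ^ 2) - t * (2 * t)) / (1 + t ^ 2) ^ 2 =
          1 - 2 / (1 + t ^ 2) ^ 2 := by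
        field_simp; ring
      rw [e]
      have : 0 ≤ 2 / (1 + t ^ 2) ^ 2 := by positivity
      linarith)
  rw [hazard, div_le_iff₀ (ncdf_pos _)]
  have h2 := mul_le_mul_of_nonneg_left h (by positivity : 0 ≤ y + 1 / y)
  refine le_trans (le_of_eq ?_) h2
  field_simp
  ring

lemma lt_hazard (y : ℝ) : y < hazard y := by
  rcases le_or_gt y 0 with h | h
  · exact h.trans_lt (hazard_pos y)
  · have := le_hazard h
    have : 0 < y / (y ^ 2 + 2) := by positivity
    linarith

lemma hazard_deriv_pos (y : ℝ) : 0 < hazard y * (hazard y - y) :=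
  mul_pos (hazard_pos y) (sub_pos.2 (lt_hazard y))

/-- The hazard rate has slope at most one: `(r' - 1) Φ(-y)` increases to `0`. -/
lemma hazard_deriv_le_one (y : ℝ) : hazard y * (hazard y - y) ≤ 1 := by
  set g : ℝ → ℝ := fun y => nphi y * (hazard y - y) - ncdf (-y) with hg
  have hd : ∀ y, HasDerivAt g (ncdf (-y) * (hazard y * (hazard y - y)) * (hazard y - y)) y := by
    intro y
    have := ((hasDerivAt_nphi y).mul ((hasDerivAt_hazard y).sub (hasDerivAt_id y))).sub
      (hasDerivAt_ncdf_neg y)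
    refine this.congr_deriv ?_
    simp only [Pi.sub_apply, id]
    rw [← hazard_mul y]
    ring
  have hmono : Monotone g := monotone_of_hasDerivAt_nonneg hd fun y =>
    mul_nonneg (mul_nonneg (ncdf_pos _).le (hazard_deriv_pos y).le) (sub_pos.2 (lt_hazard y)).le
  have hlim : Tendsto (fun y => nphi y - ncdf (-y)) atTop (𝓝 0) := by
    simpa using tendsto_nphi_atTop.sub tendsto_ncdf_neg
  have hle : g y ≤ 0 := by
    refine ge_of_tendsto hlim ?_
    filter_upwards [eventually_ge_atTop y, eventually_ge_atTop 1] with z hz hz1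
    refine (hmono hz).trans ?_
    have h1 : hazard z - z ≤ 1 := by
      have := hazard_le (by linarith : 0 < z)
      have : 1 / z ≤ 1 := by rw [div_le_one (by linarith)]; exact hz1
      linarith
    have := mul_le_mul_of_nonneg_left h1 (nphi_pos z).le
    simp only [hg]
    linarith
  have h2 := ncdf_pos (-y)
  have h3 : g y = (hazard y * (hazard y - y) - 1) * ncdf (-y) := by
    simp only [hg]
    rw [← hazard_mul y]; ring
  rw [h3] at hle
  by_contra hc
  push Not at hc
  nlinarith

/-- The hazard rate is convex: `r'' Φ(-y)² / φ(y)` decreases to `0`. -/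
lemma monotone_hazard_deriv : Monotone fun y => hazard y * (hazard y - y) := by
  set k : ℝ → ℝ := fun y => (hazard y - y) ^ 2 + hazard y * (hazard y - y) - 1 with hk
  have hd2 : ∀ y, HasDerivAt (fun y => hazard y * (hazard y - y)) (hazard y * k y) y := by
    intro y
    have := (hasDerivAt_hazard y).mul ((hasDerivAt_hazard y).sub (hasDerivAt_id y))
    exact this.congr_deriv (by simp only [hk, Pi.sub_apply, id]; ring)
  have hdk : ∀ y, HasDerivAt (fun y => k y * ncdf (-y))
      (2 * (hazard y - y) * (hazard y * (hazard y - y) - 1) * ncdf (-y)) y := by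
    intro y
    have := ((((((hasDerivAt_hazard y).sub (hasDerivAt_id y)).pow 2).add (hd2 y)).sub_const 1).mul
      (hasDerivAt_ncdf_neg y))
    refine this.congr_deriv ?_
    simp only [hk, Pi.sub_apply, Pi.add_apply, Pi.pow_apply, id]
    rw [← hazard_mul y]
    ring
  have hanti : Antitone fun y => k y * ncdf (-y) := antitone_of_hasDerivAt_nonpos hdk fun y => by
    have h1 := sub_pos.2 (lt_hazard y)
    have h2 := hazard_deriv_le_one y
    have h3 := ncdf_pos (-y)
    have : 0 ≤ 2 * (hazard y - y) * ncdf (-y) * (1 - hazard y * (hazard y - y)) :=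
      mul_nonneg (by positivity) (by linarith)
    change _ ≤ (0 : ℝ)
    linarith
  refine monotone_of_hasDerivAt_nonneg hd2 fun y => mul_nonneg (hazard_pos y).le ?_
  have hlim : Tendsto (fun y => -1 * ncdf (-y)) atTop (𝓝 0) := by
    simpa using tendsto_ncdf_neg.const_mul (-1)
  have h0 : 0 ≤ k y * ncdf (-y) := by
    refine le_of_tendsto hlim ?_
    filter_upwards [eventually_ge_atTop y] with z hz
    refine le_trans ?_ (hanti hz)
    refine mul_le_mul_of_nonneg_right ?_ (ncdf_pos _).le
    have := (hazard_deriv_pos z).le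
    simp only [hk]
    nlinarith [sq_nonneg (hazard z - z)]
  exact nonneg_of_mul_nonneg_left h0 (ncdf_pos _)

/-! ### The even and the odd part of the hazard rate -/

/-- The even part of the hazard rate. -/
def hazardEven (y : ℝ) : ℝ := (hazard y + hazard (-y)) / 2

/-- The odd part of the hazard rate. -/
def hazardOdd (y : ℝ) : ℝ := (hazard y - hazard (-y)) / 2

/-- The logit `log (Φ(y) / Φ(-y)) / 2`, a primitive of `hazardEven`. -/
def halfLogit (y : ℝ) : ℝ := (Real.log (ncdf y) - Real.log (ncdf (-y))) / 2

lemma hasDerivAt_halfLogit (y : ℝ) : HasDerivAt halfLogit (hazardEven y) y := by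
  have h := (((hasDerivAt_ncdf y).log (ncdf_pos y).ne').sub
    ((hasDerivAt_ncdf_neg y).log (ncdf_pos (-y)).ne')).div_const 2
  refine h.congr_deriv ?_
  simp only [hazardEven, hazard, nphi_neg, neg_neg]
  ring

lemma hazardEven_neg (y : ℝ) : hazardEven (-y) = hazardEven y := by
  simp [hazardEven, add_comm]

lemma hasDerivAt_hazard_neg (y : ℝ) :
    HasDerivAt (fun y => hazard (-y)) (-(hazard (-y) * (hazard (-y) + y))) y := by
  have := (hasDerivAt_hazard (-y)).comp y (hasDerivAt_neg y)
  exact this.congr_deriv (by ring)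

/-- The derivative of `hazardEven`. -/
def hazardEvenDeriv (y : ℝ) : ℝ := hazardEven y * (2 * hazardOdd y - y)

lemma hazardEvenDeriv_eq (y : ℝ) : hazardEvenDeriv y =
    (hazard y * (hazard y - y) - hazard (-y) * (hazard (-y) - -y)) / 2 := by
  simp only [hazardEvenDeriv, hazardEven, hazardOdd]; ring

lemma hasDerivAt_hazardEven (y : ℝ) : HasDerivAt hazardEven (hazardEvenDeriv y) y := by
  have := ((hasDerivAt_hazard y).add (hasDerivAt_hazard_neg y)).div_const 2
  refine this.congr_deriv ?_
  rw [hazardEvenDeriv_eq]; ring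

lemma hazardEvenDeriv_le_half (y : ℝ) : hazardEvenDeriv y ≤ 1 / 2 := by
  rw [hazardEvenDeriv_eq]
  linarith [hazard_deriv_le_one y, hazard_deriv_pos (-y)]

lemma monotone_hazardEvenDeriv : Monotone hazardEvenDeriv := by
  intro x y h
  rw [hazardEvenDeriv_eq, hazardEvenDeriv_eq]
  have h1 := monotone_hazard_deriv h
  have h2 := monotone_hazard_deriv (neg_le_neg h)
  simp only at h1 h2
  linarith

/-! ### An integral representation -/

/-- The integral `∫₀¹ exp (-y² s² / 2) / (1 + s²) ds`, equal to `π exp (y² / 2) Φ(y) Φ(-y)`. -/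
def owenInt (y : ℝ) : ℝ := ∫ s in (0 : ℝ)..1, Real.exp (-(y * s) ^ 2 / 2) / (1 + s ^ 2)

/-- The integral `∫₀¹ exp (-y² s² / 2) ds`. -/
def gaussInt (y : ℝ) : ℝ := ∫ s in (0 : ℝ)..1, Real.exp (-(y * s) ^ 2 / 2)

lemma continuous_owen (y : ℝ) :
    Continuous fun s : ℝ => Real.exp (-(y * s) ^ 2 / 2) / (1 + s ^ 2) :=
  Continuous.div (by fun_prop) (by fun_prop) fun s => by positivity

lemma owenInt_pos (y : ℝ) : 0 < owenInt y :=
  intervalIntegral.intervalIntegral_pos_of_pos ((continuous_owen y).intervalIntegrable _ _)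
    (fun s => by positivity) one_pos

lemma hasDerivAt_owenInt (y : ℝ) : HasDerivAt owenInt (-y * (gaussInt y - owenInt y)) y := by
  have h := hasDerivAt_integral_param (a := 0) (b := 1) (x := y)
    (f := fun y s => Real.exp (-(y * s) ^ 2 / 2) / (1 + s ^ 2))
    (f' := fun y s => -y * (s ^ 2 * Real.exp (-(y * s) ^ 2 / 2) / (1 + s ^ 2)))
    continuous_owen
    (Continuous.mul (by fun_prop) (Continuous.div (by fun_prop) (by fun_prop)
      fun p => by positivity)) fun y s => by
        have := (((((hasDerivAt_id y).mul_const s).pow 2).neg.div_const 2).exp).div_const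
          (1 + s ^ 2)
        exact this.congr_deriv (by simp; ring)
  refine h.congr_deriv ?_
  rw [intervalIntegral.integral_const_mul, gaussInt, owenInt, ← intervalIntegral.integral_sub
    (Continuous.intervalIntegrable (by fun_prop) _ _) ((continuous_owen y).intervalIntegrable _ _)]
  congr 1
  refine intervalIntegral.integral_congr fun s _ => ?_
  have : (1 : ℝ) + s ^ 2 ≠ 0 := by positivity
  field_simp
  ring

lemma ncdf_sub_half (y : ℝ) : ncdf y - 1 / 2 = y * ((√(2 * Real.pi))⁻¹ * gaussInt y) := by
  rw [← ncdf_zero, ← integral_nphi]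
  have := intervalIntegral.mul_integral_comp_mul_left (a := 0) (b := 1) (f := nphi) y
  rw [mul_zero, mul_one] at this
  rw [← this, gaussInt, ← intervalIntegral.integral_const_mul (√(2 * Real.pi))⁻¹]
  rfl

lemma owenInt_zero : owenInt 0 = Real.pi / 4 := by
  simp only [owenInt]
  simp

lemma nphi_sq (y : ℝ) : nphi y * (√(2 * Real.pi))⁻¹ = Real.exp (-y ^ 2 / 2) / (2 * Real.pi) := by
  have h : √(2 * Real.pi) ^ 2 = 2 * Real.pi := Real.sq_sqrt (by positivity)
  have h2 : 2 * Real.pi ≠ 0 := by positivity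
  have h3 : √(2 * Real.pi) ≠ 0 := by positivity
  rw [nphi, eq_div_iff h2]
  nth_rewrite 3 [← h]
  field_simp

/-- Owen's integral for the product of the two tails: both sides have the same derivative and agree
at `0`. -/
lemma ncdf_mul_ncdf_neg (y : ℝ) :
    ncdf y * ncdf (-y) = Real.exp (-y ^ 2 / 2) * owenInt y / Real.pi := by
  have hd : ∀ y, HasDerivAt (fun y => ncdf y * ncdf (-y) -
      Real.exp (-y ^ 2 / 2) * owenInt y / Real.pi) 0 y := by
    intro y
    have h1 := (((hasDerivAt_pow 2 y).neg.div_const 2).exp.mul (hasDerivAt_owenInt y)).div_const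
      Real.pi
    have h2 := ((hasDerivAt_ncdf y).mul (hasDerivAt_ncdf_neg y)).sub h1
    refine h2.congr_deriv ?_
    have e := ncdf_sub_half y
    have e2 := nphi_sq y
    have e3 : nphi y * ncdf (-y) + ncdf y * -nphi y =
        -2 * y * gaussInt y * (nphi y * (√(2 * Real.pi))⁻¹) := by
      rw [ncdf_neg, show ncdf y = 1 / 2 + y * ((√(2 * Real.pi))⁻¹ * gaussInt y) by linarith]
      ring
    rw [e3, e2]
    simp
    field_simp
    ring
  have hc := is_const_of_deriv_eq_zero (fun y => (hd y).differentiableAt)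
    (fun y => (hd y).deriv) y 0
  simp only [neg_zero, ncdf_zero, owenInt_zero] at hc
  have : (1 / 2 : ℝ) * (1 / 2) - Real.exp (-0 ^ 2 / 2) * (Real.pi / 4) / Real.pi = 0 := by
    norm_num [Real.pi_ne_zero]
    field_simp
    norm_num
  linarith

/-- The even part of the hazard rate as the reciprocal of an integral, which makes its monotonicity
and its comparison with `hazardOdd` accessible. -/
lemma hazardEven_eq (y : ℝ) : hazardEven y = √(Real.pi / 8) / owenInt y := by
  have h1 := (ncdf_pos y).ne'
  have h2 := (ncdf_pos (-y)).ne'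
  have h3 := (owenInt_pos y).ne'
  have e : hazardEven y = nphi y / (2 * (ncdf y * ncdf (-y))) := by
    have : ncdf y + ncdf (-y) = 1 := by rw [ncdf_neg]; ring
    simp only [hazardEven, hazard, nphi_neg, neg_neg]
    field_simp
    rw [this, mul_one]
  have hs : √(Real.pi / 8) * (√(2 * Real.pi)) = Real.pi / 2 := by
    rw [← Real.sqrt_mul (by positivity), show Real.pi / 8 * (2 * Real.pi) = (Real.pi / 2) ^ 2 by
      ring, Real.sqrt_sq (by positivity)]
  have hp : √(2 * Real.pi) ≠ 0 := by positivity
  rw [e, ncdf_mul_ncdf_neg, nphi]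
  field_simp
  linarith

lemma two_mul_hazardOdd (y : ℝ) : 2 * hazardOdd y = y * (gaussInt y / owenInt y) := by
  have h1 := (ncdf_pos y).ne'
  have h2 := (ncdf_pos (-y)).ne'
  have h3 := (owenInt_pos y).ne'
  have e : 2 * hazardOdd y * (ncdf y * ncdf (-y)) = 2 * nphi y * (ncdf y - 1 / 2) := by
    have : ncdf y + ncdf (-y) = 1 := by rw [ncdf_neg]; ring
    simp only [hazardOdd, hazard, nphi_neg, neg_neg]
    field_simp
    linear_combination (-nphi y) * this
  rw [ncdf_mul_ncdf_neg, ncdf_sub_half] at e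
  have e2 := nphi_sq y
  have e4 : 2 * nphi y * (y * ((√(2 * Real.pi))⁻¹ * gaussInt y)) =
      2 * y * gaussInt y * (nphi y * (√(2 * Real.pi))⁻¹) := by ring
  rw [e4, e2] at e
  field_simp at e
  field_simp
  linarith

/-- The relative excess of `2 * hazardOdd y` over `y`. -/
def oddExcess (y : ℝ) : ℝ := gaussInt y / owenInt y - 1

lemma two_mul_hazardOdd_sub (y : ℝ) : 2 * hazardOdd y - y = y * oddExcess y := by
  rw [two_mul_hazardOdd, oddExcess]; ring

lemma hazardEvenDeriv_eq_mul (y : ℝ) : hazardEvenDeriv y = hazardEven y * (y * oddExcess y) := by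
  rw [hazardEvenDeriv, two_mul_hazardOdd_sub]

lemma oddExcess_nonneg (y : ℝ) : 0 ≤ oddExcess y := by
  rw [oddExcess, sub_nonneg, one_le_div (owenInt_pos y)]
  refine intervalIntegral.integral_mono_on zero_le_one
    ((continuous_owen y).intervalIntegrable _ _)
    (Continuous.intervalIntegrable (by fun_prop) _ _) fun s _ => ?_
  exact div_le_self (Real.exp_pos _).le (by nlinarith [sq_nonneg s])

lemma oddExcess_neg (y : ℝ) : oddExcess (-y) = oddExcess y := by
  simp [oddExcess, gaussInt, owenInt]

/-- `gaussInt / owenInt` decreases, by Chebyshev's inequality. -/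
lemma oddExcess_anti {x y : ℝ} (hx : 0 ≤ x) (hxy : x ≤ y) : oddExcess y ≤ oddExcess x := by
  have hxy2 : x ^ 2 ≤ y ^ 2 := by gcongr
  have h := integral_mul_integral_le (a := 0) (b := 1) zero_le_one
    (f := fun s => 1 + s ^ 2) (g := fun s => -Real.exp (-((y ^ 2 - x ^ 2) * s ^ 2) / 2))
    (v := fun s => Real.exp (-(x * s) ^ 2 / 2) / (1 + s ^ 2)) (by fun_prop) (by fun_prop)
    (continuous_owen x) (fun s _ => by positivity) (fun s hs t ht => by
      have hmul : ∀ a b : ℝ, 0 ≤ a → a ≤ b →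
          -Real.exp (-((y ^ 2 - x ^ 2) * a ^ 2) / 2) ≤
            -Real.exp (-((y ^ 2 - x ^ 2) * b ^ 2) / 2) := by
        intro a b ha hab
        have h1 : 0 ≤ y ^ 2 - x ^ 2 := sub_nonneg.2 hxy2
        have : (y ^ 2 - x ^ 2) * a ^ 2 ≤ (y ^ 2 - x ^ 2) * b ^ 2 := by gcongr
        refine neg_le_neg (Real.exp_le_exp.2 ?_)
        linarith
      rcases le_total s t with h | h
      · have h1 := hmul s t hs.1 h
        have h2 : s ^ 2 ≤ t ^ 2 := pow_le_pow_left₀ hs.1 h 2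
        exact mul_nonneg_of_nonpos_of_nonpos (by linarith) (by linarith)
      · have h1 := hmul t s ht.1 h
        have h2 : t ^ 2 ≤ s ^ 2 := pow_le_pow_left₀ ht.1 h 2
        exact mul_nonneg (by linarith) (by linarith))
  have e1 : ∫ s in (0 : ℝ)..1, (1 + s ^ 2) * (Real.exp (-(x * s) ^ 2 / 2) / (1 + s ^ 2)) =
      gaussInt x := by
    refine intervalIntegral.integral_congr fun s _ => ?_
    have : (1 : ℝ) + s ^ 2 ≠ 0 := by positivity
    field_simp
  have hexp : ∀ s : ℝ, Real.exp (-((y ^ 2 - x ^ 2) * s ^ 2) / 2) * Real.exp (-(x * s) ^ 2 / 2) =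
      Real.exp (-(y * s) ^ 2 / 2) := fun s => by rw [← Real.exp_add]; ring_nf
  have e2 : ∫ s in (0 : ℝ)..1, -Real.exp (-((y ^ 2 - x ^ 2) * s ^ 2) / 2) *
      (Real.exp (-(x * s) ^ 2 / 2) / (1 + s ^ 2)) = -owenInt y := by
    rw [owenInt, ← intervalIntegral.integral_neg]
    refine intervalIntegral.integral_congr fun s _ => ?_
    simp only [← hexp s]
    ring
  have e3 : ∫ s in (0 : ℝ)..1, (1 + s ^ 2) * -Real.exp (-((y ^ 2 - x ^ 2) * s ^ 2) / 2) *
      (Real.exp (-(x * s) ^ 2 / 2) / (1 + s ^ 2)) = -gaussInt y := by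
    rw [gaussInt, ← intervalIntegral.integral_neg]
    refine intervalIntegral.integral_congr fun s _ => ?_
    have : (1 : ℝ) + s ^ 2 ≠ 0 := by positivity
    simp only [← hexp s]
    field_simp
  rw [e1, e2, e3] at h
  have hx0 := owenInt_pos x
  have hy0 := owenInt_pos y
  have hfin : gaussInt y / owenInt y ≤ gaussInt x / owenInt x := by
    rw [div_le_div_iff₀ hy0 hx0]
    change _ ≤ owenInt x * _ at h
    linarith
  unfold oddExcess
  linarith

lemma oddExcess_zero : oddExcess 0 = 4 / Real.pi - 1 := by
  have : gaussInt 0 = 1 := by simp [gaussInt]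
  rw [oddExcess, this, owenInt_zero]
  field_simp

lemma oddExcess_le (y : ℝ) : oddExcess y ≤ 4 / Real.pi - 1 := by
  rw [← oddExcess_zero]
  rcases le_total 0 y with h | h
  · exact oddExcess_anti le_rfl h
  · rw [← oddExcess_neg]; exact oddExcess_anti le_rfl (by linarith)

lemma hazardEven_pos (y : ℝ) : 0 < hazardEven y := by
  have := hazard_pos y
  have := hazard_pos (-y)
  unfold hazardEven; positivity

lemma hazardEvenDeriv_nonneg {y : ℝ} (hy : 0 ≤ y) : 0 ≤ hazardEvenDeriv y := by
  rw [hazardEvenDeriv_eq_mul]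
  exact mul_nonneg (hazardEven_pos y).le (mul_nonneg hy (oddExcess_nonneg y))

lemma hazardEven_mono {x y : ℝ} (hx : 0 ≤ x) (hxy : x ≤ y) : hazardEven x ≤ hazardEven y := by
  have := sub_le_sub_of_deriv_le hxy (fun s _ => hasDerivAt_const s (0 : ℝ))
    (fun s _ => hasDerivAt_hazardEven s) fun s hs => hazardEvenDeriv_nonneg (hx.trans hs.1.le)
  linarith

/-! ### Numerical values at a few points -/

/-- The Taylor sums of `exp (-z)` are alternately above and below it. -/
lemma exp_neg_sub_sum_sign (n : ℕ) {z : ℝ} (hz : 0 ≤ z) :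
    0 ≤ (-1) ^ n * (Real.exp (-z) - ∑ k ∈ Finset.range n, (-z) ^ k / k.factorial) := by
  induction n generalizing z with
  | zero => simpa using (Real.exp_pos _).le
  | succ n ih =>
    have hS : ∀ z : ℝ, HasDerivAt (fun z : ℝ => ∑ k ∈ Finset.range (n + 1), (-z) ^ k / k.factorial)
        (-∑ k ∈ Finset.range n, (-z) ^ k / k.factorial) z := by
      intro z
      have h : HasDerivAt (fun z : ℝ => ∑ k ∈ Finset.range (n + 1), (-z) ^ k / k.factorial)
          (∑ k ∈ Finset.range (n + 1), (k * (-z) ^ (k - 1) * -1) / k.factorial) z :=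
        HasDerivAt.fun_sum fun k _ => ((hasDerivAt_neg z).fun_pow k).div_const _
      refine h.congr_deriv ?_
      rw [Finset.sum_range_succ', ← Finset.sum_neg_distrib]
      simp only [Nat.cast_zero, zero_mul, zero_div, add_zero]
      refine Finset.sum_congr rfl fun k _ => ?_
      rw [Nat.factorial_succ]
      push_cast
      have : (k.factorial : ℝ) ≠ 0 := by positivity
      have : (k : ℝ) + 1 ≠ 0 := by positivity
      field_simp
    refine nonneg_of_deriv_nonneg (f := fun z : ℝ => (-1) ^ (n + 1) *
      (Real.exp (-z) - ∑ k ∈ Finset.range (n + 1), (-z) ^ k / k.factorial))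
      (f' := fun z => (-1) ^ n * (Real.exp (-z) - ∑ k ∈ Finset.range n, (-z) ^ k / k.factorial))
      ?_ (fun z => ?_) (fun z hz => ih hz.le) hz
    · rw [Finset.sum_range_succ']; simp
    · refine (((hasDerivAt_neg z).exp.sub (hS z)).const_mul ((-1 : ℝ) ^ (n + 1))).congr_deriv ?_
      ring

/-- The moment `∫₀¹ s²ᵏ / (1 + s²) ds`. -/
def owenMoment (k : ℕ) : ℝ := ∫ s in (0 : ℝ)..1, s ^ (2 * k) / (1 + s ^ 2)

lemma continuous_owenMoment (k : ℕ) : Continuous fun s : ℝ => s ^ (2 * k) / (1 + s ^ 2) :=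
  Continuous.div (by fun_prop) (by fun_prop) fun s => by positivity

lemma owenMoment_zero : owenMoment 0 = Real.pi / 4 := by simp [owenMoment]

lemma owenMoment_succ (k : ℕ) : owenMoment (k + 1) = 1 / (2 * k + 1) - owenMoment k := by
  rw [eq_sub_iff_add_eq, owenMoment, owenMoment, ← intervalIntegral.integral_add
    ((continuous_owenMoment _).intervalIntegrable _ _)
    ((continuous_owenMoment _).intervalIntegrable _ _)]
  have h : ∫ s in (0 : ℝ)..1, (s ^ (2 * (k + 1)) / (1 + s ^ 2) + s ^ (2 * k) / (1 + s ^ 2)) =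
      ∫ s in (0 : ℝ)..1, s ^ (2 * k) := by
    refine intervalIntegral.integral_congr fun s _ => ?_
    have : (1 : ℝ) + s ^ 2 ≠ 0 := by positivity
    field_simp
    ring
  rw [h, integral_pow]
  simp

lemma owenInt_sub_sum_sign (n : ℕ) (y : ℝ) : 0 ≤ (-1) ^ n *
    (owenInt y - ∑ k ∈ Finset.range n, (-(y ^ 2 / 2)) ^ k / k.factorial * owenMoment k) := by
  have hc : ∀ k ∈ Finset.range n, IntervalIntegrable (fun s : ℝ =>
      (-(y ^ 2 / 2)) ^ k / k.factorial * (s ^ (2 * k) / (1 + s ^ 2))) volume 0 1 := fun k _ =>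
    (continuous_const.mul (continuous_owenMoment k)).intervalIntegrable _ _
  have hs : Continuous fun s : ℝ => ∑ k ∈ Finset.range n,
      (-(y ^ 2 / 2)) ^ k / k.factorial * (s ^ (2 * k) / (1 + s ^ 2)) :=
    continuous_finsetSum _ fun k _ => continuous_const.mul (continuous_owenMoment k)
  have e : owenInt y - ∑ k ∈ Finset.range n, (-(y ^ 2 / 2)) ^ k / k.factorial * owenMoment k =
      ∫ s in (0 : ℝ)..1, (Real.exp (-(y * s) ^ 2 / 2) / (1 + s ^ 2) -
        ∑ k ∈ Finset.range n, (-(y ^ 2 / 2)) ^ k / k.factorial * (s ^ (2 * k) / (1 + s ^ 2))) := by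
    rw [intervalIntegral.integral_sub ((continuous_owen y).intervalIntegrable _ _)
      (hs.intervalIntegrable _ _),
      intervalIntegral.integral_finsetSum hc]
    simp only [intervalIntegral.integral_const_mul]
    rfl
  rw [e, ← intervalIntegral.integral_const_mul]
  refine intervalIntegral.integral_nonneg zero_le_one fun s _ => ?_
  have h := exp_neg_sub_sum_sign n (z := (y * s) ^ 2 / 2) (by positivity)
  have e2 : (-1) ^ n * (Real.exp (-(y * s) ^ 2 / 2) / (1 + s ^ 2) -
      ∑ k ∈ Finset.range n, (-(y ^ 2 / 2)) ^ k / k.factorial * (s ^ (2 * k) / (1 + s ^ 2))) =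
      (-1) ^ n * (Real.exp (-((y * s) ^ 2 / 2)) -
        ∑ k ∈ Finset.range n, (-((y * s) ^ 2 / 2)) ^ k / k.factorial) / (1 + s ^ 2) := by
    rw [mul_div_assoc, sub_div, Finset.sum_div, neg_div]
    congr 3
    funext k
    rw [show -((y * s) ^ 2 / 2) = -(y ^ 2 / 2) * s ^ 2 by ring, mul_pow, ← pow_mul]
    ring
  rw [e2]
  exact div_nonneg h (by positivity)

lemma gaussInt_sub_sum_sign (n : ℕ) (y : ℝ) : 0 ≤ (-1) ^ n *
    (gaussInt y - ∑ k ∈ Finset.range n, (-(y ^ 2 / 2)) ^ k / k.factorial * (1 / (2 * k + 1))) := by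
  have hc : ∀ k ∈ Finset.range n, IntervalIntegrable (fun s : ℝ =>
      (-(y ^ 2 / 2)) ^ k / k.factorial * s ^ (2 * k)) volume 0 1 := fun k _ =>
    Continuous.intervalIntegrable (by fun_prop) _ _
  have e : gaussInt y - ∑ k ∈ Finset.range n, (-(y ^ 2 / 2)) ^ k / k.factorial * (1 / (2 * k + 1)) =
      ∫ s in (0 : ℝ)..1, (Real.exp (-(y * s) ^ 2 / 2) -
        ∑ k ∈ Finset.range n, (-(y ^ 2 / 2)) ^ k / k.factorial * s ^ (2 * k)) := by
    rw [intervalIntegral.integral_sub (Continuous.intervalIntegrable (by fun_prop) _ _)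
      (Continuous.intervalIntegrable (by fun_prop) _ _),
      intervalIntegral.integral_finsetSum hc]
    simp only [intervalIntegral.integral_const_mul, integral_pow]
    simp [gaussInt]
  rw [e, ← intervalIntegral.integral_const_mul]
  refine intervalIntegral.integral_nonneg zero_le_one fun s _ => ?_
  have h := exp_neg_sub_sum_sign n (z := (y * s) ^ 2 / 2) (by positivity)
  rw [neg_div]
  convert h using 5 with k
  rw [show -((y * s) ^ 2 / 2) = -(y ^ 2 / 2) * s ^ 2 by ring, mul_pow, ← pow_mul]
  ring

lemma owenInt_one_bounds : 0.69139 ≤ owenInt 1 ∧ owenInt 1 ≤ 0.69141 := by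
  have h1 := owenInt_sub_sum_sign 5 1
  have h2 := owenInt_sub_sum_sign 6 1
  norm_num [Finset.sum_range_succ, owenMoment_succ, owenMoment_zero, Nat.factorial] at h1 h2
  constructor <;> linarith [Real.pi_gt_d6, Real.pi_lt_d6]

lemma owenInt_three_halves_bounds : 0.60328 ≤ owenInt 1.5 ∧ owenInt 1.5 ≤ 0.60331 := by
  have h1 := owenInt_sub_sum_sign 7 1.5
  have h2 := owenInt_sub_sum_sign 8 1.5
  norm_num [Finset.sum_range_succ, owenMoment_succ, owenMoment_zero, Nat.factorial] at h1 h2 ⊢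
  constructor <;> linarith [Real.pi_gt_d6, Real.pi_lt_d6]

lemma owenInt_two_bounds : 0.51608 ≤ owenInt 2 ∧ owenInt 2 ≤ 0.51613 := by
  have h1 := owenInt_sub_sum_sign 9 2
  have h2 := owenInt_sub_sum_sign 10 2
  norm_num [Finset.sum_range_succ, owenMoment_succ, owenMoment_zero, Nat.factorial] at h1 h2
  constructor <;> linarith [Real.pi_gt_d6, Real.pi_lt_d6]

lemma gaussInt_one_bounds : 0.8556 ≤ gaussInt 1 ∧ gaussInt 1 ≤ 0.8557 := by
  have h1 := gaussInt_sub_sum_sign 5 1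
  have h2 := gaussInt_sub_sum_sign 6 1
  norm_num [Finset.sum_range_succ, Nat.factorial] at h1 h2
  constructor <;> linarith

lemma gaussInt_three_halves_bounds : 0.72389 ≤ gaussInt 1.5 ∧ gaussInt 1.5 ≤ 0.72393 := by
  have h1 := gaussInt_sub_sum_sign 7 1.5
  have h2 := gaussInt_sub_sum_sign 8 1.5
  norm_num [Finset.sum_range_succ, Nat.factorial] at h1 h2 ⊢
  constructor <;> linarith

lemma gaussInt_two_bounds : 0.5981 ≤ gaussInt 2 ∧ gaussInt 2 ≤ 0.59821 := by
  have h1 := gaussInt_sub_sum_sign 9 2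
  have h2 := gaussInt_sub_sum_sign 10 2
  norm_num [Finset.sum_range_succ, Nat.factorial] at h1 h2
  constructor <;> linarith

lemma sqrt_pi_div_eight_bounds : 0.62665 ≤ √(Real.pi / 8) ∧ √(Real.pi / 8) ≤ 0.62666 := by
  constructor
  · exact Real.le_sqrt_of_sq_le (by norm_num; linarith [Real.pi_gt_d6])
  · rw [Real.sqrt_le_left (by norm_num)]
    norm_num; linarith [Real.pi_lt_d6]

lemma hazardEven_bounds {y a b c d : ℝ} (h : a ≤ owenInt y ∧ owenInt y ≤ b) (ha : 0 < a)
    (hc : c * b ≤ 0.62665) (hc0 : 0 ≤ c) (hd : 0.62666 ≤ d * a) :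
    c ≤ hazardEven y ∧ hazardEven y ≤ d := by
  have hp := owenInt_pos y
  have hs := sqrt_pi_div_eight_bounds
  have hd0 : 0 < d := by
    by_contra hcon
    push Not at hcon
    have := mul_nonpos_of_nonpos_of_nonneg hcon ha.le
    norm_num at hd
    linarith
  rw [hazardEven_eq]
  constructor
  · rw [le_div_iff₀ hp]
    have := mul_le_mul_of_nonneg_left h.2 hc0
    linarith
  · rw [div_le_iff₀ hp]
    have := mul_le_mul_of_nonneg_left h.1 hd0.le
    linarith

lemma oddExcess_bounds {y a b a' b' c d : ℝ} (h : a ≤ owenInt y ∧ owenInt y ≤ b)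
    (h' : a' ≤ gaussInt y ∧ gaussInt y ≤ b') (hc : (1 + c) * b ≤ a') (hc0 : 0 ≤ 1 + c)
    (hd : b' ≤ (1 + d) * a) (hd0 : 0 ≤ 1 + d) : c ≤ oddExcess y ∧ oddExcess y ≤ d := by
  have hp := owenInt_pos y
  rw [oddExcess, le_sub_iff_add_le, sub_le_iff_le_add, le_div_iff₀ hp, div_le_iff₀ hp]
  have h1 := mul_le_mul_of_nonneg_left h.2 hc0
  have h2 := mul_le_mul_of_nonneg_left h.1 hd0
  constructor <;> linarith

lemma hazardEven_zero_bounds : 0.7978 ≤ hazardEven 0 ∧ hazardEven 0 ≤ 0.7979 :=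
  hazardEven_bounds (a := 0.785398) (b := 0.785399) (by
    rw [owenInt_zero]; constructor <;> norm_num <;> linarith [Real.pi_gt_d6, Real.pi_lt_d6])
    (by norm_num) (by norm_num) (by norm_num) (by norm_num)

lemma hazardEven_one_bounds : 0.9063 ≤ hazardEven 1 ∧ hazardEven 1 ≤ 0.9065 :=
  hazardEven_bounds owenInt_one_bounds (by norm_num) (by norm_num) (by norm_num) (by norm_num)

lemma hazardEven_three_halves_bounds : 1.0386 ≤ hazardEven 1.5 ∧ hazardEven 1.5 ≤ 1.039 :=
  hazardEven_bounds owenInt_three_halves_bounds (by norm_num) (by norm_num) (by norm_num)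
    (by norm_num)

lemma hazardEven_two_bounds : 1.214 ≤ hazardEven 2 ∧ hazardEven 2 ≤ 1.2145 :=
  hazardEven_bounds owenInt_two_bounds (by norm_num) (by norm_num) (by norm_num) (by norm_num)

lemma oddExcess_one_bounds : 0.2374 ≤ oddExcess 1 ∧ oddExcess 1 ≤ 0.2377 :=
  oddExcess_bounds owenInt_one_bounds gaussInt_one_bounds (by norm_num) (by norm_num)
    (by norm_num) (by norm_num)

lemma oddExcess_three_halves_bounds : 0.1998 ≤ oddExcess 1.5 ∧ oddExcess 1.5 ≤ 0.2 :=
  oddExcess_bounds owenInt_three_halves_bounds gaussInt_three_halves_bounds (by norm_num)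
    (by norm_num) (by norm_num) (by norm_num)

lemma oddExcess_two_bounds : 0.1588 ≤ oddExcess 2 ∧ oddExcess 2 ≤ 0.1592 :=
  oddExcess_bounds owenInt_two_bounds gaussInt_two_bounds (by norm_num) (by norm_num)
    (by norm_num) (by norm_num)

/-! ### Bounds for the hazard functions -/

lemma four_div_pi_sub_one_le : 4 / Real.pi - 1 ≤ 0.27324 := by
  rw [sub_le_iff_le_add, div_le_iff₀ Real.pi_pos]
  linarith [Real.pi_gt_d6]

lemma hazardEvenDeriv_le_on {x y z e b : ℝ} (hx : 0 ≤ x) (hxy : x ≤ y) (hyz : y ≤ z)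
    (he : hazardEven z ≤ e) (hb : oddExcess x ≤ b) : hazardEvenDeriv y ≤ y * (e * b) := by
  have h1 := (hazardEven_mono (hx.trans hxy) hyz).trans he
  have h2 := (oddExcess_anti hx hxy).trans hb
  have h3 := mul_le_mul h1 h2 (oddExcess_nonneg y) ((hazardEven_pos y).le.trans h1)
  have := mul_le_mul_of_nonneg_left h3 (hx.trans hxy)
  rw [hazardEvenDeriv_eq_mul]
  linarith

lemma le_hazardEvenDeriv_on {x y z e b : ℝ} (hx : 0 ≤ x) (hxy : x ≤ y) (hyz : y ≤ z)
    (he : e ≤ hazardEven x) (hb : b ≤ oddExcess z) (hb0 : 0 ≤ b) :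
    y * (e * b) ≤ hazardEvenDeriv y := by
  have h1 := he.trans (hazardEven_mono hx hxy)
  have h2 := hb.trans (oddExcess_anti (hx.trans hxy) hyz)
  have h3 := mul_le_mul h1 h2 hb0 (hazardEven_pos y).le
  have := mul_le_mul_of_nonneg_left h3 (hx.trans hxy)
  rw [hazardEvenDeriv_eq_mul]
  linarith

lemma hazardEvenDeriv_le_quarter {y : ℝ} (hy : 0 ≤ y) : hazardEvenDeriv y ≤ y / 4 := by
  rcases le_total 2 y with h2 | h2
  · linarith [hazardEvenDeriv_le_half y]
  rcases le_total 1.5 y with h15 | h15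
  · have := hazardEvenDeriv_le_on (by norm_num) h15 h2 hazardEven_two_bounds.2
      oddExcess_three_halves_bounds.2
    linarith
  rcases le_total 1 y with h1 | h1
  · have := hazardEvenDeriv_le_on (by norm_num) h1 h15 hazardEven_three_halves_bounds.2
      oddExcess_one_bounds.2
    linarith
  · have := hazardEvenDeriv_le_on le_rfl hy h1 hazardEven_one_bounds.2
      ((oddExcess_le 0).trans four_div_pi_sub_one_le)
    linarith

lemma nphi_le {y : ℝ} : nphi y ≤ 0.4 * Real.exp (-y ^ 2 / 2) := by
  have : (√(2 * Real.pi))⁻¹ ≤ 0.4 := by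
    rw [inv_le_comm₀ (by positivity) (by norm_num)]
    exact Real.le_sqrt_of_sq_le (by norm_num; linarith [Real.pi_gt_d6])
  exact mul_le_mul_of_nonneg_right this (Real.exp_pos _).le

lemma hazard_neg_le {y : ℝ} (hy : 0 ≤ y) : hazard (-y) ≤ 2 * nphi y := by
  have h : 1 / 2 ≤ ncdf y := by rw [← ncdf_zero]; exact strictMono_ncdf.monotone hy
  rw [hazard, nphi_neg, neg_neg, div_le_iff₀ (ncdf_pos y)]
  nlinarith [nphi_pos y]

lemma exp_neg_three_le : Real.exp (-3) ≤ 0.0498 := by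
  have := Real.exp_one_gt_d9
  rw [Real.exp_neg, inv_le_comm₀ (Real.exp_pos 3) (by norm_num),
    show (3 : ℝ) = (3 : ℕ) * 1 by norm_num, Real.exp_nat_mul]
  calc (0.0498 : ℝ)⁻¹ ≤ 2.7182818 ^ 3 := by norm_num
    _ ≤ _ := by gcongr; linarith

lemma nphi_three_le : nphi 3 ≤ 0.0045 := by
  have h1 : Real.exp (-(3 : ℝ) ^ 2 / 2) = Real.exp (-3) * Real.exp (-(3 / 2)) := by
    rw [← Real.exp_add]; norm_num
  have h2 : Real.exp (-(3 / 2)) ≤ 0.2232 := by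
    refine le_of_sq_le_sq ?_ (by norm_num)
    rw [← Real.exp_nat_mul]
    norm_num
    refine exp_neg_three_le.trans (by norm_num)
  have h3 := mul_le_mul exp_neg_three_le h2 (Real.exp_pos _).le (by norm_num)
  have := nphi_le (y := 3)
  rw [h1] at this
  linarith

lemma half_le_hazardEven {y : ℝ} (hy : 0 < y) :
    y / 2 + y / (2 * (y ^ 2 + 2)) ≤ hazardEven y := by
  have h := le_hazard hy
  have h2 := hazard_pos (-y)
  have e : y / (2 * (y ^ 2 + 2)) = y / (y ^ 2 + 2) / 2 := by field_simp
  unfold hazardEven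
  linarith

lemma le_hazardEvenDeriv_two : 0.3855 ≤ hazardEvenDeriv 2 := by
  have := le_hazardEvenDeriv_on (by norm_num) le_rfl le_rfl hazardEven_two_bounds.1
    oddExcess_two_bounds.1 (by norm_num)
  linarith

lemma le_hazardEvenDeriv_three : 0.4314 ≤ hazardEvenDeriv 3 := by
  have h1 := half_le_hazardEven (by norm_num : (0 : ℝ) < 3)
  have h2 := le_hazard (by norm_num : (0 : ℝ) < 3)
  have h3 := hazard_neg_le (by norm_num : (0 : ℝ) ≤ 3)
  have h4 := nphi_three_le
  norm_num at h1 h2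
  have h5 : 0.2637 ≤ 2 * hazardOdd 3 - 3 := by unfold hazardOdd; linarith
  have h6 : 1.636 ≤ hazardEven 3 := by linarith
  have := mul_le_mul h6 h5 (by norm_num) (hazardEven_pos 3).le
  unfold hazardEvenDeriv
  linarith

/-- A linear lower bound for the derivative of `hazardEven` on an initial interval. -/
lemma le_hazardEvenDeriv {k Y y : ℝ} (hk0 : 0 ≤ k) (hk : k ≤ 0.1649)
    (h : k * Y ≤ 0.3855 ∨ k * 3 ≤ 0.3855 ∧ k * Y ≤ 0.4314) (hy : 0 ≤ y) (hyY : y ≤ Y) :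
    k * y ≤ hazardEvenDeriv y := by
  have hky : k * y ≤ k * Y := mul_le_mul_of_nonneg_left hyY hk0
  rcases le_total 2 y with h2 | h2
  · have h5 := le_hazardEvenDeriv_two.trans (monotone_hazardEvenDeriv h2)
    rcases h with h | ⟨h3, h4⟩
    · linarith
    · rcases le_total y 3 with hy3 | hy3
      · have := mul_le_mul_of_nonneg_left hy3 hk0
        linarith
      · have h5 := le_hazardEvenDeriv_three.trans (monotone_hazardEvenDeriv hy3)
        linarith
  have hky := mul_le_mul_of_nonneg_right hk hy
  rcases le_total 1.5 y with h15 | h15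
  · have := le_hazardEvenDeriv_on (by norm_num) h15 h2 hazardEven_three_halves_bounds.1
      oddExcess_two_bounds.1 (by norm_num)
    linarith
  rcases le_total 1 y with h1 | h1
  · have := le_hazardEvenDeriv_on (by norm_num) h1 h15 hazardEven_one_bounds.1
      oddExcess_three_halves_bounds.1 (by norm_num)
    linarith
  · have := le_hazardEvenDeriv_on le_rfl hy h1 hazardEven_zero_bounds.1
      oddExcess_one_bounds.1 (by norm_num)
    linarith

/-- `2 * hazardOdd y - y` is small for large `y` by the Mills ratio bound, and for small `y`
because `oddExcess` decreases. -/
lemma mul_oddExcess_le {y : ℝ} (hy : 0 ≤ y) : y * oddExcess y ≤ 0.4 := by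
  have hcell : ∀ x z b : ℝ, 0 ≤ x → x ≤ y → y ≤ z → oddExcess x ≤ b → z * b ≤ 0.4 → 0 ≤ b →
      y * oddExcess y ≤ 0.4 := by
    intro x z b hx hxy hyz hb hzb hb0
    have h2 := (oddExcess_anti hx hxy).trans hb
    have h3 := mul_le_mul hyz h2 (oddExcess_nonneg y) (hy.trans hyz)
    exact h3.trans hzb
  rcases le_total 2.5 y with h25 | h25
  · have hy0 : 0 < y := by norm_num at h25; linarith
    have h1 := hazard_le hy0
    have h2 := hazard_pos (-y)
    have h3 : 1 / y ≤ 0.4 := by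
      rw [div_le_iff₀ hy0]; linarith
    rw [← two_mul_hazardOdd_sub]
    unfold hazardOdd
    linarith
  rcases le_total 2 y with h2 | h2
  · exact hcell 2 2.5 0.1592 (by norm_num) h2 h25 oddExcess_two_bounds.2 (by norm_num) (by norm_num)
  rcases le_total 1.5 y with h15 | h15
  · exact hcell 1.5 2 0.2 (by norm_num) h15 h2 oddExcess_three_halves_bounds.2 (by norm_num)
      (by norm_num)
  rcases le_total 1 y with h1 | h1
  · exact hcell 1 1.5 0.2377 (by norm_num) h1 h15 oddExcess_one_bounds.2 (by norm_num) (by norm_num)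
  · exact hcell 0 1 0.27324 le_rfl hy h1 ((oddExcess_le 0).trans four_div_pi_sub_one_le)
      (by norm_num) (by norm_num)

/-! ### Even and odd part of the tail log likelihood ratio -/

lemma hasDerivAt_tailLlr {m : ℝ} (x : ℝ) : HasDerivAt (tailLlr m)
    ((hazard (x + m) - hazard (x - m)) / (2 * m)) x := by
  have h1 := ((hasDerivAt_ncdf (m - x)).comp x ((hasDerivAt_id x).const_sub m)).log
    (ncdf_pos (m - x)).ne'
  have h2 := ((hasDerivAt_ncdf (-m - x)).comp x ((hasDerivAt_id x).const_sub (-m))).log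
    (ncdf_pos (-m - x)).ne'
  refine ((h1.sub h2).div_const (2 * m)).congr_deriv ?_
  simp only [hazard, Function.comp]
  rw [show -(x + m) = -m - x by ring, show -(x - m) = m - x by ring,
    ← nphi_neg (x + m), ← nphi_neg (x - m), show -(x + m) = -m - x by ring,
    show -(x - m) = m - x by ring]
  ring

lemma continuous_tailLlr (m : ℝ) : Continuous (tailLlr m) :=
  continuous_iff_continuousAt.2 fun x => (hasDerivAt_tailLlr x).continuousAt

lemma hasDerivAt_tailLlr_neg {m : ℝ} (x : ℝ) : HasDerivAt (fun x => tailLlr m (-x))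
    (-((hazard (-x + m) - hazard (-x - m)) / (2 * m))) x := by
  have := (hasDerivAt_tailLlr (m := m) (-x)).comp x (hasDerivAt_neg x)
  exact this.congr_deriv (by ring)

lemma tailLlr_zero (m : ℝ) : tailLlr m 0 = halfLogit m / m := by
  simp only [tailLlr, halfLogit, sub_zero]
  rw [div_div]

lemma tailLlr_nonneg {m : ℝ} (hm : 0 < m) (x : ℝ) : 0 ≤ tailLlr m x := by
  rw [le_tailLlr_iff hm, mul_zero, Real.exp_zero, one_mul]
  exact strictMono_ncdf.monotone (by linarith)

lemma tailLlr_zero_pos {m : ℝ} (hm : 0 < m) : 0 < tailLlr m 0 := by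
  rw [tailLlr]
  refine div_pos (sub_pos.2 (Real.log_lt_log (ncdf_pos _) ?_)) (by positivity)
  exact strictMono_ncdf (by linarith)

/-- Twice the even part of `tailLlr`. -/
def evenLlr (m x : ℝ) : ℝ := tailLlr m x + tailLlr m (-x)

/-- Twice the odd part of `tailLlr`. -/
def oddLlr (m x : ℝ) : ℝ := tailLlr m x - tailLlr m (-x)

lemma evenLlr_zero (m : ℝ) : evenLlr m 0 = 2 * tailLlr m 0 := by
  simp only [evenLlr, neg_zero]; ring

lemma oddLlr_zero (m : ℝ) : oddLlr m 0 = 0 := by simp [oddLlr]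

lemma hasDerivAt_evenLlr {m : ℝ} (x : ℝ) : HasDerivAt (evenLlr m)
    ((hazardEven (m + x) - hazardEven |m - x|) / m) x := by
  refine ((hasDerivAt_tailLlr (m := m) x).add (hasDerivAt_tailLlr_neg x)).congr_deriv ?_
  have e : hazardEven |m - x| = hazardEven (m - x) := by
    rcases abs_choice (m - x) with h | h <;> rw [h]
    rw [hazardEven_neg]
  rw [e]
  simp only [hazardEven]
  rw [show -(m + x) = -x - m by ring, show -(m - x) = x - m by ring, add_comm x m,
    show -x + m = m - x by ring]
  ring

lemma hasDerivAt_oddLlr {m : ℝ} (x : ℝ) : HasDerivAt (oddLlr m)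
    ((hazardOdd (x + m) - hazardOdd (x - m)) / m) x := by
  refine ((hasDerivAt_tailLlr (m := m) x).sub (hasDerivAt_tailLlr_neg x)).congr_deriv ?_
  simp only [hazardOdd]
  rw [show -(x + m) = -x - m by ring, show -(x - m) = -x + m by ring]
  ring

lemma hazardEven_sub_le {m x : ℝ} (hm : 0 < m) (hx : 0 ≤ x) :
    hazardEven (m + x) - hazardEven |m - x| ≤ m * x / 2 ∧
      hazardEven (m + x) - hazardEven |m - x| ≤ x := by
  have hab := abs_sub_le_add hm hx
  constructor
  · have := sub_le_sub_of_deriv_le hab (fun y _ => hasDerivAt_hazardEven y)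
      (fun y _ => ((hasDerivAt_pow 2 y).div_const 8)) fun y hy => by
        have := hazardEvenDeriv_le_quarter ((abs_nonneg _).trans hy.1.le)
        push_cast
        linarith
    rw [sq_abs] at this
    linarith
  · have := sub_le_sub_of_deriv_le hab (fun y _ => hasDerivAt_hazardEven y)
      (fun y _ => ((hasDerivAt_id y).div_const 2)) fun y hy => hazardEvenDeriv_le_half y
    simp only [id] at this
    linarith [le_abs_self (m - x)]

lemma evenLlr_sub_le {m a b : ℝ} (hm : 0 < m) (ha : 0 ≤ a) (hab : a ≤ b) :
    evenLlr m b - evenLlr m a ≤ (b ^ 2 - a ^ 2) / 4 ∧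
      evenLlr m b - evenLlr m a ≤ (b ^ 2 - a ^ 2) / (2 * m) := by
  constructor
  · have := sub_le_sub_of_deriv_le hab (fun y _ => hasDerivAt_evenLlr (m := m) y)
      (fun y _ => ((hasDerivAt_pow 2 y).div_const 4)) fun y hy => by
        rw [div_le_iff₀ hm]
        have := (hazardEven_sub_le hm (ha.trans hy.1.le)).1
        push_cast
        linarith
    linarith
  · have := sub_le_sub_of_deriv_le hab (fun y _ => hasDerivAt_evenLlr (m := m) y)
      (fun y _ => ((hasDerivAt_pow 2 y).div_const (2 * m))) fun y hy => by
        rw [div_le_iff₀ hm]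
        have := (hazardEven_sub_le hm (ha.trans hy.1.le)).2
        refine this.trans_eq ?_
        push_cast
        field_simp
    refine this.trans_eq ?_
    ring

lemma le_evenLlr {m x k : ℝ} (hm : 0 < m) (hx : 0 ≤ x)
    (hk : ∀ y, 0 ≤ y → y ≤ m + x → k * y ≤ hazardEvenDeriv y) :
    2 * tailLlr m 0 + k * x ^ 2 ≤ evenLlr m x := by
  have := sub_le_sub_of_deriv_le hx (fun y _ => ((hasDerivAt_pow 2 y).const_mul k))
    (fun y _ => hasDerivAt_evenLlr (m := m) y) fun s hs => by
      rw [le_div_iff₀ hm]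
      have := sub_le_sub_of_deriv_le (abs_sub_le_add hm hs.1.le)
        (fun y _ => ((hasDerivAt_pow 2 y).const_mul (k / 2)))
        (fun y _ => hasDerivAt_hazardEven y) fun y hy => by
          have := hk y ((abs_nonneg _).trans hy.1.le) (hy.2.le.trans (by linarith [hs.2]))
          push_cast
          linarith
      rw [sq_abs] at this
      push_cast
      linarith
  rw [evenLlr_zero] at this
  linarith

lemma evenLlr_neg (m x : ℝ) : evenLlr m (-x) = evenLlr m x := by
  simp only [evenLlr, neg_neg]; ring

lemma two_mul_le_evenLlr {m : ℝ} (hm : 0 < m) (x : ℝ) : 2 * tailLlr m 0 ≤ evenLlr m x := by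
  have h : ∀ x, 0 ≤ x → 2 * tailLlr m 0 ≤ evenLlr m x := by
    intro x hx
    have := le_evenLlr (k := 0) hm hx fun y hy _ => by
      rw [zero_mul]; exact hazardEvenDeriv_nonneg hy
    linarith
  rcases le_total 0 x with hx | hx
  · exact h x hx
  · rw [← evenLlr_neg]; exact h (-x) (by linarith)

lemma monotone_evenLlr {m a b : ℝ} (hm : 0 < m) (ha : 0 ≤ a) (hab : a ≤ b) :
    evenLlr m a ≤ evenLlr m b := by
  have := sub_le_sub_of_deriv_le hab (fun y _ => hasDerivAt_const y (0 : ℝ))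
    (fun y _ => hasDerivAt_evenLlr (m := m) y) fun y hy => by
      refine div_nonneg (sub_nonneg.2 (hazardEven_mono (abs_nonneg _) ?_)) hm.le
      exact abs_sub_le_add hm (ha.trans hy.1.le)
  linarith

lemma self_le_evenLlr {m : ℝ} (hm : 0 < m) (x : ℝ) : x ≤ evenLlr m x := by
  have := le_tailLlr hm x
  have := tailLlr_nonneg hm (-x)
  unfold evenLlr
  linarith

lemma hazardOdd_eq (y : ℝ) : hazardOdd y = (y + y * oddExcess y) / 2 := by
  linarith [two_mul_hazardOdd_sub y]

lemma hazardOdd_sub {m x : ℝ} : hazardOdd (x + m) - hazardOdd (x - m) =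
    m + ((x + m) * oddExcess (x + m) - (x - m) * oddExcess (x - m)) / 2 := by
  rw [hazardOdd_eq, hazardOdd_eq]; ring

lemma mul_oddExcess_abs (y : ℝ) : |y * oddExcess y| ≤ 0.4 := by
  rcases le_total 0 y with h | h
  · rw [abs_of_nonneg (mul_nonneg h (oddExcess_nonneg y))]
    exact mul_oddExcess_le h
  · rw [abs_of_nonpos (mul_nonpos_of_nonpos_of_nonneg h (oddExcess_nonneg y)), ← oddExcess_neg]
    have := mul_oddExcess_le (neg_nonneg.2 h)
    linarith

lemma oddLlr_sub_le {m a b : ℝ} (hm : 0 < m) (ha : 0 ≤ a) (hab : a ≤ b) :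
    oddLlr m b - oddLlr m a ≤ 2 * 0.6367 * (b - a) ∧
      oddLlr m b - oddLlr m a ≤ (1 + 0.4 / m) * (b - a) := by
  constructor
  · have := sub_le_sub_of_deriv_le hab (fun y _ => hasDerivAt_oddLlr (m := m) y)
      (fun y _ => ((hasDerivAt_id y).const_mul (2 * 0.6367))) fun y hy => by
        have hy0 : 0 ≤ y := ha.trans hy.1.le
        rw [div_le_iff₀ hm, hazardOdd_sub]
        have h1 := (oddExcess_le (y - m)).trans four_div_pi_sub_one_le
        have h2 : oddExcess (y + m) ≤ oddExcess (y - m) := by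
          rcases le_total m y with h | h
          · exact oddExcess_anti (by linarith) (by linarith)
          · rw [← oddExcess_neg (y - m)]
            exact oddExcess_anti (by linarith) (by linarith)
        have h3 := mul_le_mul_of_nonneg_left h2 (by linarith : 0 ≤ y + m)
        have h4 := mul_le_mul_of_nonneg_left h1 hm.le
        linarith
    simp only [id] at this
    linarith
  · have := sub_le_sub_of_deriv_le hab (fun y _ => hasDerivAt_oddLlr (m := m) y)
      (fun y _ => ((hasDerivAt_id y).const_mul (1 + 0.4 / m))) fun y hy => by
        rw [div_le_iff₀ hm, hazardOdd_sub]
        have h1 := (abs_le.1 (mul_oddExcess_abs (y + m))).2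
        have h2 := (abs_le.1 (mul_oddExcess_abs (y - m))).1
        have e : (1 + 0.4 / m) * 1 * m = m + 0.4 := by field_simp
        rw [e]
        linarith
    simp only [id] at this
    linarith

lemma self_le_oddLlr {m x : ℝ} (hm : 0 < m) (hx : 0 ≤ x) : x ≤ oddLlr m x := by
  have h := sub_le_sub_of_deriv_le (abs_sub_le_add hm hx)
    (fun y _ => ((hasDerivAt_pow 2 y).div_const 2))
    (fun y _ => (((hasDerivAt_ncdf y).log (ncdf_pos y).ne').add
      ((hasDerivAt_ncdf_neg y).log (ncdf_pos (-y)).ne')).neg) fun y hy => by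
        have h1 := mul_nonneg ((abs_nonneg _).trans hy.1.le) (oddExcess_nonneg y)
        rw [← two_mul_hazardOdd_sub] at h1
        have e : 2 * hazardOdd y = -(nphi y / ncdf y + -nphi y / ncdf (-y)) := by
          simp only [hazardOdd, hazard, nphi_neg, neg_neg]; ring
        push_cast
        linarith
  have e : Real.log (ncdf |m - x|) + Real.log (ncdf (-|m - x|)) =
      Real.log (ncdf (m - x)) + Real.log (ncdf (-(m - x))) := by
    rcases abs_choice (m - x) with h | h <;> rw [h]
    rw [neg_neg, add_comm]
  simp only [Pi.neg_apply, Pi.add_apply] at h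
  rw [e, sq_abs] at h
  rw [oddLlr, tailLlr, tailLlr, ← sub_div, le_div_iff₀ (by positivity),
    show m - -x = m + x by ring, show -m - -x = -(m - x) by ring, show -m - x = -(m + x) by ring]
  linarith

/-- `tailLlr` is convex, hence above its tangent at `0`. -/
lemma le_tailLlr_tangent {m x : ℝ} (hm : 0 < m) (hx : 0 ≤ x) :
    tailLlr m 0 + (1 + oddExcess m) / 2 * x ≤ tailLlr m x := by
  have := sub_le_sub_of_deriv_le hx
    (fun y _ => (hasDerivAt_id y).const_mul ((1 + oddExcess m) / 2))
    (fun y _ => hasDerivAt_tailLlr (m := m) y) fun y hy => by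
      have h := sub_le_sub_of_deriv_le hy.1.le (fun z _ => hasDerivAt_const z (0 : ℝ))
        (fun z _ => ((hasDerivAt_hazard (z + m)).comp_add_const z m).sub
          ((hasDerivAt_hazard (z - m)).comp_sub_const z m)) fun z _ =>
            sub_nonneg.2 (monotone_hazard_deriv (by linarith : z - m ≤ z + m))
      rw [le_div_iff₀ (by positivity)]
      have e := hazardOdd_eq m
      simp only [hazardOdd] at e
      simp only [zero_add, zero_sub, Pi.sub_apply] at h
      linarith
  simp only [id] at this
  linarith

/-! ### The normalised Bayes risk as a function of three thresholds -/

/-- The Bayes risk, up to a positive factor, for the signal laws `N(-m, 1)` and `N(m, 1)` and the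
weight `exp (2 m g)` of the state `H = 0`, when the first agent uses the threshold `a` and the
second one the threshold `x` after the decision `1` and `y` after the decision `0`. -/
def risk (m g a x y : ℝ) : ℝ :=
  Real.exp (2 * m * g) * (ncdf (-m - a) * ncdf (-m - x) + ncdf (a + m) * ncdf (-m - y)) +
    (ncdf (m - a) * ncdf (x - m) + ncdf (a - m) * ncdf (y - m))

/-- The threshold of a second agent after the decision `1` when both agents' thresholds without
further information are supposed to be `b`. -/
def thrOne (m b : ℝ) : ℝ := b - tailLlr m b

/-- The threshold of a second agent after the decision `0` when both agents' thresholds without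
further information are supposed to be `b`. -/
def thrZero (m b : ℝ) : ℝ := b + tailLlr m (-b)

/-- The risk of a first agent with threshold `a` and a second agent with prior threshold `b`. -/
def curveRisk (m g a b : ℝ) : ℝ := risk m g a (thrOne m b) (thrZero m b)

/-- The infimum of the risk over the prior threshold of the second agent. -/
def infRisk (m g a : ℝ) : ℝ := ⨅ b : ℝ, curveRisk m g a b

/-- The risk of a first agent with threshold `a` when the second agent's thresholds are optimal. -/
def optRisk (m g a : ℝ) : ℝ := risk m g a (g - tailLlr m a) (g + tailLlr m (-a))

lemma ncdf_sub_eq (m x : ℝ) : ncdf (x - m) = 1 - ncdf (m - x) := by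
  rw [← ncdf_neg]; ring_nf

lemma ncdf_add_eq (m x : ℝ) : ncdf (x + m) = 1 - ncdf (-m - x) := by
  rw [← ncdf_neg]; ring_nf

lemma mass_eq_sub (m a b : ℝ) : mass m a b = ncdf (m - a) - ncdf (m - b) := by
  rw [mass, ncdf_sub_eq m a, ncdf_sub_eq m b]; ring

lemma exp_two_mul_add (m a b : ℝ) : Real.exp (2 * m * (a + b)) =
    Real.exp (2 * m * a) * Real.exp (2 * m * b) := by rw [mul_add, Real.exp_add]

lemma risk_sub_one {m : ℝ} (hm : 0 < m) (g a y : ℝ) {x x' : ℝ} (h : x < x') :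
    risk m g a x' y - risk m g a x y = ncdf (-m - a) * mass (-m) x x' *
      (Real.exp (2 * m * (tailLlr m a + llr m x x')) - Real.exp (2 * m * g)) := by
  have e : ncdf (-m - a) * mass (-m) x x' * (Real.exp (2 * m * tailLlr m a) *
      Real.exp (2 * m * llr m x x')) = ncdf (m - a) * mass m x x' := by
    rw [← exp_tailLlr_mul hm a, ← exp_llr_mul hm h]; ring
  rw [exp_two_mul_add, mul_sub, e, mass_eq_sub (-m), mass, risk, risk]
  ring

lemma risk_sub_zero {m : ℝ} (hm : 0 < m) (g a x : ℝ) {y y' : ℝ} (h : y < y') :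
    risk m g a x y' - risk m g a x y = ncdf (a + m) * mass (-m) y y' *
      (Real.exp (2 * m * (-tailLlr m (-a) + llr m y y')) - Real.exp (2 * m * g)) := by
  have e1 : ncdf (a + m) = Real.exp (2 * m * tailLlr m (-a)) * ncdf (a - m) := by
    have := exp_tailLlr_mul hm (-a)
    rw [show -m - -a = a - m by ring, show m - -a = a + m by ring] at this
    exact this.symm
  have e : ncdf (a + m) * mass (-m) y y' * (Real.exp (2 * m * -tailLlr m (-a)) *
      Real.exp (2 * m * llr m y y')) = ncdf (a - m) * mass m y y' := by
    have : Real.exp (2 * m * tailLlr m (-a)) * Real.exp (2 * m * -tailLlr m (-a)) = 1 := by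
      rw [← Real.exp_add]; simp
    rw [e1, ← exp_llr_mul hm h]
    linear_combination (ncdf (a - m) * mass (-m) y y' * Real.exp (2 * m * llr m y y')) * this
  rw [exp_two_mul_add, mul_sub, e, mass_eq_sub (-m), mass, risk, risk]
  ring

lemma risk_sub_first {m : ℝ} (hm : 0 < m) (g : ℝ) {a a' x y : ℝ} (h : a < a') (hxy : x < y) :
    risk m g a' x y - risk m g a x y = mass (-m) a a' * mass (-m) x y *
      (Real.exp (2 * m * (llr m a a' + llr m x y)) - Real.exp (2 * m * g)) := by
  have e : mass (-m) a a' * mass (-m) x y * (Real.exp (2 * m * llr m a a') *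
      Real.exp (2 * m * llr m x y)) = mass m a a' * mass m x y := by
    rw [← exp_llr_mul hm h, ← exp_llr_mul hm hxy]; ring
  rw [exp_two_mul_add, mul_sub, e, mass_eq_sub (-m), mass_eq_sub (-m), mass_eq_sub m a,
    mass_eq_sub m x, risk, risk]
  rw [ncdf_sub_eq m x, ncdf_sub_eq m y, ncdf_sub_eq m a, ncdf_sub_eq m a', ncdf_add_eq m a,
    ncdf_add_eq m a']
  ring

lemma exp_two_mul_le {m a b : ℝ} (hm : 0 < m) (h : a ≤ b) :
    Real.exp (2 * m * a) ≤ Real.exp (2 * m * b) := by gcongr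

lemma exp_two_mul_lt {m a b : ℝ} (hm : 0 < m) (h : a < b) :
    Real.exp (2 * m * a) < Real.exp (2 * m * b) := by gcongr

lemma risk_le_one_of_lower {m g a y x x' : ℝ} (hm : 0 < m) (h : x ≤ x')
    (hc : x < x' → g ≤ tailLlr m a + llr m x x') : risk m g a x y ≤ risk m g a x' y := by
  rcases h.eq_or_lt with rfl | h
  · rfl
  rw [← sub_nonneg, risk_sub_one hm g a y h]
  exact mul_nonneg (mul_pos (ncdf_pos _) (mass_pos _ h)).le
    (sub_nonneg.2 (exp_two_mul_le hm (hc h)))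

lemma risk_le_one_of_upper {m g a y x x' : ℝ} (hm : 0 < m) (h : x ≤ x')
    (hc : x < x' → tailLlr m a + llr m x x' ≤ g) : risk m g a x' y ≤ risk m g a x y := by
  rcases h.eq_or_lt with rfl | h
  · rfl
  rw [← sub_nonpos, risk_sub_one hm g a y h]
  exact mul_nonpos_of_nonneg_of_nonpos (mul_pos (ncdf_pos _) (mass_pos _ h)).le
    (sub_nonpos.2 (exp_two_mul_le hm (hc h)))

lemma risk_le_zero_of_lower {m g a x y y' : ℝ} (hm : 0 < m) (h : y ≤ y')
    (hc : y < y' → g ≤ -tailLlr m (-a) + llr m y y') : risk m g a x y ≤ risk m g a x y' := by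
  rcases h.eq_or_lt with rfl | h
  · rfl
  rw [← sub_nonneg, risk_sub_zero hm g a x h]
  exact mul_nonneg (mul_pos (ncdf_pos _) (mass_pos _ h)).le
    (sub_nonneg.2 (exp_two_mul_le hm (hc h)))

lemma risk_le_zero_of_upper {m g a x y y' : ℝ} (hm : 0 < m) (h : y ≤ y')
    (hc : y < y' → -tailLlr m (-a) + llr m y y' ≤ g) : risk m g a x y' ≤ risk m g a x y := by
  rcases h.eq_or_lt with rfl | h
  · rfl
  rw [← sub_nonpos, risk_sub_zero hm g a x h]
  exact mul_nonpos_of_nonneg_of_nonpos (mul_pos (ncdf_pos _) (mass_pos _ h)).le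
    (sub_nonpos.2 (exp_two_mul_le hm (hc h)))

lemma risk_le_first_of_lower {m g a a' x y : ℝ} (hm : 0 < m) (h : a ≤ a') (hxy : x < y)
    (hc : a < a' → g ≤ llr m a a' + llr m x y) : risk m g a x y ≤ risk m g a' x y := by
  rcases h.eq_or_lt with rfl | h
  · rfl
  rw [← sub_nonneg, risk_sub_first hm g h hxy]
  exact mul_nonneg (mul_pos (mass_pos _ h) (mass_pos _ hxy)).le
    (sub_nonneg.2 (exp_two_mul_le hm (hc h)))

lemma risk_le_first_of_upper {m g a a' x y : ℝ} (hm : 0 < m) (h : a ≤ a') (hxy : x < y)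
    (hc : a < a' → llr m a a' + llr m x y ≤ g) : risk m g a' x y ≤ risk m g a x y := by
  rcases h.eq_or_lt with rfl | h
  · rfl
  rw [← sub_nonpos, risk_sub_first hm g h hxy]
  exact mul_nonpos_of_nonneg_of_nonpos (mul_pos (mass_pos _ h) (mass_pos _ hxy)).le
    (sub_nonpos.2 (exp_two_mul_le hm (hc h)))

lemma risk_lt_first_of_lower {m g a a' x y : ℝ} (hm : 0 < m) (h : a < a') (hxy : x < y)
    (hc : g < llr m a a' + llr m x y) : risk m g a x y < risk m g a' x y := by
  rw [← sub_pos, risk_sub_first hm g h hxy]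
  exact mul_pos (mul_pos (mass_pos _ h) (mass_pos _ hxy)) (sub_pos.2 (exp_two_mul_lt hm hc))

lemma risk_lt_first_of_upper {m g a a' x y : ℝ} (hm : 0 < m) (h : a < a') (hxy : x < y)
    (hc : llr m a a' + llr m x y < g) : risk m g a' x y < risk m g a x y := by
  rw [← sub_neg, risk_sub_first hm g h hxy]
  exact mul_neg_of_pos_of_neg (mul_pos (mass_pos _ h) (mass_pos _ hxy))
    (sub_neg.2 (exp_two_mul_lt hm hc))

lemma risk_opt_one_le {m g a x y : ℝ} (hm : 0 < m) :
    risk m g a (g - tailLlr m a) y ≤ risk m g a x y := by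
  rcases le_total (g - tailLlr m a) x with h | h
  · exact risk_le_one_of_lower hm h fun h => by linarith [left_le_llr hm h]
  · exact risk_le_one_of_upper hm h fun h => by linarith [llr_le_right hm h]

/-- Among thresholds that are at least `z`, where `z` is at least the optimal one, `z` is best. -/
lemma risk_zero_le_of_le {m g a x y z : ℝ} (hm : 0 < m) (hz : g + tailLlr m (-a) ≤ z)
    (hzy : z ≤ y) : risk m g a x z ≤ risk m g a x y :=
  risk_le_zero_of_lower hm hzy fun h => by linarith [left_le_llr hm h]

lemma risk_opt_zero_le {m g a x y : ℝ} (hm : 0 < m) :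
    risk m g a x (g + tailLlr m (-a)) ≤ risk m g a x y := by
  rcases le_total (g + tailLlr m (-a)) y with h | h
  · exact risk_zero_le_of_le hm le_rfl h
  · exact risk_le_zero_of_upper hm h fun h => by linarith [llr_le_right hm h]

lemma optRisk_le {m : ℝ} (hm : 0 < m) (g a x y : ℝ) : optRisk m g a ≤ risk m g a x y :=
  (risk_opt_one_le hm).trans (risk_opt_zero_le hm)

lemma risk_nonneg (m g a x y : ℝ) : 0 ≤ risk m g a x y := by
  have := fun z => (ncdf_pos z).le
  unfold risk
  have h1 := this (-m - a)
  have h2 := this (-m - x)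
  have h3 := this (a + m)
  have h4 := this (-m - y)
  have h5 := this (m - a)
  have h6 := this (x - m)
  have h7 := this (a - m)
  have h8 := this (y - m)
  positivity

lemma bddBelow_curveRisk (m g a : ℝ) : BddBelow (Set.range fun b => curveRisk m g a b) :=
  ⟨0, by rintro _ ⟨b, rfl⟩; exact risk_nonneg _ _ _ _ _⟩

lemma infRisk_le (m g a b : ℝ) : infRisk m g a ≤ curveRisk m g a b :=
  ciInf_le (bddBelow_curveRisk m g a) b

lemma le_infRisk {m g a C : ℝ} (h : ∀ b, C ≤ curveRisk m g a b) : C ≤ infRisk m g a :=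
  le_ciInf h

lemma optRisk_le_infRisk {m : ℝ} (hm : 0 < m) (g a : ℝ) : optRisk m g a ≤ infRisk m g a :=
  le_infRisk fun _ => optRisk_le hm _ _ _ _

lemma thrOne_nonpos {m : ℝ} (hm : 0 < m) (b : ℝ) : thrOne m b ≤ 0 :=
  sub_nonpos.2 (le_tailLlr hm b)

lemma thrZero_nonneg {m : ℝ} (hm : 0 < m) (b : ℝ) : 0 ≤ thrZero m b := by
  have := le_tailLlr hm (-b)
  unfold thrZero
  linarith

lemma thrOne_mono {m a b : ℝ} (hm : 0 < m) (h : a ≤ b) : thrOne m a ≤ thrOne m b := by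
  have := tailLlr_shift hm a (sub_nonneg.2 h)
  rw [add_sub_cancel] at this
  unfold thrOne
  linarith

lemma thrZero_mono {m a b : ℝ} (hm : 0 < m) (h : a ≤ b) : thrZero m a ≤ thrZero m b := by
  have := tailLlr_shift hm (-b) (sub_nonneg.2 h)
  rw [show -b + (b - a) = -a by ring] at this
  unfold thrZero
  linarith

lemma thrZero_sub_thrOne (m b : ℝ) : thrZero m b - thrOne m b = evenLlr m b := by
  unfold thrZero thrOne evenLlr; ring

lemma thrOne_lt_thrZero {m : ℝ} (hm : 0 < m) (b : ℝ) : thrOne m b < thrZero m b := by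
  have := two_mul_le_evenLlr hm b
  have := tailLlr_zero_pos hm
  rw [← sub_pos, thrZero_sub_thrOne]
  linarith

/-- The log likelihood ratio of the signals on which the two decisions of the first agent lead to
different final decisions. -/
def curveLlr (m b : ℝ) : ℝ := llr m (thrOne m b) (thrZero m b)

lemma curveLlr_mono {m a b : ℝ} (hm : 0 < m) (h : a ≤ b) : curveLlr m a ≤ curveLlr m b :=
  llr_mono hm (thrOne_lt_thrZero hm a) (thrOne_lt_thrZero hm b) (thrOne_mono hm h)
    (thrZero_mono hm h)

lemma curveLlr_le {m : ℝ} (hm : 0 < m) (b : ℝ) : curveLlr m b ≤ tailLlr m 0 :=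
  (llr_le_tailLlr hm (thrOne_lt_thrZero hm b)).trans (monotone_tailLlr hm (thrOne_nonpos hm b))

lemma llr_lt_right {m a b : ℝ} (hm : 0 < m) (h : a < b) : llr m a b < b := by
  obtain ⟨c, hac, hcb⟩ := exists_between h
  have h1 := exp_llr_mul hm h
  rw [← mass_add m a c b, ← mass_add (-m) a c b] at h1
  have h2 := mass_le_exp_mul hm hac.le
  have h3 := mass_le_exp_mul hm hcb.le
  have h4 := exp_two_mul_lt hm hcb
  have h5 := mass_pos (-m) hac
  have h6 := mass_pos (-m) hcb
  have h7 := mul_lt_mul_of_pos_right h4 h5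
  have h8 : Real.exp (2 * m * llr m a b) < Real.exp (2 * m * b) := by
    refine lt_of_mul_lt_mul_right (a := mass (-m) a c + mass (-m) c b) ?_ (by positivity)
    linarith
  rw [Real.exp_lt_exp] at h8
  exact lt_of_mul_lt_mul_left h8 (by positivity)

lemma llr_lt_llr_right {m a b c : ℝ} (hm : 0 < m) (h : a < b) (hbc : b < c) :
    llr m a b < llr m a c := by
  have h1 := exp_llr_mul hm (h.trans hbc)
  have h2 := exp_llr_mul hm h
  have h3 := exp_mul_le_mass hm hbc.le
  have h4 := mul_lt_mul_of_pos_right (exp_two_mul_lt hm (llr_lt_right hm h)) (mass_pos (-m) hbc)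
  rw [← mass_add m a b c, ← mass_add (-m) a b c] at h1
  have h5 : Real.exp (2 * m * llr m a b) < Real.exp (2 * m * llr m a c) := by
    refine lt_of_mul_lt_mul_right (a := mass (-m) a b + mass (-m) b c) ?_
      (add_pos (mass_pos _ h) (mass_pos _ hbc)).le
    linarith
  rw [Real.exp_lt_exp] at h5
  exact lt_of_mul_lt_mul_left h5 (by positivity)

lemma llr_center_pos {m c L : ℝ} (hm : 0 < m) (hc : 0 < c) (hL : 0 < L) :
    0 < llr m (c - L) (c + L) := by
  have h0 : llr m (-L) L = 0 := by
    have := llr_neg (m := m) (-L) L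
    rw [neg_neg] at this
    linarith
  rw [← h0]
  exact (llr_lt_llr_right hm (by linarith) (by linarith : L < c + L)).trans_le
    (llr_mono_left hm (by linarith) (by linarith))

lemma curveLlr_pos {m b : ℝ} (hm : 0 < m) (hb : 0 < b) : 0 < curveLlr m b := by
  have h := (oddLlr_sub_le hm le_rfl hb.le).1
  rw [oddLlr_zero] at h
  have h1 := thrZero_sub_thrOne m b
  have h2 : thrZero m b + thrOne m b = 2 * b - oddLlr m b := by
    unfold thrZero thrOne oddLlr; ring
  have := llr_center_pos hm (c := (thrOne m b + thrZero m b) / 2)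
    (L := (thrZero m b - thrOne m b) / 2) (by linarith)
    (by linarith [thrOne_lt_thrZero hm b])
  rwa [show (thrOne m b + thrZero m b) / 2 - (thrZero m b - thrOne m b) / 2 = thrOne m b by ring,
    show (thrOne m b + thrZero m b) / 2 + (thrZero m b - thrOne m b) / 2 = thrZero m b by ring]
    at this

/-! ### First thresholds beyond the true prior threshold -/

lemma opt_lt_opt {m g a : ℝ} (hm : 0 < m) : g - tailLlr m a < g + tailLlr m (-a) := by
  have := two_mul_le_evenLlr hm a
  have := tailLlr_zero_pos hm
  unfold evenLlr at *
  linarith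

lemma curveLlr_sub_le {m g a : ℝ} (hm : 0 < m) (h : g ≤ a) :
    curveLlr m a - (a - g) ≤ llr m (g - tailLlr m a) (g + tailLlr m (-a)) := by
  have := llr_shift hm (opt_lt_opt (g := g) (a := a) hm) (sub_nonneg.2 h)
  rw [show g - tailLlr m a + (a - g) = thrOne m a by unfold thrOne; ring,
    show g + tailLlr m (-a) + (a - g) = thrZero m a by unfold thrZero; ring] at this
  unfold curveLlr
  linarith

lemma optRisk_sub_le {m g a h : ℝ} (hm : 0 < m) (hga : g ≤ a) (h0 : 0 ≤ h)
    (hd : h ≤ curveLlr m a) : optRisk m g (a - h) ≤ optRisk m g a := by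
  refine (optRisk_le hm g _ _ _).trans
    (risk_le_first_of_lower hm (by linarith : a - h ≤ a) (opt_lt_opt hm) fun hlt => ?_)
  linarith [left_le_llr hm hlt, curveLlr_sub_le hm hga]

lemma optRisk_sub_lt {m g a h : ℝ} (hm : 0 < m) (hga : g ≤ a) (h0 : 0 < h)
    (hd : h < curveLlr m a) : optRisk m g (a - h) < optRisk m g a := by
  refine (optRisk_le hm g _ _ _).trans_lt
    (risk_lt_first_of_lower hm (by linarith : a - h < a) (opt_lt_opt hm) ?_)
  linarith [left_le_llr hm (by linarith : a - h < a), curveLlr_sub_le hm hga]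

/-- The optimal risk increases in the first threshold beyond `g`, by steps of a size bounded from
below. -/
lemma optRisk_mono {m g p a : ℝ} (hm : 0 < m) (hgp : g ≤ p) (hp : 0 < p) (hpa : p ≤ a) :
    optRisk m g p ≤ optRisk m g a := by
  have hd := curveLlr_pos hm hp
  have key : ∀ n : ℕ, ∀ a, p ≤ a → a ≤ p + n * curveLlr m p → optRisk m g p ≤ optRisk m g a := by
    intro n
    induction n with
    | zero => intro a h1 h2; rw [show a = p by simp at h2; linarith]
    | succ n ih =>
      intro a h1 h2
      have hda := curveLlr_mono hm h1
      rcases le_total (a - curveLlr m p) p with h | h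
      · have := optRisk_sub_le (h := a - p) hm (hgp.trans h1) (by linarith) (by linarith)
        rwa [sub_sub_cancel] at this
      · refine (ih (a - curveLlr m p) h ?_).trans (optRisk_sub_le hm (hgp.trans h1) hd.le hda)
        push_cast at h2
        linarith
  obtain ⟨n, hn⟩ := exists_nat_ge ((a - p) / curveLlr m p)
  refine key n a hpa ?_
  rw [div_le_iff₀ hd] at hn
  linarith

/-- First thresholds `a ≥ g > 0` are not optimal: their risk is at least the one of `a = b = g`,
where the second agent is right about the first one, and this one is lowered by lowering `a` alone. -/
lemma exists_infRisk_lt_of_ge {m g : ℝ} (hm : 0 < m) (hg : 0 < g) :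
    ∃ a₀ ∈ Ioo 0 g, ∀ a, g ≤ a → infRisk m g a₀ < infRisk m g a := by
  have hd := curveLlr_pos hm hg
  set h := min (curveLlr m g / 2) (g / 2) with hh
  have h0 : 0 < h := lt_min (by linarith) (by linarith)
  have h1 : h ≤ curveLlr m g / 2 := min_le_left _ _
  have h2 : h ≤ g / 2 := min_le_right _ _
  refine ⟨g - h, ⟨by linarith, by linarith⟩, fun a ha => ?_⟩
  have hlt : curveRisk m g (g - h) g < curveRisk m g g g := by
    refine risk_lt_first_of_lower hm (by linarith) (thrOne_lt_thrZero hm g) ?_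
    have := left_le_llr hm (by linarith : g - h < g)
    change g < _ + curveLlr m g
    linarith
  calc infRisk m g (g - h) ≤ curveRisk m g (g - h) g := infRisk_le _ _ _ _
    _ < curveRisk m g g g := hlt
    _ = optRisk m g g := rfl
    _ ≤ optRisk m g a := optRisk_mono hm le_rfl hg ha
    _ ≤ infRisk m g a := optRisk_le_infRisk hm g a

lemma continuous_risk_comp {m g : ℝ} {f₁ f₂ f₃ : ℝ → ℝ} (h₁ : Continuous f₁) (h₂ : Continuous f₂)
    (h₃ : Continuous f₃) : Continuous fun a => risk m g (f₁ a) (f₂ a) (f₃ a) := by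
  have := fun {f : ℝ → ℝ} (hf : Continuous f) => continuous_ncdf.comp hf
  simp only [Function.comp_def] at this
  unfold risk
  refine (continuous_const.mul (((this ?_).mul (this ?_)).add ((this ?_).mul (this ?_)))).add
    (((this ?_).mul (this ?_)).add ((this ?_).mul (this ?_))) <;> fun_prop

lemma continuous_optRisk (m g : ℝ) : Continuous (optRisk m g) :=
  continuous_risk_comp continuous_id (continuous_const.sub (continuous_tailLlr m))
    (continuous_const.add ((continuous_tailLlr m).comp continuous_neg))

/-- For `g = 0` a positive first threshold is worse than `0`. -/
lemma infRisk_zero_lt_of_pos {m a : ℝ} (hm : 0 < m) (ha : 0 < a) :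
    infRisk m 0 0 < infRisk m 0 a := by
  have hle : ∀ a, 0 < a → optRisk m 0 0 ≤ optRisk m 0 a := by
    intro a ha
    refine le_of_tendsto ((continuous_optRisk m 0).tendsto 0 |>.mono_left nhdsWithin_le_nhds)
      (f := optRisk m 0) (x := 𝓝[>] 0) ?_
    filter_upwards [Ioc_mem_nhdsGT ha] with p hp
    exact optRisk_mono hm hp.1.le hp.1 hp.2
  have hd := curveLlr_pos hm ha
  set h := min (curveLlr m a / 2) (a / 2) with hh
  have h0 : 0 < h := lt_min (by linarith) (by linarith)
  have h1 : h ≤ curveLlr m a / 2 := min_le_left _ _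
  have h2 : h ≤ a / 2 := min_le_right _ _
  calc infRisk m 0 0 ≤ curveRisk m 0 0 0 := infRisk_le _ _ _ _
    _ = optRisk m 0 0 := rfl
    _ ≤ optRisk m 0 (a - h) := hle _ (by linarith)
    _ < optRisk m 0 a := optRisk_sub_lt hm ha.le h0 (by linarith)
    _ ≤ infRisk m 0 a := optRisk_le_infRisk hm 0 a

/-! ### Nonpositive first thresholds -/

lemma tailLlr_neg_le {m x : ℝ} (hm : 0 < m) (hx : 0 ≤ x) : tailLlr m x ≤ tailLlr m 0 + x := by
  have := tailLlr_shift hm 0 hx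
  rwa [zero_add] at this

lemma le_tailLlr_neg {m x : ℝ} (hm : 0 < m) (hx : 0 ≤ x) : tailLlr m 0 - x ≤ tailLlr m (-x) := by
  have := tailLlr_shift hm (-x) hx
  rw [neg_add_cancel] at this
  linarith

/-- If the first threshold is nonpositive and the second agent's threshold after the decision `0`
is at least `S`, the risk is at least the one for the first threshold `0` and for the thresholds
`g - l` and `S` of the second agent. -/
lemma risk_zero_le_risk_of_nonpos {m g S e a x y : ℝ} (hm : 0 < m) (he : 0 < e)
    (hS : g + tailLlr m 0 ≤ S) (hd : llr m (g - tailLlr m 0) S ≤ g - e) (ha : a ≤ 0)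
    (hy : S ≤ y) : risk m g 0 (g - tailLlr m 0) S ≤ risk m g a x y := by
  have hl := tailLlr_zero_pos hm
  set Y : ℝ → ℝ := fun a => max S (g + tailLlr m (-a)) with hY
  set f : ℝ → ℝ := fun a => risk m g a (g - tailLlr m a) (Y a) with hf
  -- `f a` is the least risk for the first threshold `a` under the constraint `S ≤ y`
  have hle : ∀ a x y, S ≤ y → f a ≤ risk m g a x y := by
    intro a x y hy
    refine (risk_opt_one_le (x := x) hm).trans ?_
    rcases le_total S (g + tailLlr m (-a)) with h | h
    · simp only [hY, max_eq_right h]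
      exact risk_opt_zero_le hm
    · simp only [hY, max_eq_left h]
      exact risk_zero_le_of_le hm h hy
  -- with the second thresholds that are optimal for `a`, raising `a` by at most `e` to a
  -- nonpositive threshold does not increase the risk: these second thresholds exceed `g - l` and `S`
  -- by at most `-a`, which raises their log likelihood ratio by at most `-a`
  have hstep : ∀ a a', a ≤ a' → a' ≤ 0 → a' - a ≤ e → f a' ≤ f a := by
    intro a a' h1 h2 h3
    refine (hle a' (g - tailLlr m a) (Y a) (le_max_left _ _)).trans ?_
    have hSY : S ≤ Y a := le_max_left _ _
    have h0 := tailLlr_nonneg hm a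
    have hlt : g - tailLlr m a < Y a := by linarith
    refine risk_le_first_of_upper hm h1 hlt fun hlt' => ?_
    have i1 := le_tailLlr_neg hm (neg_nonneg.2 (h1.trans h2))
    have i2 := tailLlr_neg_le hm (neg_nonneg.2 (h1.trans h2))
    rw [neg_neg] at i1
    have hYle : Y a ≤ S + -a := max_le (by linarith) (by linarith)
    have i3 := llr_mono hm hlt (by linarith : g - tailLlr m 0 + -a < S + -a) (by linarith) hYle
    have i4 := llr_shift hm (by linarith : g - tailLlr m 0 < S) (neg_nonneg.2 (h1.trans h2))
    linarith [llr_le_right hm hlt']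
  have key : ∀ n : ℕ, ∀ a, a ≤ 0 → -a ≤ n * e → f 0 ≤ f a := by
    intro n
    induction n with
    | zero => intro a h1 h2; rw [show a = 0 by simp at h2; linarith]
    | succ n ih =>
      intro a h1 h2
      rcases le_total (-e) a with h | h
      · exact hstep a 0 h1 le_rfl (by linarith)
      · refine (ih (a + e) (by linarith) ?_).trans (hstep a (a + e) (by linarith) (by linarith)
          (by linarith))
        push_cast at h2
        linarith
  obtain ⟨n, hn⟩ := exists_nat_ge (-a / e)
  rw [div_le_iff₀ he] at hn
  have h0 : f 0 = risk m g 0 (g - tailLlr m 0) S := by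
    simp only [hf, hY, neg_zero, max_eq_left hS]
  rw [← h0]
  exact (key n a ha hn).trans (hle a x y hy)

/-- Second thresholds with a log likelihood ratio below `g` are improved by a positive first
threshold, uniformly. -/
lemma exists_lt_curveRisk {m g e : ℝ} (hm : 0 < m) (hg : 0 < g) (he : 0 < e) :
    ∃ a₀ ∈ Ioo 0 g, ∃ C, infRisk m g a₀ < C ∧
      ∀ a b, a ≤ 0 → curveLlr m b ≤ g - e → C ≤ curveRisk m g a b := by
  set a₀ := min e g / 2 with ha₀
  have hpos : 0 < min e g := lt_min he hg
  have h1 : min e g ≤ e := min_le_left _ _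
  have h2 : min e g ≤ g := min_le_right _ _
  have ha0 : 0 < a₀ := by linarith
  have hl := tailLlr_zero_pos hm
  set μ := min (mass (-m) 0 (tailLlr m 0)) (mass (-m) (-tailLlr m 0) 0) with hμ
  have hμ0 : 0 < μ := lt_min (mass_pos _ hl) (mass_pos _ (by linarith))
  set gain := mass (-m) 0 a₀ * μ * (Real.exp (2 * m * g) - Real.exp (2 * m * (a₀ + (g - e))))
    with hgain
  have hgain0 : 0 < gain := mul_pos (mul_pos (mass_pos _ ha0) hμ0)
    (sub_pos.2 (exp_two_mul_lt hm (by linarith)))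
  refine ⟨a₀, ⟨ha0, by linarith⟩, infRisk m g a₀ + gain, by linarith, fun a b ha hb => ?_⟩
  have hlt := thrOne_lt_thrZero hm b
  have hs1 := thrOne_nonpos hm b
  have hs0 := thrZero_nonneg hm b
  -- the first threshold is raised to `0` for free, and then to `a₀` with a gain
  have hle : curveRisk m g 0 b ≤ curveRisk m g a b := by
    refine risk_le_first_of_upper hm ha hlt fun h => ?_
    change _ + curveLlr m b ≤ g
    linarith [llr_le_right hm h]
  -- one of the two sides of `0` contributes an amount that does not depend on `b`
  have hmass : μ ≤ mass (-m) (thrOne m b) (thrZero m b) := by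
    rcases le_total 0 b with h | h
    · have h3 := thrZero_mono hm h
      have h4 : thrZero m 0 = tailLlr m 0 := by simp [thrZero]
      have h5 := mass_add (-m) (thrOne m b) 0 (thrZero m b)
      have h6 := mass_add (-m) 0 (tailLlr m 0) (thrZero m b)
      have h7 := mass_nonneg (-m) hs1
      have h8 := mass_nonneg (-m) (h4 ▸ h3)
      have : μ ≤ _ := min_le_left _ _
      linarith
    · have h3 := thrOne_mono hm h
      have h4 : thrOne m 0 = -tailLlr m 0 := by simp [thrOne]
      have h5 := mass_add (-m) (thrOne m b) 0 (thrZero m b)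
      have h6 := mass_add (-m) (thrOne m b) (-tailLlr m 0) 0
      have h7 := mass_nonneg (-m) hs0
      have h8 := mass_nonneg (-m) (h4 ▸ h3)
      have : μ ≤ _ := min_le_right _ _
      linarith
  have hdiff := risk_sub_first hm g ha0 hlt
  have hexp : Real.exp (2 * m * (llr m 0 a₀ + llr m (thrOne m b) (thrZero m b))) ≤
      Real.exp (2 * m * (a₀ + (g - e))) :=
    exp_two_mul_le hm (add_le_add (llr_le_right hm ha0) hb)
  have hG : gain ≤ mass (-m) 0 a₀ * mass (-m) (thrOne m b) (thrZero m b) *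
      (Real.exp (2 * m * g) - Real.exp (2 * m * (llr m 0 a₀ +
        llr m (thrOne m b) (thrZero m b)))) := by
    have := (mass_pos (-m) ha0).le
    have : 0 ≤ Real.exp (2 * m * g) - Real.exp (2 * m * (a₀ + (g - e))) :=
      sub_nonneg.2 (exp_two_mul_le hm (by linarith))
    rw [hgain]
    gcongr
    exact mul_nonneg ‹_› (hμ0.le.trans hmass)
  have h3 := infRisk_le m g a₀ b
  unfold curveRisk at *
  linarith

/-- The case of a large true prior threshold, where `curveLlr m b ≤ tailLlr m 0 < g` for all `b`. -/
lemma exists_infRisk_lt_of_nonpos_of_lt {m g : ℝ} (hm : 0 < m) (hg : tailLlr m 0 < g) :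
    ∃ a₀ ∈ Ioo 0 g, ∀ a ≤ 0, infRisk m g a₀ < infRisk m g a := by
  have hl := tailLlr_zero_pos hm
  obtain ⟨a₀, h0, C, hC, h⟩ := exists_lt_curveRisk hm (hl.trans hg) (sub_pos.2 hg)
  refine ⟨a₀, h0, fun a ha => hC.trans_le (le_infRisk fun b => h a b ha ?_)⟩
  linarith [curveLlr_le hm b]

/-- If `L` is at most half the distance of the two thresholds at `2 c`, a bound for the threshold
after the decision `0` gives a bound for the log likelihood ratio. -/
lemma curveLlr_le_center {m b c L : ℝ} (hm : 0 < m) (hc : 0 ≤ c) (hL : 0 < L)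
    (h : L ≤ evenLlr m (2 * c) / 2) (hb : thrZero m b ≤ c + L) :
    curveLlr m b ≤ llr m (c - L) (c + L) := by
  refine llr_mono hm (thrOne_lt_thrZero hm b) (by linarith) ?_ hb
  rcases le_total b (2 * c) with h2 | h2
  · refine (thrOne_mono hm h2).trans ?_
    have h3 := self_le_oddLlr hm (by linarith : 0 ≤ 2 * c)
    unfold evenLlr at h
    unfold oddLlr at h3
    unfold thrOne
    linarith
  · have h3 := monotone_evenLlr hm (by linarith) h2
    have h4 := thrZero_sub_thrOne m b
    linarith

lemma llr_le_center_of_nonpos {m a b : ℝ} (hm : 0 < m) (h : a < b) (hab : a + b ≤ 0) :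
    (a + b) / 2 ≤ llr m a b := by
  have h1 := llr_center_le hm (c := -((a + b) / 2)) (L := (b - a) / 2) (by linarith) (by linarith)
  rw [show -((a + b) / 2) - (b - a) / 2 = -b by ring,
    show -((a + b) / 2) + (b - a) / 2 = -a by ring, llr_neg] at h1
  linarith

/-- The risk of the first threshold `0` with the second thresholds `g - l` and `S`, where
`l = tailLlr m 0`, is reduced by a path of threshold moves: lower `S` to `s`, raise the first
threshold to `a`, and pass to the second thresholds of a prior threshold `b` that is optimal for `a`
after the decision `0`. None of the moves raises the risk, and the second one lowers it. -/
lemma infRisk_lt_risk_zero {m g S s a b : ℝ} (hm : 0 < m) (hgl : g ≤ tailLlr m 0)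
    (hs : g - tailLlr m 0 < s) (hsS : s < S) (h3 : g + tailLlr m 0 ≤ llr m s S) (ha : 0 < a)
    (h4 : a / 2 + llr m (g - tailLlr m 0) s < g)
    (hab : a ≤ b) (hb : thrZero m b = g + tailLlr m (-a))
    (h5 : evenLlr m b - evenLlr m a ≤ tailLlr m a - tailLlr m 0) :
    infRisk m g a < risk m g 0 (g - tailLlr m 0) S := by
  have e1 := thrZero_sub_thrOne m b
  have hG := monotone_evenLlr hm ha.le hab
  have hta := monotone_tailLlr hm ha.le
  have hGa : evenLlr m a = tailLlr m a + tailLlr m (-a) := rfl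
  calc infRisk m g a ≤ risk m g a (thrOne m b) (thrZero m b) := infRisk_le m g a b
    _ ≤ risk m g a (thrOne m b) s := by rw [hb]; exact risk_opt_zero_le hm
    _ ≤ risk m g a (g - tailLlr m 0) s := by
        refine risk_le_one_of_lower hm (by linarith) fun hlt => ?_
        have := llr_le_center_of_nonpos hm hlt (by linarith [thrOne_nonpos hm b])
        linarith
    _ < risk m g 0 (g - tailLlr m 0) s := by
        refine risk_lt_first_of_upper hm ha hs ?_
        have := llr_center_le hm (c := a / 2) (L := a / 2) (by linarith) (by linarith)
        rw [sub_self, add_halves] at this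
        linarith
    _ ≤ risk m g 0 (g - tailLlr m 0) S := by
        refine risk_le_zero_of_lower hm hsS.le fun _ => ?_
        rw [neg_zero]
        linarith

/-- The thresholds of a second agent with prior threshold `b` can be matched to the optimal one of a
first threshold `a` after the decision `0`, at a small cost after the decision `1`. -/
lemma exists_thrZero_eq {m g a k K ρ z : ℝ} (hm : 0 < m) (ha : 0 < a) (hag : a ≤ g)
    (hK : K < 1) (hρ : 0 ≤ ρ)
    (hodd : ∀ b, a ≤ b → oddLlr m b - oddLlr m a ≤ 2 * K * (b - a))
    (heven : ∀ b, a ≤ b → evenLlr m b - evenLlr m a ≤ ρ * (b ^ 2 - a ^ 2))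
    (hk : k * a ≤ tailLlr m a - tailLlr m 0) (hz : g - a - k * a / 2 ≤ z * (1 - K))
    (hfin : ρ * (z * (2 * a + z)) ≤ k * a) :
    ∃ b, a ≤ b ∧ thrZero m b = g + tailLlr m (-a) ∧
      evenLlr m b - evenLlr m a ≤ tailLlr m a - tailLlr m 0 := by
  have hu : ∀ b, tailLlr m (-b) - tailLlr m (-a) =
      (evenLlr m b - evenLlr m a) / 2 - (oddLlr m b - oddLlr m a) / 2 := by
    intro b; unfold evenLlr oddLlr; ring
  have hcont : Continuous (thrZero m) :=
    continuous_id.add ((continuous_tailLlr m).comp continuous_neg)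
  set b₁ := a + (g - a) / (1 - K) with hb₁
  have hab₁ : a ≤ b₁ := by
    have : 0 ≤ (g - a) / (1 - K) := div_nonneg (by linarith) (by linarith)
    linarith
  have h1 : g + tailLlr m (-a) ≤ thrZero m b₁ := by
    have h2 := hu b₁
    have h3 := hodd b₁ hab₁
    have h4 := monotone_evenLlr hm ha.le hab₁
    have h5 : (b₁ - a) * (1 - K) = g - a := by
      rw [hb₁]; field_simp [show 1 - K ≠ 0 by linarith]; ring
    unfold thrZero
    linarith
  obtain ⟨b, ⟨hab, -⟩, hb⟩ := intermediate_value_Icc hab₁ hcont.continuousOn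
    (show g + tailLlr m (-a) ∈ Icc (thrZero m a) (thrZero m b₁) from
      ⟨by unfold thrZero; linarith, h1⟩)
  refine ⟨b, hab, hb, ?_⟩
  by_contra hcon
  push Not at hcon
  have h2 := hu b
  have h3 := hodd b hab
  have h4 : (b - a) * (1 - K) < z * (1 - K) := by
    unfold thrZero at hb
    linarith
  have h5 : b - a < z := lt_of_mul_lt_mul_right h4 (by linarith)
  have h6 := heven b hab
  have h7 : b ^ 2 - a ^ 2 ≤ z * (2 * a + z) := by
    have : b ^ 2 - a ^ 2 = (b - a) * (2 * a + (b - a)) := by ring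
    rw [this]
    have : 0 ≤ b - a := by linarith
    have : 0 ≤ z := by linarith
    gcongr
  have := mul_le_mul_of_nonneg_left h7 hρ
  linarith

/-- The case of a small true prior threshold, with explicit auxiliary thresholds. -/
lemma exists_infRisk_lt_of_nonpos {m g c L s a b : ℝ} (hm : 0 < m) (hg : 0 < g)
    (hgl : g ≤ tailLlr m 0) (hc : 0 ≤ c) (hL0 : 0 < L) (hL : L ≤ evenLlr m (2 * c) / 2)
    (h1 : g - tailLlr m 0 ≤ c - L) (h1' : g + tailLlr m 0 ≤ c + L)
    (h2 : llr m (c - L) (c + L) < g) (hs : g - tailLlr m 0 < s) (hsS : s < c + L)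
    (h3 : g + tailLlr m 0 ≤ llr m s (c + L)) (ha : 0 < a) (hag : a < g)
    (h4 : a / 2 + llr m (g - tailLlr m 0) s < g)
    (hab : a ≤ b) (hb : thrZero m b = g + tailLlr m (-a))
    (h5 : evenLlr m b - evenLlr m a ≤ tailLlr m a - tailLlr m 0) :
    ∃ a₀ ∈ Ioo 0 g, ∀ a ≤ 0, infRisk m g a₀ < infRisk m g a := by
  have hl := tailLlr_zero_pos hm
  obtain ⟨a₁, ha₁, C₁, hC₁, hC⟩ := exists_lt_curveRisk hm hg (sub_pos.2 h2)
  set C₂ := risk m g 0 (g - tailLlr m 0) (c + L) with hC₂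
  have hlt := infRisk_lt_risk_zero hm hgl hs hsS h3 ha h4 hab hb h5
  -- a prior threshold `b` with a small threshold after the decision `0` has a log likelihood ratio
  -- below `g`, so that a positive first threshold is better; for the others, the comparison with
  -- the thresholds `0`, `g - l`, `c + L` applies
  have key : ∀ a ≤ 0, min C₁ C₂ ≤ infRisk m g a := by
    intro a ha
    refine le_infRisk fun b => ?_
    rcases le_total (thrZero m b) (c + L) with h | h
    · refine (min_le_left _ _).trans (hC a b ha ?_)
      rw [sub_sub_cancel]
      exact curveLlr_le_center hm hc hL0 hL h
    · refine (min_le_right _ _).trans ?_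
      refine risk_zero_le_risk_of_nonpos hm (sub_pos.2 h2) h1' ?_ ha h
      rw [sub_sub_cancel]
      exact llr_mono_left hm h1 (by linarith)
  rcases le_total (infRisk m g a₁) (infRisk m g a) with h | h
  · exact ⟨a₁, ha₁, fun x hx => (lt_min hC₁ (h.trans_lt hlt)).trans_le (key x hx)⟩
  · exact ⟨a, ⟨ha, hag⟩, fun x hx => (lt_min (h.trans_lt hC₁) hlt).trans_le (key x hx)⟩

/-! ### A criterion in terms of numerical bounds -/

/-- Bounds for the slopes of `tailLlr`: `k` for the slope at `0`, from below, and `K` and `2 ρ x`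
for the slopes at `x` of its odd part and of twice its even part, from above. -/
structure SlopeBounds (m k K ρ : ℝ) : Prop where
  lt_one : K < 1
  nonneg : 0 ≤ ρ
  tangent : k ≤ (1 + oddExcess m) / 2
  odd : ∀ a b, 0 ≤ a → a ≤ b → oddLlr m b - oddLlr m a ≤ 2 * K * (b - a)
  even : ∀ a b, 0 ≤ a → a ≤ b → evenLlr m b - evenLlr m a ≤ ρ * (b ^ 2 - a ^ 2)

/-- The bound `llr_center_le_of_sq_le` for a centre and a half length measured in units of
`l = tailLlr m 0`, when `l²` has a linear lower bound in `m²`. -/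
lemma llr_center_lt {m c L g A B q v w r d : ℝ} (hm : 0 < m) (hg : 0 < g)
    (hAB : A + B * m ^ 2 ≤ tailLlr m 0 ^ 2) (hc : 0 ≤ c) (hcw : c ≤ w * tailLlr m 0)
    (hv : 0 < v) (hL : v * tailLlr m 0 ≤ L) (hLm : L ^ 2 ≤ 3 ∨ c + L ≤ m) (hq : 0 < q)
    (hz : 0 ≤ q ^ 2 * v ^ 2 - w ^ 2)
    (h : m ^ 2 + 3 * q ≤ (q ^ 2 * v ^ 2 - w ^ 2) * (A + B * m ^ 2))
    (hcg : c ≤ r * g) (hr : r * (1 - 1 / (q + 3 / 5)) < 1 - d)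
    (hq1 : 2 / 5 ≤ q) : llr m (c - L) (c + L) < (1 - d) * g := by
  have hl := tailLlr_zero_pos hm
  have hL0 : 0 < L := lt_of_lt_of_le (by positivity) hL
  have h1 := mul_le_mul_of_nonneg_left hAB hz
  have h2 : c ^ 2 ≤ w ^ 2 * tailLlr m 0 ^ 2 := by
    rw [← mul_pow]; gcongr
  have h3 : v ^ 2 * tailLlr m 0 ^ 2 ≤ L ^ 2 := by
    rw [← mul_pow]; gcongr
  have h4 := mul_le_mul_of_nonneg_left h3 (sq_nonneg q)
  have h5 := llr_center_le_of_sq_le hm hc hL0 hq hLm (by linarith)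
  have h6 : 0 ≤ 1 - 1 / (q + 3 / 5) := by
    rw [sub_nonneg, div_le_one (by linarith)]
    linarith
  calc _ ≤ c * (1 - 1 / (q + 3 / 5)) := h5
    _ ≤ r * g * (1 - 1 / (q + 3 / 5)) := by gcongr
    _ = r * (1 - 1 / (q + 3 / 5)) * g := by ring
    _ < _ := by gcongr

/-- Sufficient conditions, in the form of numerical inequalities, for nonpositive first thresholds
not to be optimal. In the notation of `exists_infRisk_lt_of_nonpos`, with `l = tailLlr m 0`, the
auxiliary thresholds are `c = ν g`, `s = l + β g` and `a = θ g`, and `z g` is a bound for `b - a`.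
The numbers `q₁` and `q₂` are the parameters of `llr_center_le_of_sq_le` for the intervals
`(c - L, c + L)` and `(g - l, s)`. -/
lemma exists_infRisk_lt_of_bounds {m g L A B k K ρ g₂ ν β θ v q₁ q₂ z e : ℝ} (hm : 0 < m)
    (hg : 0 < g) (hg₂ : g ≤ g₂ * tailLlr m 0) (hg₁ : g₂ ≤ 1)
    (hAB : A + B * m ^ 2 ≤ tailLlr m 0 ^ 2) (hS : SlopeBounds m k K ρ)
    (he : ρ * tailLlr m 0 ≤ e)
    (hν : 0 < ν) (hlL : tailLlr m 0 ≤ L) (hL : L ≤ evenLlr m (2 * (ν * g)) / 2)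
    (h1 : g - tailLlr m 0 ≤ ν * g - L) (h1' : g + tailLlr m 0 ≤ ν * g + L)
    (hv : 0 < v) (hvL : v * tailLlr m 0 ≤ L) (hLm : L ^ 2 ≤ 3 ∨ ν * g + L ≤ m)
    (hβ0 : 0 ≤ β) (hβ1 : β ≤ 1) (hs : tailLlr m 0 + β * g < ν * g + L)
    (h3 : g + tailLlr m 0 ≤ llr m (tailLlr m 0 + β * g) (ν * g + L))
    (hq₁ : 2 / 5 ≤ q₁) (hz₁ : 0 ≤ q₁ ^ 2 * v ^ 2 - (ν * g₂) ^ 2)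
    (hQ₁ : m ^ 2 + 3 * q₁ ≤ (q₁ ^ 2 * v ^ 2 - (ν * g₂) ^ 2) * (A + B * m ^ 2))
    (hν₁ : ν * (1 - 1 / (q₁ + 3 / 5)) < 1)
    (hq₂ : 2 / 5 ≤ q₂)
    (hz₂ : 0 ≤ q₂ ^ 2 * (1 - (1 - β) * g₂ / 2) ^ 2 - ((1 + β) * g₂ / 2) ^ 2)
    (hQ₂ : m ^ 2 + 3 * q₂ ≤
      (q₂ ^ 2 * (1 - (1 - β) * g₂ / 2) ^ 2 - ((1 + β) * g₂ / 2) ^ 2) * (A + B * m ^ 2))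
    (hβ₂ : (1 + β) / 2 * (1 - 1 / (q₂ + 3 / 5)) < 1 - θ / 2)
    (hθ0 : 0 < θ) (hθ1 : θ < 1) (hz0 : 0 ≤ z) (hz : 1 - θ - k * θ / 2 ≤ z * (1 - K))
    (hfin : e * g₂ * (z * (2 * θ + z)) ≤ k * θ) :
    ∃ a₀ ∈ Ioo 0 g, ∀ a ≤ 0, infRisk m g a₀ < infRisk m g a := by
  set l := tailLlr m 0 with hl
  have hl0 : 0 < l := tailLlr_zero_pos hm
  have hgl : g ≤ l := hg₂.trans (mul_le_of_le_one_left hl0.le hg₁)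
  have hg₂0 : 0 < g₂ := (mul_pos_iff_of_pos_right hl0).1 (hg.trans_le hg₂)
  have h2 : llr m (ν * g - L) (ν * g + L) < (1 - 0) * g :=
    llr_center_lt hm hg hAB (by positivity) (w := ν * g₂)
      (by rw [mul_assoc]; gcongr) hv hvL hLm (by linarith) hz₁ hQ₁ le_rfl (by linarith) hq₁
  have h4 : llr m (g - l) (l + β * g) < (1 - θ / 2) * g := by
    have hb : (1 - β) * g ≤ (1 - β) * (g₂ * l) := by
      have : 0 ≤ 1 - β := by linarith
      gcongr
    have hb0 : 0 ≤ (1 - β) * g := mul_nonneg (by linarith) hg.le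
    have hb1 : (1 + β) * g ≤ (1 + β) * (g₂ * l) := by gcongr
    have hgl2 : (1 - β) * g₂ ≤ 1 := mul_le_one₀ (by linarith) hg₂0.le hg₁
    have hgl3 : (1 - β) * g ≤ l := (mul_le_of_le_one_left hg.le (by linarith)).trans hgl
    have := llr_center_lt (c := (1 + β) * g / 2) (L := l - (1 - β) * g / 2) (g := g)
      (w := (1 + β) * g₂ / 2) (v := 1 - (1 - β) * g₂ / 2) (r := (1 + β) / 2) (d := θ / 2)
      hm hg hAB (by positivity) (by linarith) (by linarith) (by rw [← hl]; linarith) (by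
        rcases hLm with h | h
        · left
          refine le_trans ?_ h
          exact pow_le_pow_left₀ (by linarith) (by linarith) 2
        · right; linarith) (by linarith) hz₂ hQ₂ (by linarith) hβ₂ hq₂
    rwa [show (1 + β) * g / 2 - (l - (1 - β) * g / 2) = g - l by ring,
      show (1 + β) * g / 2 + (l - (1 - β) * g / 2) = l + β * g by ring] at this
  have ha : 0 < θ * g := by positivity
  have hag : θ * g < g := mul_lt_of_lt_one_left hg hθ1
  have hk : k * (θ * g) ≤ tailLlr m (θ * g) - tailLlr m 0 := by
    have := le_tailLlr_tangent hm ha.le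
    have := mul_le_mul_of_nonneg_right hS.tangent ha.le
    linarith
  obtain ⟨b, hab, hb, h5⟩ := exists_thrZero_eq (z := z * g) hm ha hag.le hS.lt_one hS.nonneg
    (fun b hb => hS.odd _ b ha.le hb) (fun b hb => hS.even _ b ha.le hb) hk
    (by have := mul_le_mul_of_nonneg_right hz hg.le; linarith) (by
      have i1 : ρ * g ≤ e * g₂ := by
        calc ρ * g ≤ ρ * (g₂ * l) := mul_le_mul_of_nonneg_left hg₂ hS.nonneg
          _ = ρ * l * g₂ := by ring
          _ ≤ e * g₂ := by gcongr
      have i2 : 0 ≤ z * (2 * θ + z) := by positivity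
      have i3 := mul_le_mul_of_nonneg_right i1 i2
      have i4 := mul_le_mul_of_nonneg_right (i3.trans hfin) hg.le
      linarith)
  have hβg : 0 ≤ β * g := by positivity
  exact exists_infRisk_lt_of_nonpos hm hg hgl (by positivity) (hl0.trans_le hlL) hL h1 h1'
    (by linarith) (by rw [← hl]; linarith) hs h3 ha hag (by rw [← hl]; linarith) hab hb h5

lemma add_le_center_mul {g l g₂ s ε e : ℝ} (hg : 0 < g) (hl : 0 < l) (hg₂ : g ≤ g₂ * l)
    (hs : 0 ≤ s) (hε : 0 ≤ ε) (he : e * l ≤ ε * g) (h : ε * (s * g₂ + 2) ≤ s - 2) :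
    g + l ≤ (s * g + 2 * l) / 2 * (1 - e) := by
  refine le_of_mul_le_mul_right ?_ hl
  have h1 := mul_le_mul_of_nonneg_left he (by positivity : 0 ≤ (s * g + 2 * l) / 2)
  have h2 := mul_le_mul_of_nonneg_right h (by positivity : 0 ≤ g * l)
  have h3 := mul_le_mul_of_nonneg_left hg₂ (by positivity : 0 ≤ ε * g * s)
  linarith

/-- The criterion `exists_infRisk_lt_of_bounds` with `L = l + lam * g`, for `g / l ∈ [g₁, g₂]`. The
number `ε` bounds the relative deficit of the log likelihood ratio of `(s, c + L)` from its
centre. -/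
lemma exists_infRisk_lt_of_add {m g A B k K ρ g₁ g₂ ν lam β θ q₁ q₂ z e u r ε : ℝ} (hm : 0 < m)
    (hg : 0 < g) (hg₁ : g₁ * tailLlr m 0 ≤ g) (hg₂ : g ≤ g₂ * tailLlr m 0)
    (hAB : A + B * m ^ 2 ≤ tailLlr m 0 ^ 2) (hS : SlopeBounds m k K ρ)
    (he : ρ * tailLlr m 0 ≤ e)
    (hL : tailLlr m 0 + lam * g ≤ evenLlr m (2 * (ν * g)) / 2)
    (hnum : 0 ≤ g₁ ∧ g₂ ≤ 1 ∧ 0 ≤ lam ∧ 1 ≤ ν - lam ∧ 0 ≤ β ∧ β ≤ 1 ∧ β < ν + lam)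
    (hLm : tailLlr m 0 ≤ u ∧ (1 + lam * g₂) * u ≤ 1.732 ∨
      tailLlr m 0 ≤ r * m ∧ (1 + (ν + lam) * g₂) * r ≤ 1)
    (hε : tailLlr m 0 ≤ u ∧ ((ν + lam - β) / 2 * u) ^ 2 * g₂ ≤ 3 * ε ∨
      tailLlr m 0 ≤ r * m ∧ (ν + lam - β) / 2 * r ≤ ε)
    (hβ : ε * ((ν + lam + β) * g₂ + 2) ≤ ν + lam + β - 2)
    (hq₁ : 2 / 5 ≤ q₁) (hz₁ : 0 ≤ q₁ ^ 2 * (1 + lam * g₁) ^ 2 - (ν * g₂) ^ 2)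
    (hQ₁ : m ^ 2 + 3 * q₁ ≤ (q₁ ^ 2 * (1 + lam * g₁) ^ 2 - (ν * g₂) ^ 2) * (A + B * m ^ 2))
    (hν₁ : ν * (1 - 1 / (q₁ + 3 / 5)) < 1)
    (hq₂ : 2 / 5 ≤ q₂)
    (hz₂ : 0 ≤ q₂ ^ 2 * (1 - (1 - β) * g₂ / 2) ^ 2 - ((1 + β) * g₂ / 2) ^ 2)
    (hQ₂ : m ^ 2 + 3 * q₂ ≤
      (q₂ ^ 2 * (1 - (1 - β) * g₂ / 2) ^ 2 - ((1 + β) * g₂ / 2) ^ 2) * (A + B * m ^ 2))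
    (hβ₂ : (1 + β) / 2 * (1 - 1 / (q₂ + 3 / 5)) < 1 - θ / 2)
    (hθ : 0 < θ ∧ θ < 1 ∧ 0 ≤ z ∧ 0 ≤ ε) (hz : 1 - θ - k * θ / 2 ≤ z * (1 - K))
    (hfin : e * g₂ * (z * (2 * θ + z)) ≤ k * θ) :
    ∃ a₀ ∈ Ioo 0 g, ∀ a ≤ 0, infRisk m g a₀ < infRisk m g a := by
  obtain ⟨hg₁0, hg₂1, hlam, hνlam, hβ0, hβ1, hβν⟩ := hnum
  obtain ⟨hθ0, hθ1, hz0, hε0⟩ := hθ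
  set l := tailLlr m 0 with hl
  have hl0 : 0 < l := tailLlr_zero_pos hm
  have hg₂0 : 0 < g₂ := (mul_pos_iff_of_pos_right hl0).1 (hg.trans_le hg₂)
  have hlg : 0 ≤ lam * g := by positivity
  have hlg2 : lam * g ≤ lam * (g₂ * l) := by gcongr
  have hlg1 : lam * (g₁ * l) ≤ lam * g := by gcongr
  have hνg2 : (ν + lam) * g ≤ (ν + lam) * (g₂ * l) := by
    have : 0 ≤ ν + lam := by linarith
    gcongr
  have hνg : g ≤ (ν - lam) * g := le_mul_of_one_le_left hg.le hνlam
  have hω : 0 < (ν + lam - β) / 2 := by linarith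
  have h3 : g + l ≤ llr m (l + β * g) (ν * g + (l + lam * g)) := by
    have hC : 0 ≤ ((ν + lam + β) * g + 2 * l) / 2 := by
      have : 0 ≤ ν + lam + β := by linarith
      positivity
    have e1 : ((ν + lam + β) * g + 2 * l) / 2 - (ν + lam - β) / 2 * g = l + β * g := by ring
    have e2 : ((ν + lam + β) * g + 2 * l) / 2 + (ν + lam - β) / 2 * g =
      ν * g + (l + lam * g) := by ring
    have hW : 0 < (ν + lam - β) / 2 * g := by positivity
    rcases hε with ⟨hu, h⟩ | ⟨hu, h⟩
    · have := le_llr_center_sq hm hC hW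
      rw [e1, e2] at this
      refine le_trans (add_le_center_mul hg hl0 hg₂ (by linarith) hε0 ?_ hβ) this
      have i1 : g * l ≤ g₂ * u ^ 2 :=
        calc g * l ≤ g₂ * l * l := by gcongr
          _ = g₂ * l ^ 2 := by ring
          _ ≤ g₂ * u ^ 2 := by gcongr
      have i2 := mul_le_mul_of_nonneg_left i1 (by positivity : 0 ≤ ((ν + lam - β) / 2) ^ 2 * g)
      have i3 := mul_le_mul_of_nonneg_right h hg.le
      linarith
    · have := le_llr_center_div hm hC hW
      rw [e1, e2] at this
      refine le_trans (add_le_center_mul hg hl0 hg₂ (by linarith) hε0 ?_ hβ) this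
      rw [div_mul_eq_mul_div, div_le_iff₀ hm]
      have i1 := mul_le_mul_of_nonneg_left hu (by positivity : 0 ≤ (ν + lam - β) / 2 * g)
      have i2 := mul_le_mul_of_nonneg_right h (by positivity : 0 ≤ g * m)
      linarith
  have hlL : l ≤ l + lam * g := by linarith
  have hLu : l + lam * g ≤ (1 + lam * g₂) * l := by linarith
  refine exists_infRisk_lt_of_bounds (L := l + lam * g) (v := 1 + lam * g₁) hm hg hg₂ hg₂1 hAB hS he
    (by linarith) hlL hL (by linarith) (by linarith) (by positivity) (by rw [← hl]; linarith) ?_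
    hβ0 hβ1 ?_ h3 hq₁ hz₁ hQ₁ hν₁ hq₂ hz₂ hQ₂ hβ₂ hθ0 hθ1 hz0 hz hfin
  · rcases hLm with ⟨hu, h⟩ | ⟨hu, h⟩
    · left
      have i1 : (1 + lam * g₂) * l ≤ (1 + lam * g₂) * u := by gcongr
      calc (l + lam * g) ^ 2 ≤ 1.732 ^ 2 := pow_le_pow_left₀ (by linarith) (by linarith) 2
        _ ≤ 3 := by norm_num
    · right
      have i0 : 0 ≤ 1 + (ν + lam) * g₂ := by
        have : 0 ≤ ν + lam := by linarith
        positivity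
      have i1 := mul_le_mul_of_nonneg_left hu i0
      have i2 := mul_le_mul_of_nonneg_right h hm.le
      linarith
  · have := mul_lt_mul_of_pos_right hβν hg
    rw [← hl]
    linarith

/-- The criterion `exists_infRisk_lt_of_bounds` with `L = ν g`, for `g / l ∈ [g₁, g₂]`; the numbers
have the same meaning as in `exists_infRisk_lt_of_add`. The interval `(c - L, c + L)` is then
`(0, 2 ν g)`, which is the better choice for `g` near `l`. -/
lemma exists_infRisk_lt_of_mul {m g A B k K ρ g₁ g₂ ν β θ q₁ q₂ z e u r ε : ℝ} (hm : 0 < m)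
    (hg : 0 < g) (hg₁ : g₁ * tailLlr m 0 ≤ g) (hg₂ : g ≤ g₂ * tailLlr m 0)
    (hAB : A + B * m ^ 2 ≤ tailLlr m 0 ^ 2) (hS : SlopeBounds m k K ρ)
    (he : ρ * tailLlr m 0 ≤ e)
    (hnum : 0 < g₁ ∧ g₂ ≤ 1 ∧ 1 ≤ ν * g₁ ∧ 1 ≤ (2 * ν - 1) * g₁ ∧ 0 ≤ β ∧ β < 1)
    (hLm : tailLlr m 0 ≤ u ∧ ν * g₂ * u ≤ 1.732 ∨
      tailLlr m 0 ≤ r * m ∧ 2 * ν * g₂ * r ≤ 1)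
    (hε : tailLlr m 0 ≤ u ∧ (((2 * ν - β) * g₂ - 1) / 2 * u) ^ 2 ≤ 3 * ε ∨
      tailLlr m 0 ≤ r * m ∧ ((2 * ν - β) * g₂ - 1) / 2 * r ≤ ε)
    (hβ : 1 + ε ≤ ((2 * ν + β) * (1 - ε) - 2) * g₁)
    (hq₁ : 2 / 5 ≤ q₁) (hz₁ : 0 ≤ q₁ ^ 2 * (ν * g₁) ^ 2 - (ν * g₂) ^ 2)
    (hQ₁ : m ^ 2 + 3 * q₁ ≤ (q₁ ^ 2 * (ν * g₁) ^ 2 - (ν * g₂) ^ 2) * (A + B * m ^ 2))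
    (hν₁ : ν * (1 - 1 / (q₁ + 3 / 5)) < 1)
    (hq₂ : 2 / 5 ≤ q₂)
    (hz₂ : 0 ≤ q₂ ^ 2 * (1 - (1 - β) * g₂ / 2) ^ 2 - ((1 + β) * g₂ / 2) ^ 2)
    (hQ₂ : m ^ 2 + 3 * q₂ ≤
      (q₂ ^ 2 * (1 - (1 - β) * g₂ / 2) ^ 2 - ((1 + β) * g₂ / 2) ^ 2) * (A + B * m ^ 2))
    (hβ₂ : (1 + β) / 2 * (1 - 1 / (q₂ + 3 / 5)) < 1 - θ / 2)
    (hθ : 0 < θ ∧ θ < 1 ∧ 0 ≤ z ∧ 0 ≤ ε) (hz : 1 - θ - k * θ / 2 ≤ z * (1 - K))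
    (hfin : e * g₂ * (z * (2 * θ + z)) ≤ k * θ) :
    ∃ a₀ ∈ Ioo 0 g, ∀ a ≤ 0, infRisk m g a₀ < infRisk m g a := by
  obtain ⟨hg₁0, hg₂1, hν1, hν2, hβ0, hβ1⟩ := hnum
  obtain ⟨hθ0, hθ1, hz0, hε0⟩ := hθ
  set l := tailLlr m 0 with hl
  have hl0 : 0 < l := tailLlr_zero_pos hm
  have hg₂0 : 0 < g₂ := (mul_pos_iff_of_pos_right hl0).1 (hg.trans_le hg₂)
  have hν : 0 < ν := (mul_pos_iff_of_pos_right hg₁0).1 (by linarith)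
  have h2ν : 0 < 2 * ν - 1 := (mul_pos_iff_of_pos_right hg₁0).1 (by linarith)
  have hνg1 : ν * (g₁ * l) ≤ ν * g := by gcongr
  have hνg2 : ν * g ≤ ν * (g₂ * l) := by gcongr
  have hl1 : l ≤ ν * g₁ * l := le_mul_of_one_le_left hl0.le hν1
  have hl2 : l ≤ (2 * ν - 1) * g₁ * l := le_mul_of_one_le_left hl0.le hν2
  have hl3 : (2 * ν - 1) * (g₁ * l) ≤ (2 * ν - 1) * g := by gcongr
  have hβg : β * g < 1 * g := mul_lt_mul_of_pos_right hβ1 hg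
  have hgl : g ≤ l := hg₂.trans (mul_le_of_le_one_left hl0.le hg₂1)
  have h3 : g + l ≤ llr m (l + β * g) (ν * g + ν * g) := by
    have hC : 0 ≤ ((2 * ν + β) * g + l) / 2 := by positivity
    have e1 : ((2 * ν + β) * g + l) / 2 - ((2 * ν - β) * g - l) / 2 = l + β * g := by ring
    have e2 : ((2 * ν + β) * g + l) / 2 + ((2 * ν - β) * g - l) / 2 = ν * g + ν * g := by ring
    have hW : 0 < ((2 * ν - β) * g - l) / 2 := by linarith
    have hWl : ((2 * ν - β) * g - l) / 2 ≤ ((2 * ν - β) * g₂ - 1) / 2 * l := by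
      have : (2 * ν - β) * g ≤ (2 * ν - β) * (g₂ * l) :=
        mul_le_mul_of_nonneg_left hg₂ (by linarith)
      linarith
    have hω : 0 < ((2 * ν - β) * g₂ - 1) / 2 := (mul_pos_iff_of_pos_right hl0).1 (hW.trans_le hWl)
    have hfinal : g + l ≤ ((2 * ν + β) * g + l) / 2 * (1 - ε) := by
      have hD : 0 < (2 * ν + β) * (1 - ε) - 2 :=
        (mul_pos_iff_of_pos_right hg₁0).1 (by linarith)
      have i1 := mul_le_mul_of_nonneg_left hg₁ hD.le
      have i2 := mul_le_mul_of_nonneg_right hβ hl0.le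
      linarith
    rcases hε with ⟨hu, h⟩ | ⟨hu, h⟩
    · have := le_llr_center_sq hm hC hW
      rw [e1, e2] at this
      refine (hfinal.trans (mul_le_mul_of_nonneg_left ?_ hC)).trans this
      have : (((2 * ν - β) * g - l) / 2) ^ 2 ≤ (((2 * ν - β) * g₂ - 1) / 2 * u) ^ 2 :=
        pow_le_pow_left₀ hW.le (hWl.trans (mul_le_mul_of_nonneg_left hu hω.le)) 2
      linarith
    · have := le_llr_center_div hm hC hW
      rw [e1, e2] at this
      refine (hfinal.trans (mul_le_mul_of_nonneg_left ?_ hC)).trans this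
      have : ((2 * ν - β) * g - l) / 2 / m ≤ ε := by
        rw [div_le_iff₀ hm]
        have i1 := mul_le_mul_of_nonneg_left hu hω.le
        have i2 := mul_le_mul_of_nonneg_right h hm.le
        linarith
      linarith
  refine exists_infRisk_lt_of_bounds (L := ν * g) (v := ν * g₁) hm hg hg₂ hg₂1 hAB hS he
    hν (by linarith) ?_ (by linarith) (by linarith) (by positivity) (by rw [← hl]; linarith) ?_
    hβ0 hβ1.le ?_ h3 hq₁ hz₁ hQ₁ hν₁ hq₂ hz₂ hQ₂ hβ₂ hθ0 hθ1 hz0 hz hfin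
  · have := self_le_evenLlr hm (2 * (ν * g))
    linarith
  · rcases hLm with ⟨hu, h⟩ | ⟨hu, h⟩
    · left
      have i1 : ν * g₂ * l ≤ ν * g₂ * u := by gcongr
      calc (ν * g) ^ 2 ≤ 1.732 ^ 2 := pow_le_pow_left₀ (by positivity) (by linarith) 2
        _ ≤ 3 := by norm_num
    · right
      have i1 := mul_le_mul_of_nonneg_left hu (by positivity : 0 ≤ 2 * ν * g₂)
      have i2 := mul_le_mul_of_nonneg_right h hm.le
      linarith
  · rw [← hl]
    linarith

lemma add_zero_le_evenLlr {m : ℝ} (hm : 0 < m) (g x : ℝ) :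
    tailLlr m 0 + 0 * g ≤ evenLlr m x / 2 := by
  linarith [two_mul_le_evenLlr hm x]

/-- An admissible `L = l + lam * g` from a lower bound for the derivative of `hazardEven`. -/
lemma add_mul_le_evenLlr {m g κ Y ν lam g₁ g₂ l₁ u m₂ : ℝ} (hm : 0 < m) (hg : 0 < g)
    (hg₁ : g₁ * tailLlr m 0 ≤ g) (hg₂ : g ≤ g₂ * tailLlr m 0) (hm₂ : m ≤ m₂)
    (hl₁ : l₁ ≤ tailLlr m 0) (hu : tailLlr m 0 ≤ u)
    (hnum : 0 ≤ g₁ ∧ 0 ≤ ν ∧ 0 ≤ κ ∧ κ ≤ 0.1649 ∧ 0 ≤ g₂)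
    (hκ : κ * Y ≤ 0.3855 ∨ κ * 3 ≤ 0.3855 ∧ κ * Y ≤ 0.4314)
    (hY : m₂ + 2 * ν * g₂ * u ≤ Y) (hlam : lam ≤ 2 * κ * ν ^ 2 * g₁ * l₁) :
    tailLlr m 0 + lam * g ≤ evenLlr m (2 * (ν * g)) / 2 := by
  obtain ⟨hg₁0, hν, hκ0, hκ1, hg₂0⟩ := hnum
  have h1 : 2 * (ν * g) ≤ 2 * ν * g₂ * u := by
    have : g ≤ g₂ * u := hg₂.trans (by gcongr)
    have := mul_le_mul_of_nonneg_left this (by positivity : 0 ≤ 2 * ν)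
    linarith
  have h2 := le_evenLlr (k := κ) (x := 2 * (ν * g)) hm (by positivity) fun y hy hyx =>
    le_hazardEvenDeriv hκ0 hκ1 hκ hy (by linarith)
  have h3 : g₁ * l₁ ≤ g := (mul_le_mul_of_nonneg_left hl₁ hg₁0).trans hg₁
  have h4 := mul_le_mul_of_nonneg_left h3 (by positivity : 0 ≤ 2 * κ * ν ^ 2)
  have h5 : lam ≤ 2 * κ * ν ^ 2 * g := by linarith
  have h6 := mul_le_mul_of_nonneg_right h5 hg.le
  linarith

/-! ### Values of `halfLogit` -/

lemma halfLogit_zero : halfLogit 0 = 0 := by simp [halfLogit]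

lemma le_hazardEven_on {x y z e k : ℝ} (hxy : x ≤ y) (he : e ≤ hazardEven x)
    (hk : ∀ t ∈ Icc x z, t * k ≤ hazardEvenDeriv t) (hyz : y ≤ z) :
    e + k / 2 * (y ^ 2 - x ^ 2) ≤ hazardEven y := by
  have := sub_le_sub_of_deriv_le hxy
    (fun t _ => ((hasDerivAt_pow 2 t).const_mul (k / 2)))
    (fun t _ => hasDerivAt_hazardEven t) fun t ht => by
      have := hk t ⟨ht.1.le, ht.2.le.trans hyz⟩
      norm_num
      linarith
  linarith

/-- A lower bound from bounds for `hazardEven` and `oddExcess` at the ends of an interval. -/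
lemma le_halfLogit {x y z e b h : ℝ} (hx : 0 ≤ x) (hxy : x ≤ y) (hyz : y ≤ z) (hh : h ≤ halfLogit x)
    (he : e ≤ hazardEven x) (hb : b ≤ oddExcess z) (hb0 : 0 ≤ b) :
    h + e * (y - x) + e * b / 2 * (x * (y - x) ^ 2 + (y - x) ^ 3 / 3) ≤ halfLogit y := by
  have := sub_le_sub_of_deriv_le hxy (f := fun t => e * t + e * b / 2 * (t ^ 3 / 3 - x ^ 2 * t))
    (f' := fun t => e + e * b / 2 * (t ^ 2 - x ^ 2))
    (fun t _ => by
      refine (((hasDerivAt_id t).const_mul e).add ((((hasDerivAt_pow 3 t).div_const 3).sub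
        ((hasDerivAt_id t).const_mul (x ^ 2))).const_mul (e * b / 2))).congr_deriv ?_
      norm_num)
    (fun t _ => hasDerivAt_halfLogit t) fun t ht =>
      le_hazardEven_on (z := z) (k := e * b) ht.1.le he
        (fun s hs => le_hazardEvenDeriv_on hx hs.1 hs.2 he hb hb0) (ht.2.le.trans hyz)
  linarith

lemma le_halfLogit_of_two_le {y h : ℝ} (hy : 2 ≤ y) (hh : h ≤ halfLogit 2) :
    h + 1.214 * (y - 2) + 0.19275 * (y - 2) ^ 2 ≤ halfLogit y := by
  have h1 : ∀ t, 2 ≤ t → 1.214 + 0.3855 * (t - 2) ≤ hazardEven t := fun t ht => by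
    have := sub_le_sub_of_deriv_le ht (fun s _ => ((hasDerivAt_id s).const_mul (0.3855 : ℝ)))
      (fun s _ => hasDerivAt_hazardEven s) fun s hs => by
        have := le_hazardEvenDeriv_two.trans (monotone_hazardEvenDeriv hs.1.le)
        norm_num at this ⊢
        linarith
    simp only [id] at this
    linarith [hazardEven_two_bounds.1]
  have := sub_le_sub_of_deriv_le hy (f := fun t => 1.214 * t + 0.19275 * (t - 2) ^ 2)
    (f' := fun t => 1.214 + 0.3855 * (t - 2))
    (fun t _ => by
      refine (((hasDerivAt_id t).const_mul _).add ((((hasDerivAt_id t).sub_const 2).pow 2).const_mul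
        _)).congr_deriv ?_
      norm_num
      ring)
    (fun t _ => hasDerivAt_halfLogit t) fun t ht => h1 t ht.1.le
  linarith

/-- The difference `halfLogit y - y² / 4` increases. -/
lemma le_halfLogit_sub_sq {x y z k c : ℝ} (hx : 2 ≤ x) (hxy : x ≤ y) (hyz : y ≤ z)
    (hc : c ≤ halfLogit x - x ^ 2 / 4) (hk : k * (2 * (z ^ 2 + 2)) ≤ z) :
    c + k * (y - x) ≤ halfLogit y - y ^ 2 / 4 := by
  have := sub_le_sub_of_deriv_le hxy
    (fun t _ => (((hasDerivAt_pow 2 t).div_const 4).add ((hasDerivAt_id t).const_mul k)))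
    (fun t _ => hasDerivAt_halfLogit t) fun t ht => by
      have h1 := half_le_hazardEven (by linarith [ht.1] : 0 < t)
      have h2 : k ≤ t / (2 * (t ^ 2 + 2)) := by
        refine ((le_div_iff₀ (by positivity)).2 hk).trans ?_
        rw [div_le_div_iff₀ (by positivity) (by positivity)]
        nlinarith [mul_nonneg (by linarith [ht.2] : 0 ≤ z - t)
          (by nlinarith [ht.1, ht.2] : 0 ≤ z * t - 2)]
      norm_num
      linarith
  simp only [Pi.add_apply, id] at this
  linarith

lemma halfLogit_le {x y e h : ℝ} (hx : 0 ≤ x) (hxy : x ≤ y) (hh : halfLogit x ≤ h)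
    (he : hazardEven x ≤ e) :
    halfLogit y ≤ h + e * (y - x) + (x * (y - x) ^ 2 + (y - x) ^ 3 / 3) / 8 := by
  have h1 : ∀ t, x ≤ t → hazardEven t ≤ e + (t ^ 2 - x ^ 2) / 8 := fun t ht => by
    have := sub_le_sub_of_deriv_le ht (fun s _ => hasDerivAt_hazardEven s)
      (fun s _ => ((hasDerivAt_pow 2 s).div_const 8)) fun s hs => by
        have := hazardEvenDeriv_le_quarter (hx.trans hs.1.le)
        norm_num
        linarith
    linarith
  have := sub_le_sub_of_deriv_le hxy (g := fun t => e * t + (t ^ 3 / 3 - x ^ 2 * t) / 8)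
    (g' := fun t => e + (t ^ 2 - x ^ 2) / 8) (fun t _ => hasDerivAt_halfLogit t)
    (fun t _ => by
      refine (((hasDerivAt_id t).const_mul e).add ((((hasDerivAt_pow 3 t).div_const 3).sub
        ((hasDerivAt_id t).const_mul (x ^ 2))).div_const 8)).congr_deriv ?_
      norm_num) fun t ht => h1 t ht.1.le
  linarith

lemma halfLogit_le_of_two_le {y h : ℝ} (hy : 2 ≤ y) (hh : halfLogit 2 ≤ h) :
    halfLogit y ≤ h + 1.2145 * (y - 2) + (y - 2) ^ 2 / 4 := by
  have h1 : ∀ t, 2 ≤ t → hazardEven t ≤ 1.2145 + (t - 2) / 2 := fun t ht => by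
    have := sub_le_sub_of_deriv_le ht (fun s _ => hasDerivAt_hazardEven s)
      (fun s _ => ((hasDerivAt_id s).div_const 2)) fun s hs => hazardEvenDeriv_le_half s
    simp only [id] at this
    linarith [hazardEven_two_bounds.2]
  have := sub_le_sub_of_deriv_le hy (g := fun t => 1.2145 * t + (t - 2) ^ 2 / 4)
    (g' := fun t => 1.2145 + (t - 2) / 2) (fun t _ => hasDerivAt_halfLogit t)
    (fun t _ => by
      refine (((hasDerivAt_id t).const_mul _).add ((((hasDerivAt_id t).sub_const 2).pow 2).div_const
        _)).congr_deriv ?_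
      norm_num
      ring) fun t ht => h1 t ht.1.le
  linarith

lemma le_halfLogit_one {y : ℝ} (hy : 0 ≤ y) (hy1 : y ≤ 1) :
    0.7978 * y + 0.0315 * y ^ 3 ≤ halfLogit y := by
  have := le_halfLogit le_rfl hy hy1 halfLogit_zero.ge hazardEven_zero_bounds.1
    oddExcess_one_bounds.1 (by norm_num)
  have : 0 ≤ y ^ 3 := by positivity
  linarith

lemma halfLogit_one_bounds : 0.8293 ≤ halfLogit 1 ∧ halfLogit 1 ≤ 0.8396 := by
  have h1 := le_halfLogit_one zero_le_one le_rfl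
  have h2 := halfLogit_le le_rfl zero_le_one halfLogit_zero.le hazardEven_zero_bounds.2
  constructor <;> linarith

lemma le_halfLogit_three_halves {y : ℝ} (hy : 1 ≤ y) (hy1 : y ≤ 1.5) :
    0.8293 + 0.9063 * (y - 1) + 0.0905 * ((y - 1) ^ 2 + (y - 1) ^ 3 / 3) ≤ halfLogit y := by
  have := le_halfLogit zero_le_one hy hy1 halfLogit_one_bounds.1 hazardEven_one_bounds.1
    oddExcess_three_halves_bounds.1 (by norm_num)
  have h0 : 0 ≤ y - 1 := by linarith
  have : 0 ≤ (y - 1) ^ 2 + (y - 1) ^ 3 / 3 := by positivity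
  linarith

lemma halfLogit_three_halves_bounds : 1.3088 ≤ halfLogit 1.5 ∧ halfLogit 1.5 ≤ 1.3294 := by
  have h1 := le_halfLogit_three_halves (y := 1.5) (by norm_num) le_rfl
  have h2 := halfLogit_le (y := 1.5) zero_le_one (by norm_num) halfLogit_one_bounds.2
    hazardEven_one_bounds.2
  constructor <;> linarith

lemma le_halfLogit_two {y : ℝ} (hy : 1.5 ≤ y) (hy1 : y ≤ 2) :
    1.3088 + 1.0386 * (y - 1.5) + 0.08245 * (1.5 * (y - 1.5) ^ 2 + (y - 1.5) ^ 3 / 3) ≤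
      halfLogit y := by
  have := le_halfLogit (by norm_num) hy hy1 halfLogit_three_halves_bounds.1
    hazardEven_three_halves_bounds.1 oddExcess_two_bounds.1 (by norm_num)
  have h0 : 0 ≤ y - 1.5 := by linarith
  have : 0 ≤ 1.5 * (y - 1.5) ^ 2 + (y - 1.5) ^ 3 / 3 := by positivity
  linarith

lemma halfLogit_two_bounds : 1.8624 ≤ halfLogit 2 ∧ halfLogit 2 ≤ 1.901 := by
  have h1 := le_halfLogit_two (y := 2) (by norm_num) le_rfl
  have h2 := halfLogit_le (y := 2) (by norm_num) (by norm_num) halfLogit_three_halves_bounds.2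
    hazardEven_three_halves_bounds.2
  constructor <;> linarith

lemma le_halfLogit_three {y : ℝ} (hy : 2 ≤ y) :
    1.8624 + 1.214 * (y - 2) + 0.19275 * (y - 2) ^ 2 ≤ halfLogit y :=
  le_halfLogit_of_two_le hy halfLogit_two_bounds.1

lemma halfLogit_le_three {y : ℝ} (hy : 2 ≤ y) :
    halfLogit y ≤ 1.901 + 1.2145 * (y - 2) + (y - 2) ^ 2 / 4 :=
  halfLogit_le_of_two_le hy halfLogit_two_bounds.2

/-- Lower bounds for the increasing function `halfLogit y - y² / 4`. -/
lemma le_halfLogit_sub_sq_nodes :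
    1.0191 ≤ halfLogit 3 - 3 ^ 2 / 4 ∧ 1.0821 ≤ halfLogit 3.5 - 3.5 ^ 2 / 4 ∧
    1.139 ≤ halfLogit 4 - 4 ^ 2 / 4 ∧ 1.1643 ≤ halfLogit 4.25 - 4.25 ^ 2 / 4 ∧
    1.1896 ≤ halfLogit 4.5 - 4.5 ^ 2 / 4 ∧ 1.2358 ≤ halfLogit 5 - 5 ^ 2 / 4 ∧
    1.3147 ≤ halfLogit 6 - 6 ^ 2 / 4 := by
  have h3 : 1.0191 ≤ halfLogit 3 - 3 ^ 2 / 4 := by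
    have := le_halfLogit_three (y := 3) (by norm_num)
    linarith
  have h325 := le_halfLogit_sub_sq (x := 3) (y := 3.25) (z := 3.25) (k := 0.1293) (by norm_num)
    (by norm_num) le_rfl h3 (by norm_num)
  have h35 := le_halfLogit_sub_sq (x := 3.25) (y := 3.5) (z := 3.5) (k := 0.1228) (by norm_num)
    (by norm_num) le_rfl h325 (by norm_num)
  have h375 := le_halfLogit_sub_sq (x := 3.5) (y := 3.75) (z := 3.75) (k := 0.1167) (by norm_num)
    (by norm_num) le_rfl h35 (by norm_num)
  have h4 := le_halfLogit_sub_sq (x := 3.75) (y := 4) (z := 4) (k := 0.1111) (by norm_num)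
    (by norm_num) le_rfl h375 (by norm_num)
  have h425 := le_halfLogit_sub_sq (x := 4) (y := 4.25) (z := 4.5) (k := 0.1011) (by norm_num)
    (by norm_num) (by norm_num) h4 (by norm_num)
  have h45 := le_halfLogit_sub_sq (x := 4) (y := 4.5) (z := 4.5) (k := 0.1011) (by norm_num)
    (by norm_num) le_rfl h4 (by norm_num)
  have h5 := le_halfLogit_sub_sq (x := 4.5) (y := 5) (z := 5) (k := 0.0925) (by norm_num)
    (by norm_num) le_rfl h45 (by norm_num)
  have h6 := le_halfLogit_sub_sq (x := 5) (y := 6) (z := 6) (k := 0.0789) (by norm_num)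
    (by norm_num) le_rfl h5 (by norm_num)
  norm_num at h3 h325 h35 h375 h4 h425 h45 h5 h6 ⊢
  refine ⟨?_, ?_, ?_, ?_, ?_, ?_, ?_⟩ <;> linarith

lemma le_halfLogit_of_three_le {x y c : ℝ} (hx : 2 ≤ x) (hxy : x ≤ y)
    (hc : c ≤ halfLogit x - x ^ 2 / 4) : y ^ 2 / 4 + c ≤ halfLogit y := by
  have := le_halfLogit_sub_sq (z := y) (k := 0) hx hxy le_rfl hc (by linarith)
  linarith

/-! ### Bounds for `tailLlr m 0` -/

lemma mul_hazardEven_ge {y : ℝ} (hy : 0 ≤ y) : halfLogit y ≤ y * hazardEven y := by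
  have := sub_le_sub_of_deriv_le hy (fun t _ => hasDerivAt_halfLogit t)
    (fun t _ => (hasDerivAt_id t).mul_const (hazardEven y)) fun t ht => by
      simpa using hazardEven_mono ht.1.le ht.2.le
  simp only [id, halfLogit_zero] at this
  linarith

lemma mul_hazardEven_le {y : ℝ} (hy : 0 ≤ y) : y * hazardEven y ≤ 2 * halfLogit y := by
  have := sub_le_sub_of_deriv_le hy
    (fun t _ => (hasDerivAt_id t).mul (hasDerivAt_hazardEven t))
    (fun t _ => (hasDerivAt_halfLogit t).const_mul 2) fun t ht => by
      have h1 := half_le_hazardEven ht.1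
      have h2 := mul_le_mul_of_nonneg_left (hazardEvenDeriv_le_half t) ht.1.le
      have h3 : 0 ≤ t / (2 * (t ^ 2 + 2)) := by
        have := ht.1
        positivity
      simp only [id]
      linarith
  simp only [Pi.mul_apply, id, halfLogit_zero] at this
  linarith

lemma le_tailLlr_zero_iff {m c : ℝ} (hm : 0 < m) : c ≤ tailLlr m 0 ↔ c * m ≤ halfLogit m := by
  rw [tailLlr_zero, le_div_iff₀ hm]

lemma tailLlr_zero_le_iff {m c : ℝ} (hm : 0 < m) : tailLlr m 0 ≤ c ↔ halfLogit m ≤ c * m := by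
  rw [tailLlr_zero, div_le_iff₀ hm]

lemma tailLlr_zero_mono {x y : ℝ} (hx : 0 < x) (hxy : x ≤ y) : tailLlr x 0 ≤ tailLlr y 0 := by
  have h1 := sub_le_sub_of_deriv_le hxy
    (fun t _ => (hasDerivAt_id t).mul_const (hazardEven x))
    (fun t _ => hasDerivAt_halfLogit t) fun t ht => by
      simpa using hazardEven_mono hx.le ht.1.le
  have h2 := mul_hazardEven_ge hx.le
  simp only [id] at h1
  rw [tailLlr_zero, tailLlr_zero, div_le_div_iff₀ hx (hx.trans_le hxy)]
  nlinarith [mul_nonneg (sub_nonneg.2 hxy) (sub_nonneg.2 h2)]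

/-- The quotient `tailLlr m 0 / m` decreases. -/
lemma tailLlr_zero_le_mul {x y r : ℝ} (hx : 0 < x) (hxy : x ≤ y) (hr : halfLogit x ≤ r * x ^ 2) :
    tailLlr y 0 ≤ r * y := by
  have hpos : ∀ t ∈ Icc x y, t ≠ 0 := fun t ht => (hx.trans_le ht.1).ne'
  have h1 := sub_le_sub_of_deriv_le (g := fun _ => (0 : ℝ)) (g' := fun _ => (0 : ℝ)) hxy
    (fun t ht => (hasDerivAt_halfLogit t).div (hasDerivAt_pow 2 t) (pow_ne_zero 2 (hpos t ht)))
    (fun t _ => hasDerivAt_const t 0) fun t ht => by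
      have h0 := hx.trans ht.1
      refine div_nonpos_of_nonpos_of_nonneg ?_ (by positivity)
      have := mul_le_mul_of_nonneg_left (mul_hazardEven_le h0.le) h0.le
      norm_num
      linarith
  have hy := hx.trans_le hxy
  simp only [Pi.div_apply, sub_self] at h1
  rw [tailLlr_zero_le_iff hy]
  have h2 : halfLogit y / y ^ 2 ≤ r := by
    have := (div_le_iff₀ (by positivity)).2 hr
    linarith
  rw [div_le_iff₀ (by positivity)] at h2
  linarith

lemma le_tailLlr_zero_sq {m P A B : ℝ} (hm : 0 < m) (hP : P ≤ halfLogit m) (hP0 : 0 ≤ P)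
    (h : m ^ 2 * (A + B * m ^ 2) ≤ P ^ 2) : A + B * m ^ 2 ≤ tailLlr m 0 ^ 2 := by
  rw [tailLlr_zero, div_pow, le_div_iff₀ (by positivity)]
  have := pow_le_pow_left₀ hP0 hP 2
  linarith

/-- The case of the lower bound `m² / 4 + c` for `halfLogit m`; the number `t` is the value of `m²`
at which nothing is lost. -/
lemma le_tailLlr_zero_sq_of_add {m c t : ℝ} (hm : 0 < m) (hc : 0 ≤ c) (ht : 0 < t)
    (h : m ^ 2 / 4 + c ≤ halfLogit m) :
    c / 2 + 2 * c ^ 2 / t + (1 / 16 - c ^ 2 / t ^ 2) * m ^ 2 ≤ tailLlr m 0 ^ 2 := by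
  refine le_tailLlr_zero_sq hm h (by positivity) ?_
  have h1 : (m ^ 2 / 4 + c) ^ 2 - m ^ 2 * (c / 2 + 2 * c ^ 2 / t +
      (1 / 16 - c ^ 2 / t ^ 2) * m ^ 2) = (c - c * m ^ 2 / t) ^ 2 := by
    field_simp
    ring
  linarith [sq_nonneg (c - c * m ^ 2 / t)]

lemma le_oddExcess {y : ℝ} (hy : 0 < y) : 1 / (y ^ 2 + 2) - 2 * nphi y / y ≤ oddExcess y := by
  have h1 := le_hazard hy
  have h2 := hazard_neg_le hy.le
  have h3 := two_mul_hazardOdd_sub y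
  rw [hazardOdd] at h3
  refine le_of_mul_le_mul_left ?_ hy
  have e : y * (1 / (y ^ 2 + 2) - 2 * nphi y / y) = y / (y ^ 2 + 2) - 2 * nphi y := by field_simp
  linarith

lemma le_oddExcess_five_halves : 0.1052 ≤ oddExcess 2.5 := by
  have h1 := le_oddExcess (by norm_num : (0 : ℝ) < 2.5)
  have h2 : nphi 2.5 ≤ 0.4 * (0.0498 * (9 / 8)⁻¹) := by
    refine nphi_le.trans ?_
    have e : Real.exp (-(2.5 : ℝ) ^ 2 / 2) = Real.exp (-3) * (Real.exp (1 / 8))⁻¹ := by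
      rw [← Real.exp_neg, ← Real.exp_add]; norm_num
    rw [e]
    have := Real.add_one_le_exp (1 / 8 : ℝ)
    have h3 : (Real.exp (1 / 8))⁻¹ ≤ (9 / 8 : ℝ)⁻¹ := by
      gcongr
      linarith
    have := exp_neg_three_le
    gcongr
  norm_num at h1 h2 ⊢
  linarith

lemma le_oddExcess_of_three_le {y z : ℝ} (hy : 3 ≤ y) (hyz : y ≤ z) :
    1 / (z ^ 2 + 2) - 0.003 ≤ oddExcess y := by
  have h0 : 0 < y := by linarith
  have h1 := le_oddExcess h0
  have h2 : nphi y ≤ nphi 3 := by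
    rw [nphi, nphi]
    gcongr
  have h3 : 2 * nphi y / y ≤ 0.003 := by
    rw [div_le_iff₀ h0]
    linarith [nphi_three_le]
  have h4 : 1 / (z ^ 2 + 2) ≤ 1 / (y ^ 2 + 2) := by gcongr
  linarith

/-! ### The criterion on intervals of parameters -/

/-- Numerical bounds for `l = tailLlr m 0` and for the slopes of `tailLlr m` that are valid for
`m ∈ [m₁, m₂]`: a bound `l² ≥ A + B m²`, slope bounds `k`, `K` and `ρ` with `ρ l ≤ e`, and the
bounds `l₁ ≤ l ≤ u` and `l ≤ r m`. The last one is used only if `m₁ > 0`, as `l / m` is unbounded near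
`0`. -/
structure NumBounds (m m₁ m₂ A B k K e l₁ u r : ℝ) : Prop where
  pos : 0 < m
  nonneg : 0 ≤ m₁
  left : m₁ ≤ m
  right : m ≤ m₂
  sq : A + B * m ^ 2 ≤ tailLlr m 0 ^ 2
  slope : ∃ ρ, SlopeBounds m k K ρ ∧ ρ * tailLlr m 0 ≤ e
  lower : l₁ ≤ tailLlr m 0
  upper : tailLlr m 0 ≤ u
  ratio : 0 < m₁ → tailLlr m 0 ≤ r * m

lemma exists_slopeBounds {m m₁ k K e u r : ℝ} (hm : 0 < m) (hm₁ : m₁ ≤ m)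
    (hk : k ≤ (1 + oddExcess m) / 2) (hK : K < 1) (hK' : 0.6367 ≤ K ∨ 0 < m₁ ∧ 1 + 0.4 / m₁ ≤ 2 * K)
    (he : tailLlr m 0 ≤ u ∧ u / 4 ≤ e ∨ tailLlr m 0 ≤ r * m ∧ r / 2 ≤ e) :
    ∃ ρ, SlopeBounds m k K ρ ∧ ρ * tailLlr m 0 ≤ e := by
  have hodd : ∀ a b, 0 ≤ a → a ≤ b → oddLlr m b - oddLlr m a ≤ 2 * K * (b - a) :=
      fun a b ha hab => by
    obtain ⟨h1, h2⟩ := oddLlr_sub_le hm ha hab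
    have hab' : 0 ≤ b - a := by linarith
    rcases hK' with h | ⟨h0, h⟩
    · refine h1.trans (mul_le_mul_of_nonneg_right (by linarith) hab')
    · refine h2.trans (mul_le_mul_of_nonneg_right (le_trans ?_ h) hab')
      gcongr
  rcases he with ⟨h1, h2⟩ | ⟨h1, h2⟩
  · refine ⟨1 / 4, ⟨hK, by norm_num, hk, hodd, fun a b ha hab => ?_⟩, by linarith⟩
    linarith [(evenLlr_sub_le hm ha hab).1]
  · refine ⟨1 / (2 * m), ⟨hK, by positivity, hk, hodd, fun a b ha hab => ?_⟩, ?_⟩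
    · refine (evenLlr_sub_le hm ha hab).2.trans_eq ?_
      ring
    · rw [one_div_mul_eq_div, div_le_iff₀ (by positivity)]
      nlinarith

lemma numBounds_of {m m₁ m₂ A B k K e l₁ u r : ℝ} (hm₁ : 0 < m₁) (h₁ : m₁ ≤ m) (h₂ : m ≤ m₂)
    (hsq : A + B * m ^ 2 ≤ tailLlr m 0 ^ 2) (hk : 2 * k - 1 ≤ oddExcess m)
    (hl₁ : l₁ * m₁ ≤ halfLogit m₁) (hu : halfLogit m₂ ≤ u * m₂) (hr : halfLogit m₁ ≤ r * m₁ ^ 2)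
    (hnum : K < 1 ∧ (0.6367 ≤ K ∨ 1 + 0.4 / m₁ ≤ 2 * K) ∧ (u / 4 ≤ e ∨ r / 2 ≤ e)) :
    NumBounds m m₁ m₂ A B k K e l₁ u r := by
  have hm := hm₁.trans_le h₁
  have hl := (tailLlr_zero_mono hm h₂).trans ((tailLlr_zero_le_iff (hm.trans_le h₂)).2 hu)
  have hl' := tailLlr_zero_le_mul hm₁ h₁ hr
  refine ⟨hm, hm₁.le, h₁, h₂, hsq, exists_slopeBounds (u := u) (r := r) hm h₁ (by linarith) hnum.1
    (hnum.2.1.imp_right fun h => ⟨hm₁, h⟩) (hnum.2.2.imp (⟨hl, ·⟩) (⟨hl', ·⟩)),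
    ((le_tailLlr_zero_iff hm₁).2 hl₁).trans (tailLlr_zero_mono hm₁ h₁), hl, fun _ => hl'⟩

/-- The condition of `llr_center_lt` is affine in `m²`, so that it may be checked at the endpoints
of an interval. -/
lemma sq_add_le_of_endpoints {m m₁ m₂ q Z A B : ℝ} (h₀ : 0 ≤ m₁) (h₁ : m₁ ≤ m) (h₂ : m ≤ m₂)
    (hl : m₁ ^ 2 + 3 * q ≤ Z * (A + B * m₁ ^ 2)) (hr : m₂ ^ 2 + 3 * q ≤ Z * (A + B * m₂ ^ 2)) :
    m ^ 2 + 3 * q ≤ Z * (A + B * m ^ 2) := by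
  have i1 : m₁ ^ 2 ≤ m ^ 2 := pow_le_pow_left₀ h₀ h₁ 2
  have i2 : m ^ 2 ≤ m₂ ^ 2 := pow_le_pow_left₀ (h₀.trans h₁) h₂ 2
  rcases le_total (Z * B) 1 with h | h
  · linarith [mul_nonneg (sub_nonneg.2 h) (sub_nonneg.2 i2)]
  · linarith [mul_nonneg (sub_nonneg.2 h) (sub_nonneg.2 i1)]

/-- The criterion with `L = l + lam * g`, for `m ∈ [m₁, m₂]` and `g / l ∈ [g₁, g₂]`. -/
lemma NumBounds.exists_of_add {m m₁ m₂ A B k K e l₁ u r g : ℝ}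
    (h : NumBounds m m₁ m₂ A B k K e l₁ u r) (hg : 0 < g) {g₁ g₂ : ℝ}
    (hg₁ : g₁ * tailLlr m 0 ≤ g) (hg₂ : g ≤ g₂ * tailLlr m 0) (κ ν lam β θ q₁ q₂ z ε : ℝ)
    (hlam : κ * (m₂ + 2 * ν * g₂ * u) ≤ 0.3855 ∨
      κ * 3 ≤ 0.3855 ∧ κ * (m₂ + 2 * ν * g₂ * u) ≤ 0.4314)
    (hnum : (0 ≤ g₁ ∧ g₂ ≤ 1 ∧ 0 ≤ lam ∧ 1 ≤ ν - lam ∧ 0 ≤ β ∧ β ≤ 1 ∧ β < ν + lam) ∧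
      (0 ≤ κ ∧ κ ≤ 0.1649 ∧ 0 ≤ g₂ ∧ 0 ≤ ν ∧ lam ≤ 2 * κ * ν ^ 2 * g₁ * l₁) ∧
      ((1 + lam * g₂) * u ≤ 1.732 ∨ 0 < m₁ ∧ (1 + (ν + lam) * g₂) * r ≤ 1) ∧
      (((ν + lam - β) / 2 * u) ^ 2 * g₂ ≤ 3 * ε ∨ 0 < m₁ ∧ (ν + lam - β) / 2 * r ≤ ε) ∧
      ε * ((ν + lam + β) * g₂ + 2) ≤ ν + lam + β - 2)
    (hq₁ : 2 / 5 ≤ q₁ ∧ 0 ≤ q₁ ^ 2 * (1 + lam * g₁) ^ 2 - (ν * g₂) ^ 2 ∧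
      ν * (1 - 1 / (q₁ + 3 / 5)) < 1 ∧
      m₁ ^ 2 + 3 * q₁ ≤ (q₁ ^ 2 * (1 + lam * g₁) ^ 2 - (ν * g₂) ^ 2) * (A + B * m₁ ^ 2) ∧
      m₂ ^ 2 + 3 * q₁ ≤ (q₁ ^ 2 * (1 + lam * g₁) ^ 2 - (ν * g₂) ^ 2) * (A + B * m₂ ^ 2))
    (hq₂ : 2 / 5 ≤ q₂ ∧ 0 ≤ q₂ ^ 2 * (1 - (1 - β) * g₂ / 2) ^ 2 - ((1 + β) * g₂ / 2) ^ 2 ∧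
      (1 + β) / 2 * (1 - 1 / (q₂ + 3 / 5)) < 1 - θ / 2 ∧
      m₁ ^ 2 + 3 * q₂ ≤ (q₂ ^ 2 * (1 - (1 - β) * g₂ / 2) ^ 2 - ((1 + β) * g₂ / 2) ^ 2) *
        (A + B * m₁ ^ 2) ∧
      m₂ ^ 2 + 3 * q₂ ≤ (q₂ ^ 2 * (1 - (1 - β) * g₂ / 2) ^ 2 - ((1 + β) * g₂ / 2) ^ 2) *
        (A + B * m₂ ^ 2))
    (hθ : (0 < θ ∧ θ < 1 ∧ 0 ≤ z ∧ 0 ≤ ε) ∧ 1 - θ - k * θ / 2 ≤ z * (1 - K) ∧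
      e * g₂ * (z * (2 * θ + z)) ≤ k * θ) :
    ∃ a₀ ∈ Ioo 0 g, ∀ a ≤ 0, infRisk m g a₀ < infRisk m g a := by
  obtain ⟨ρ, hS, he⟩ := h.slope
  obtain ⟨hn, ⟨hκ0, hκ1, hg₂0, hν, hlam'⟩, hLm, hε, hβ⟩ := hnum
  refine exists_infRisk_lt_of_add (u := u) (r := r) h.pos hg hg₁ hg₂ h.sq hS he
    (add_mul_le_evenLlr h.pos hg hg₁ hg₂ h.right h.lower h.upper ⟨hn.1, hν, hκ0, hκ1, hg₂0⟩ hlam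
      le_rfl hlam') hn
    (hLm.imp (⟨h.upper, ·⟩) fun h' => ⟨h.ratio h'.1, h'.2⟩)
    (hε.imp (⟨h.upper, ·⟩) fun h' => ⟨h.ratio h'.1, h'.2⟩) hβ hq₁.1 hq₁.2.1
    (sq_add_le_of_endpoints h.nonneg h.left h.right hq₁.2.2.2.1 hq₁.2.2.2.2) hq₁.2.2.1 hq₂.1
    hq₂.2.1 (sq_add_le_of_endpoints h.nonneg h.left h.right hq₂.2.2.2.1 hq₂.2.2.2.2) hq₂.2.2.1
    hθ.1 hθ.2.1 hθ.2.2

/-- The criterion with `L = ν * g`, for `m ∈ [m₁, m₂]` and `g / l ∈ [g₁, g₂]`. -/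
lemma NumBounds.exists_of_mul {m m₁ m₂ A B k K e l₁ u r g : ℝ}
    (h : NumBounds m m₁ m₂ A B k K e l₁ u r) (hg : 0 < g) {g₁ g₂ : ℝ}
    (hg₁ : g₁ * tailLlr m 0 ≤ g) (hg₂ : g ≤ g₂ * tailLlr m 0) (ν β θ q₁ q₂ z ε : ℝ)
    (hnum : (0 < g₁ ∧ g₂ ≤ 1 ∧ 1 ≤ ν * g₁ ∧ 1 ≤ (2 * ν - 1) * g₁ ∧ 0 ≤ β ∧ β < 1) ∧
      (ν * g₂ * u ≤ 1.732 ∨ 0 < m₁ ∧ 2 * ν * g₂ * r ≤ 1) ∧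
      ((((2 * ν - β) * g₂ - 1) / 2 * u) ^ 2 ≤ 3 * ε ∨
        0 < m₁ ∧ ((2 * ν - β) * g₂ - 1) / 2 * r ≤ ε) ∧
      1 + ε ≤ ((2 * ν + β) * (1 - ε) - 2) * g₁)
    (hq₁ : 2 / 5 ≤ q₁ ∧ 0 ≤ q₁ ^ 2 * (ν * g₁) ^ 2 - (ν * g₂) ^ 2 ∧
      ν * (1 - 1 / (q₁ + 3 / 5)) < 1 ∧
      m₁ ^ 2 + 3 * q₁ ≤ (q₁ ^ 2 * (ν * g₁) ^ 2 - (ν * g₂) ^ 2) * (A + B * m₁ ^ 2) ∧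
      m₂ ^ 2 + 3 * q₁ ≤ (q₁ ^ 2 * (ν * g₁) ^ 2 - (ν * g₂) ^ 2) * (A + B * m₂ ^ 2))
    (hq₂ : 2 / 5 ≤ q₂ ∧ 0 ≤ q₂ ^ 2 * (1 - (1 - β) * g₂ / 2) ^ 2 - ((1 + β) * g₂ / 2) ^ 2 ∧
      (1 + β) / 2 * (1 - 1 / (q₂ + 3 / 5)) < 1 - θ / 2 ∧
      m₁ ^ 2 + 3 * q₂ ≤ (q₂ ^ 2 * (1 - (1 - β) * g₂ / 2) ^ 2 - ((1 + β) * g₂ / 2) ^ 2) *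
        (A + B * m₁ ^ 2) ∧
      m₂ ^ 2 + 3 * q₂ ≤ (q₂ ^ 2 * (1 - (1 - β) * g₂ / 2) ^ 2 - ((1 + β) * g₂ / 2) ^ 2) *
        (A + B * m₂ ^ 2))
    (hθ : (0 < θ ∧ θ < 1 ∧ 0 ≤ z ∧ 0 ≤ ε) ∧ 1 - θ - k * θ / 2 ≤ z * (1 - K) ∧
      e * g₂ * (z * (2 * θ + z)) ≤ k * θ) :
    ∃ a₀ ∈ Ioo 0 g, ∀ a ≤ 0, infRisk m g a₀ < infRisk m g a := by
  obtain ⟨ρ, hS, he⟩ := h.slope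
  obtain ⟨hn, hLm, hε, hβ⟩ := hnum
  exact exists_infRisk_lt_of_mul (u := u) (r := r) h.pos hg hg₁ hg₂ h.sq hS he hn
    (hLm.imp (⟨h.upper, ·⟩) fun h' => ⟨h.ratio h'.1, h'.2⟩)
    (hε.imp (⟨h.upper, ·⟩) fun h' => ⟨h.ratio h'.1, h'.2⟩) hβ hq₁.1 hq₁.2.1
    (sq_add_le_of_endpoints h.nonneg h.left h.right hq₁.2.2.2.1 hq₁.2.2.2.2) hq₁.2.2.1 hq₂.1
    hq₂.2.1 (sq_add_le_of_endpoints h.nonneg h.left h.right hq₂.2.2.2.1 hq₂.2.2.2.2) hq₂.2.2.1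
    hθ.1 hθ.2.1 hθ.2.2

/-! ### Verification of the criterion for all parameters -/

/-
The range `0 < g ≤ l`, `l = tailLlr m 0`, is covered by finitely many cells, on each of which `m`
lies in an interval and `g / l` in another one. The numbers given on a cell are rounded solutions of the
strict inequalities of the criterion; they have no further meaning. The order is
`κ ν lam β θ q₁ q₂ z ε` for `exists_of_add` and `ν β θ q₁ q₂ z ε` for `exists_of_mul`.
-/

lemma numBounds_zero {m : ℝ} (h₁ : 0 < m) (h₂ : m ≤ 1) :
    NumBounds m 0 1 0.6361 0.05125 0.6187 0.6367 0.2099 0.7977 0.8396 0 := by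
  have h := le_halfLogit_one h₁.le h₂
  have hm3 : 0 ≤ m ^ 3 := by positivity
  have hu := (tailLlr_zero_mono h₁ h₂).trans
    ((tailLlr_zero_le_iff (c := 0.8396) zero_lt_one).2 (by linarith [halfLogit_one_bounds.2]))
  refine ⟨h₁, le_rfl, h₁.le, h₂, le_tailLlr_zero_sq h₁ h (by positivity) ?_,
    exists_slopeBounds (u := 0.8396) (r := 0) h₁ le_rfl ?_ (by norm_num) (by norm_num)
      (Or.inl ⟨hu, by norm_num⟩), (le_tailLlr_zero_iff h₁).2 (by linarith), hu,
    fun h => (lt_irrefl _ h).elim⟩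
  · nlinarith [sq_nonneg m, pow_nonneg h₁.le 4, pow_nonneg h₁.le 6]
  · linarith [oddExcess_anti h₁.le h₂, oddExcess_one_bounds.1]

lemma exists_infRisk_lt_of_le_one {m g : ℝ} (h₁ : 0 < m) (h₂ : m ≤ 1) (hg : 0 < g)
    (hgl : g ≤ tailLlr m 0) : ∃ a₀ ∈ Ioo 0 g, ∀ a ≤ 0, infRisk m g a₀ < infRisk m g a := by
  have h := numBounds_zero h₁ h₂
  have c₀ : g ≤ 1 * tailLlr m 0 := by linarith
  rcases le_total (0.559 * tailLlr m 0) g with c | c₁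
  · exact h.exists_of_add hg c c₀ 0.125 1.262 0.1775 0.6952 0.5351 4.2159 6.7137 0.8241 0.03255
      (by norm_num) (by norm_num) (by norm_num) (by norm_num) (by norm_num)
  exact h.exists_of_add hg (g₁ := 0) (by linarith) c₁ 0 1.2265 0 0.7929 0.4787 4.8139 5.3664 1.0273
    0.00618
    (by norm_num) (by norm_num) (by norm_num) (by norm_num) (by norm_num)

lemma numBounds_one {m : ℝ} (h₁ : 1 ≤ m) (h₂ : m ≤ 1.5) :
    NumBounds m 1 1.5 0.6287 0.0589 0.5999 0.6367 0.2216 0.8292 0.8863 0.8396 := by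
  have h := le_halfLogit_three_halves h₁ h₂
  obtain ⟨s, rfl⟩ : ∃ s, m = 1 + s := ⟨m - 1, by ring⟩
  have hs : 0 ≤ s := by linarith
  have hw : 0 ≤ 0.5 - s := by linarith
  have hsw := mul_nonneg hs hw
  refine numBounds_of (by norm_num) h₁ h₂ (le_tailLlr_zero_sq (by linarith) h ?_ ?_) ?_
    (halfLogit_one_bounds.1.trans' (by norm_num))
    (halfLogit_three_halves_bounds.2.trans (by norm_num))
    (halfLogit_one_bounds.2.trans (by norm_num))
    (by norm_num)
  · positivity
  · nlinarith [mul_nonneg hsw hs, mul_nonneg hsw hw, mul_nonneg hsw (sq_nonneg s),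
      mul_nonneg (mul_nonneg hsw hs) hw, mul_nonneg hsw (pow_nonneg hs 3), mul_nonneg hsw
        (pow_nonneg hs 4)]
  · linarith [oddExcess_anti (by linarith : (0 : ℝ) ≤ 1 + s) h₂, oddExcess_three_halves_bounds.1]

lemma exists_infRisk_lt_of_one_le {m g : ℝ} (h₁ : 1 ≤ m) (h₂ : m ≤ 1.5) (hg : 0 < g)
    (hgl : g ≤ tailLlr m 0) : ∃ a₀ ∈ Ioo 0 g, ∀ a ≤ 0, infRisk m g a₀ < infRisk m g a := by
  have h := numBounds_one h₁ h₂
  have c₀ : g ≤ 1 * tailLlr m 0 := by linarith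
  rcases le_total (0.776 * tailLlr m 0) g with c | c₁
  · exact h.exists_of_add hg c c₀ 0.1 1.2935 0.2153 0.6797 0.5505 3.8065 6.6463 0.7828 0.045
      (by norm_num) (by norm_num) (by norm_num) (by norm_num) (by norm_num)
  rcases le_total (0.175 * tailLlr m 0) g with c | c₂
  · exact h.exists_of_add hg c c₁ 0.125 1.2289 0.0547 0.7655 0.5137 4.7672 5.6894 0.9145 0.01364
      (by norm_num) (by norm_num) (by norm_num) (by norm_num) (by norm_num)
  exact h.exists_of_add hg (g₁ := 0) (by linarith) c₂ 0 1.2334 0 0.7724 0.5011 4.6835 4.8589 0.9596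
    0.00244
    (by norm_num) (by norm_num) (by norm_num) (by norm_num) (by norm_num)

lemma numBounds_three_halves {m : ℝ} (h₁ : 1.5 ≤ m) (h₂ : m ≤ 2) :
    NumBounds m 1.5 2 0.6252 0.06046 0.5794 0.6334 0.2377 0.8725 0.9506 0.5909 := by
  have h := le_halfLogit_two h₁ h₂
  obtain ⟨s, rfl⟩ : ∃ s, m = 1.5 + s := ⟨m - 1.5, by ring⟩
  have hs : 0 ≤ s := by linarith
  have hw : 0 ≤ 0.5 - s := by linarith
  have hsw := mul_nonneg hs hw
  refine numBounds_of (by norm_num) h₁ h₂ (le_tailLlr_zero_sq (by linarith) h ?_ ?_) ?_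
    (halfLogit_three_halves_bounds.1.trans' (by norm_num))
    (halfLogit_two_bounds.2.trans (by norm_num))
    (halfLogit_three_halves_bounds.2.trans (by norm_num))
    (by norm_num)
  · positivity
  · nlinarith [mul_nonneg hsw hs, mul_nonneg hsw hw, mul_nonneg hsw (sq_nonneg s),
      mul_nonneg (mul_nonneg hsw hs) hw, mul_nonneg hsw (pow_nonneg hs 3), mul_nonneg hsw
        (pow_nonneg hs 4)]
  · linarith [oddExcess_anti (by linarith : (0 : ℝ) ≤ 1.5 + s) h₂, oddExcess_two_bounds.1]

lemma exists_infRisk_lt_of_three_halves_le {m g : ℝ} (h₁ : 1.5 ≤ m) (h₂ : m ≤ 2) (hg : 0 < g)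
    (hgl : g ≤ tailLlr m 0) : ∃ a₀ ∈ Ioo 0 g, ∀ a ≤ 0, infRisk m g a₀ < infRisk m g a := by
  have h := numBounds_three_halves h₁ h₂
  have c₀ : g ≤ 1 * tailLlr m 0 := by linarith
  rcases le_total (0.978 * tailLlr m 0) g with c | c₁
  · exact h.exists_of_mul hg c c₀ 1.3716 0.6664 0.5672 3.0907 6.4873 0.7324 0.08732
      (by norm_num) (by norm_num) (by norm_num) (by norm_num)
  rcases le_total (0.952 * tailLlr m 0) g with c | c₂
  · exact h.exists_of_mul hg c c₁ 1.3471 0.6734 0.5643 3.2806 6.3855 0.7426 0.07179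
      (by norm_num) (by norm_num) (by norm_num) (by norm_num)
  rcases le_total (0.863 * tailLlr m 0) g with c | c₃
  · exact h.exists_of_add hg c c₂ 0.1 1.2784 0.2461 0.6836 0.5603 3.5351 6.2592 0.7567 0.0507
      (by norm_num) (by norm_num) (by norm_num) (by norm_num) (by norm_num)
  rcases le_total (0.512 * tailLlr m 0) g with c | c₄
  · exact h.exists_of_add hg c c₃ 0.1 1.2584 0.1414 0.7164 0.5465 4.2691 5.8892 0.8052 0.03036
      (by norm_num) (by norm_num) (by norm_num) (by norm_num) (by norm_num)
  exact h.exists_of_add hg (g₁ := 0) (by linarith) c₄ 0 1.2346 0 0.7887 0.4948 4.6609 5.0985 0.9871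
    0.00767
    (by norm_num) (by norm_num) (by norm_num) (by norm_num) (by norm_num)

lemma numBounds_two {m : ℝ} (h₁ : 2 ≤ m) (h₂ : m ≤ 2.5) :
    NumBounds m 2 2.5 0.6058 0.0653 0.5526 0.6 0.2377 0.9312 1.0284 0.4753 := by
  have h := le_halfLogit_three h₁
  obtain ⟨s, rfl⟩ : ∃ s, m = 2 + s := ⟨m - 2, by ring⟩
  have hs : 0 ≤ s := by linarith
  have hw : 0 ≤ 0.5 - s := by linarith
  have hsw := mul_nonneg hs hw
  refine numBounds_of (by norm_num) h₁ h₂ (le_tailLlr_zero_sq (by linarith) h ?_ ?_) ?_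
    (halfLogit_two_bounds.1.trans' (by norm_num))
    ((halfLogit_le_three (by norm_num)).trans (by norm_num))
    (halfLogit_two_bounds.2.trans (by norm_num))
    (by norm_num)
  · positivity
  · nlinarith [mul_nonneg hsw hs, mul_nonneg hsw hw, mul_nonneg hsw (sq_nonneg s),
      mul_nonneg (mul_nonneg hsw hs) hw, mul_nonneg hsw (pow_nonneg hs 3), mul_nonneg hsw
        (pow_nonneg hs 4)]
  · linarith [oddExcess_anti (by linarith : (0 : ℝ) ≤ 2 + s) h₂, le_oddExcess_five_halves]

lemma exists_infRisk_lt_of_two_le {m g : ℝ} (h₁ : 2 ≤ m) (h₂ : m ≤ 2.5) (hg : 0 < g)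
    (hgl : g ≤ tailLlr m 0) : ∃ a₀ ∈ Ioo 0 g, ∀ a ≤ 0, infRisk m g a₀ < infRisk m g a := by
  have h := numBounds_two h₁ h₂
  have c₀ : g ≤ 1 * tailLlr m 0 := by linarith
  rcases le_total (0.995 * tailLlr m 0) g with c | c₁
  · exact h.exists_of_mul hg c c₀ 1.3881 0.6922 0.5612 2.9762 6.0617 0.7094 0.10357
      (by norm_num) (by norm_num) (by norm_num) (by norm_num)
  rcases le_total (0.985 * tailLlr m 0) g with c | c₂
  · exact h.exists_of_mul hg c c₁ 1.3789 0.6943 0.5603 3.0392 6.0391 0.7123 0.09776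
      (by norm_num) (by norm_num) (by norm_num) (by norm_num)
  rcases le_total (0.969 * tailLlr m 0) g with c | c₃
  · exact h.exists_of_mul hg c c₂ 1.3638 0.6972 0.5591 3.1486 6.002 0.7161 0.08813
      (by norm_num) (by norm_num) (by norm_num) (by norm_num)
  rcases le_total (0.915 * tailLlr m 0) g with c | c₄
  · exact h.exists_of_add hg c c₃ 0.08 1.3194 0.2373 0.7037 0.5565 3.5305 5.934 0.7244 0.06214
      (by norm_num) (by norm_num) (by norm_num) (by norm_num) (by norm_num)
  rcases le_total (0.678 * tailLlr m 0) g with c | c₅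
  · exact h.exists_of_add hg c c₄ 0.08 1.2772 0.1647 0.7238 0.548 4.0074 5.7306 0.7515 0.04159
      (by norm_num) (by norm_num) (by norm_num) (by norm_num) (by norm_num)
  exact h.exists_of_add hg (g₁ := 0) (by linarith) c₅ 0 1.2373 0 0.8012 0.5077 4.613 5.1021 0.8801
    0.01137
    (by norm_num) (by norm_num) (by norm_num) (by norm_num) (by norm_num)

lemma numBounds_five_halves {m : ℝ} (h₁ : 2.5 ≤ m) (h₂ : m ≤ 3) :
    NumBounds m 2.5 3 0.62 0.06304 0.543 0.58 0.2057 1.007 1.1219 0.4114 := by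
  have h := le_halfLogit_three (by linarith)
  obtain ⟨s, rfl⟩ : ∃ s, m = 2.5 + s := ⟨m - 2.5, by ring⟩
  have hs : 0 ≤ s := by linarith
  have hw : 0 ≤ 0.5 - s := by linarith
  have hsw := mul_nonneg hs hw
  refine numBounds_of (by norm_num) h₁ h₂ (le_tailLlr_zero_sq (by linarith) h ?_ ?_) ?_
    ((le_halfLogit_three (by norm_num)).trans' (by norm_num))
    ((halfLogit_le_three (by norm_num)).trans (by norm_num))
    ((halfLogit_le_three (by norm_num)).trans (by norm_num))
    (by norm_num)
  · linarith [sq_nonneg (2.5 + s - 2)]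
  · nlinarith [mul_nonneg hsw hs, mul_nonneg hsw hw, mul_nonneg hsw (sq_nonneg s),
      mul_nonneg (mul_nonneg hsw hs) hw, mul_nonneg hsw (pow_nonneg hs 3), mul_nonneg hsw
        (pow_nonneg hs 4)]
  · have := le_oddExcess_of_three_le (le_refl (3 : ℝ)) le_rfl
    norm_num at this
    linarith [oddExcess_anti (by linarith : (0 : ℝ) ≤ 2.5 + s) h₂]

lemma exists_infRisk_lt_of_five_halves_le {m g : ℝ} (h₁ : 2.5 ≤ m) (h₂ : m ≤ 3) (hg : 0 < g)
    (hgl : g ≤ tailLlr m 0) : ∃ a₀ ∈ Ioo 0 g, ∀ a ≤ 0, infRisk m g a₀ < infRisk m g a := by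
  have h := numBounds_five_halves h₁ h₂
  have c₀ : g ≤ 1 * tailLlr m 0 := by linarith
  rcases le_total (0.971 * tailLlr m 0) g with c | c₁
  · exact h.exists_of_mul hg c c₀ 1.3635 0.7523 0.534 3.1506 5.4969 0.7644 0.09965
      (by norm_num) (by norm_num) (by norm_num) (by norm_num)
  rcases le_total (0.921 * tailLlr m 0) g with c | c₂
  · exact h.exists_of_mul hg c c₁ 1.3227 0.7633 0.5293 3.4986 5.4055 0.7786 0.07183
      (by norm_num) (by norm_num) (by norm_num) (by norm_num)
  rcases le_total (0.868 * tailLlr m 0) g with c | c₃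
  · exact h.exists_of_mul hg c c₂ 1.2828 0.7817 0.521 3.9356 5.2627 0.8037 0.04337
      (by norm_num) (by norm_num) (by norm_num) (by norm_num)
  rcases le_total (0.83 * tailLlr m 0) g with c | c₄
  · exact h.exists_of_mul hg c c₃ 1.2568 0.8028 0.5113 4.2931 5.1209 0.8331 0.02467
      (by norm_num) (by norm_num) (by norm_num) (by norm_num)
  exact h.exists_of_add hg (g₁ := 0) (by linarith) c₄ 0 1.2411 0 0.817 0.5043 4.5474 5.0318 0.8543
    0.01566
    (by norm_num) (by norm_num) (by norm_num) (by norm_num) (by norm_num)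

lemma numBounds_three {m : ℝ} (h₁ : 3 ≤ m) (h₂ : m ≤ 3.5) :
    NumBounds m 3 3.5 0.7073 0.05307 0.5335 0.5667 0.187 1.0896 1.2244 0.374 := by
  have h := le_halfLogit_of_three_le (by norm_num) h₁ le_halfLogit_sub_sq_nodes.1
  have hsq := le_tailLlr_zero_sq_of_add (t := 10.5) (by linarith) (by norm_num) (by norm_num) h
  refine numBounds_of (by norm_num) h₁ h₂ ?_ ?_
    (by linarith [le_halfLogit_sub_sq_nodes.1])
    ((halfLogit_le_three (by norm_num)).trans (by norm_num))
    ((halfLogit_le_three (by norm_num)).trans (by norm_num))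
    (by norm_num)
  · have := sq_nonneg m
    norm_num at hsq ⊢
    linarith
  · exact (le_oddExcess_of_three_le (by linarith) h₂).trans' (by norm_num)

lemma exists_infRisk_lt_of_three_le {m g : ℝ} (h₁ : 3 ≤ m) (h₂ : m ≤ 3.5) (hg : 0 < g)
    (hgl : g ≤ tailLlr m 0) : ∃ a₀ ∈ Ioo 0 g, ∀ a ≤ 0, infRisk m g a₀ < infRisk m g a := by
  have h := numBounds_three h₁ h₂
  have c₀ : g ≤ 1 * tailLlr m 0 := by linarith
  rcases le_total (0.968 * tailLlr m 0) g with c | c₁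
  · exact h.exists_of_mul hg c c₀ 1.3514 0.796 0.5154 3.2454 5.1592 0.8012 0.10273
      (by norm_num) (by norm_num) (by norm_num) (by norm_num)
  rcases le_total (0.905 * tailLlr m 0) g with c | c₂
  · exact h.exists_of_mul hg c c₁ 1.307 0.8078 0.5101 3.6566 5.079 0.8166 0.06998
      (by norm_num) (by norm_num) (by norm_num) (by norm_num)
  exact h.exists_of_add hg (g₁ := 0) (by linarith) c₂ 0 1.2438 0 0.831 0.4991 4.5009 4.9358 0.8488
    0.01927
    (by norm_num) (by norm_num) (by norm_num) (by norm_num) (by norm_num)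

lemma numBounds_seven_halves {m : ℝ} (h₁ : 3.5 ≤ m) (h₂ : m ≤ 4) :
    NumBounds m 3.5 4 0.7083 0.05652 0.5262 0.5572 0.175 1.1841 1.3326 0.3499 := by
  have h := le_halfLogit_of_three_le (by norm_num) h₁ le_halfLogit_sub_sq_nodes.2.1
  have hsq := le_tailLlr_zero_sq_of_add (t := 14) (by linarith) (by norm_num) (by norm_num) h
  refine numBounds_of (by norm_num) h₁ h₂ ?_ ?_
    (by linarith [le_halfLogit_sub_sq_nodes.2.1])
    ((halfLogit_le_three (by norm_num)).trans (by norm_num))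
    ((halfLogit_le_three (by norm_num)).trans (by norm_num))
    (by norm_num)
  · have := sq_nonneg m
    norm_num at hsq ⊢
    linarith
  · exact (le_oddExcess_of_three_le (by linarith) h₂).trans' (by norm_num)

lemma exists_infRisk_lt_of_seven_halves_le {m g : ℝ} (h₁ : 3.5 ≤ m) (h₂ : m ≤ 4) (hg : 0 < g)
    (hgl : g ≤ tailLlr m 0) : ∃ a₀ ∈ Ioo 0 g, ∀ a ≤ 0, infRisk m g a₀ < infRisk m g a := by
  have h := numBounds_seven_halves h₁ h₂
  have c₀ : g ≤ 1 * tailLlr m 0 := by linarith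
  rcases le_total (0.997 * tailLlr m 0) g with c | c₁
  · exact h.exists_of_mul hg c c₀ 1.3784 0.8299 0.5026 3.0425 4.8965 0.8247 0.12715
      (by norm_num) (by norm_num) (by norm_num) (by norm_num)
  rcases le_total (0.982 * tailLlr m 0) g with c | c₂
  · exact h.exists_of_mul hg c c₁ 1.367 0.8308 0.5022 3.1245 4.8907 0.8259 0.11921
      (by norm_num) (by norm_num) (by norm_num) (by norm_num)
  rcases le_total (0.932 * tailLlr m 0) g with c | c₃
  · exact h.exists_of_mul hg c c₂ 1.3312 0.8363 0.4996 3.4188 4.8589 0.8333 0.09312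
      (by norm_num) (by norm_num) (by norm_num) (by norm_num)
  exact h.exists_of_add hg (g₁ := 0) (by linarith) c₃ 0 1.2484 0 0.8417 0.4948 4.4245 4.7996 0.847
    0.02282
    (by norm_num) (by norm_num) (by norm_num) (by norm_num) (by norm_num)

lemma numBounds_four {m : ℝ} (h₁ : 4 ≤ m) (h₂ : m ≤ 4.25) :
    NumBounds m 4 4.25 0.7221 0.05801 0.5234 0.55 0.1666 1.2847 1.3881 0.3332 := by
  have h := le_halfLogit_of_three_le (by norm_num) h₁ le_halfLogit_sub_sq_nodes.2.2.1
  have hsq := le_tailLlr_zero_sq_of_add (t := 17) (by linarith) (by norm_num) (by norm_num) h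
  refine numBounds_of (by norm_num) h₁ h₂ ?_ ?_
    (by linarith [le_halfLogit_sub_sq_nodes.2.2.1])
    ((halfLogit_le_three (by norm_num)).trans (by norm_num))
    ((halfLogit_le_three (by norm_num)).trans (by norm_num))
    (by norm_num)
  · have := sq_nonneg m
    norm_num at hsq ⊢
    linarith
  · exact (le_oddExcess_of_three_le (by linarith) h₂).trans' (by norm_num)

lemma exists_infRisk_lt_of_four_le {m g : ℝ} (h₁ : 4 ≤ m) (h₂ : m ≤ 4.25) (hg : 0 < g)
    (hgl : g ≤ tailLlr m 0) : ∃ a₀ ∈ Ioo 0 g, ∀ a ≤ 0, infRisk m g a₀ < infRisk m g a := by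
  have h := numBounds_four h₁ h₂
  have c₀ : g ≤ 1 * tailLlr m 0 := by linarith
  exact h.exists_of_add hg (g₁ := 0) (by linarith) c₀ 0 1.2509 0 0.8534 0.4931 4.3855 4.7205 0.8397
    0.02538
    (by norm_num) (by norm_num) (by norm_num) (by norm_num) (by norm_num)

lemma numBounds_seventeen_fourths {m : ℝ} (h₁ : 4.25 ≤ m) (h₂ : m ≤ 4.5) :
    NumBounds m 4.25 4.5 0.7239 0.05879 0.5209 0.5471 0.1634 1.3364 1.4445 0.3267 := by
  have h := le_halfLogit_of_three_le (by norm_num) h₁ le_halfLogit_sub_sq_nodes.2.2.2.1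
  have hsq := le_tailLlr_zero_sq_of_add (t := 19.125) (by linarith) (by norm_num) (by norm_num) h
  refine numBounds_of (by norm_num) h₁ h₂ ?_ ?_
    (by linarith [le_halfLogit_sub_sq_nodes.2.2.2.1])
    ((halfLogit_le_three (by norm_num)).trans (by norm_num))
    ((halfLogit_le_three (by norm_num)).trans (by norm_num))
    (by norm_num)
  · have := sq_nonneg m
    norm_num at hsq ⊢
    linarith
  · exact (le_oddExcess_of_three_le (by linarith) h₂).trans' (by norm_num)

lemma exists_infRisk_lt_of_seventeen_fourths_le {m g : ℝ} (h₁ : 4.25 ≤ m) (h₂ : m ≤ 4.5)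
    (hg : 0 < g) (hgl : g ≤ tailLlr m 0) :
    ∃ a₀ ∈ Ioo 0 g, ∀ a ≤ 0, infRisk m g a₀ < infRisk m g a := by
  have h := numBounds_seventeen_fourths h₁ h₂
  have c₀ : g ≤ 1 * tailLlr m 0 := by linarith
  exact h.exists_of_add hg (g₁ := 0) (by linarith) c₀ 0 1.2525 0 0.8585 0.4908 4.3598 4.6687 0.8421
    0.027
    (by norm_num) (by norm_num) (by norm_num) (by norm_num) (by norm_num)

lemma numBounds_nine_halves {m : ℝ} (h₁ : 4.5 ≤ m) (h₂ : m ≤ 5) :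
    NumBounds m 4.5 5 0.7205 0.0597 0.517 0.5445 0.1605 1.3893 1.559 0.321 := by
  have h := le_halfLogit_of_three_le (by norm_num) h₁ le_halfLogit_sub_sq_nodes.2.2.2.2.1
  have hsq := le_tailLlr_zero_sq_of_add (t := 22.5) (by linarith) (by norm_num) (by norm_num) h
  refine numBounds_of (by norm_num) h₁ h₂ ?_ ?_
    (by linarith [le_halfLogit_sub_sq_nodes.2.2.2.2.1])
    ((halfLogit_le_three (by norm_num)).trans (by norm_num))
    ((halfLogit_le_three (by norm_num)).trans (by norm_num))
    (by norm_num)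
  · have := sq_nonneg m
    norm_num at hsq ⊢
    linarith
  · exact (le_oddExcess_of_three_le (by linarith) h₂).trans' (by norm_num)

lemma exists_infRisk_lt_of_nine_halves_le {m g : ℝ} (h₁ : 4.5 ≤ m) (h₂ : m ≤ 5) (hg : 0 < g)
    (hgl : g ≤ tailLlr m 0) : ∃ a₀ ∈ Ioo 0 g, ∀ a ≤ 0, infRisk m g a₀ < infRisk m g a := by
  have h := numBounds_nine_halves h₁ h₂
  have c₀ : g ≤ 1 * tailLlr m 0 := by linarith
  exact h.exists_of_add hg (g₁ := 0) (by linarith) c₀ 0 1.2539 0 0.8696 0.4872 4.3373 4.6048 0.8494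
    0.02992
    (by norm_num) (by norm_num) (by norm_num) (by norm_num) (by norm_num)

lemma numBounds_five {m : ℝ} (h₁ : 5 ≤ m) (h₂ : m ≤ 6) :
    NumBounds m 5 6 0.7197 0.0608 0.5116 0.54 0.1559 1.4971 1.7932 0.3118 := by
  have h := le_halfLogit_of_three_le (by norm_num) h₁ le_halfLogit_sub_sq_nodes.2.2.2.2.2.1
  have hsq := le_tailLlr_zero_sq_of_add (t := 30) (by linarith) (by norm_num) (by norm_num) h
  refine numBounds_of (by norm_num) h₁ h₂ ?_ ?_
    (by linarith [le_halfLogit_sub_sq_nodes.2.2.2.2.2.1])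
    ((halfLogit_le_three (by norm_num)).trans (by norm_num))
    ((halfLogit_le_three (by norm_num)).trans (by norm_num))
    (by norm_num)
  · have := sq_nonneg m
    norm_num at hsq ⊢
    linarith
  · exact (le_oddExcess_of_three_le (by linarith) h₂).trans' (by norm_num)

lemma exists_infRisk_lt_of_five_le {m g : ℝ} (h₁ : 5 ≤ m) (h₂ : m ≤ 6) (hg : 0 < g)
    (hgl : g ≤ tailLlr m 0) : ∃ a₀ ∈ Ioo 0 g, ∀ a ≤ 0, infRisk m g a₀ < infRisk m g a := by
  have h := numBounds_five h₁ h₂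
  have c₀ : g ≤ 1 * tailLlr m 0 := by linarith
  rcases le_total (0.988 * tailLlr m 0) g with c | c₁
  · exact h.exists_of_mul hg c c₀ 1.3735 0.8877 0.4809 3.0773 4.5062 0.8611 0.13397
      (by norm_num) (by norm_num) (by norm_num) (by norm_num)
  exact h.exists_of_add hg (g₁ := 0) (by linarith) c₁ 0 1.2566 0 0.8901 0.4794 4.2964 4.4927 0.8652
    0.03557
    (by norm_num) (by norm_num) (by norm_num) (by norm_num) (by norm_num)

/-- The unbounded interval: all bounds are relative to `m` here, so that they hold uniformly. -/
lemma exists_infRisk_lt_of_six_le {m g : ℝ} (h₁ : 6 ≤ m) (hg : 0 < g)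
    (hgl : g ≤ tailLlr m 0) : ∃ a₀ ∈ Ioo 0 g, ∀ a ≤ 0, infRisk m g a₀ < infRisk m g a := by
  have hm : 0 < m := by linarith
  have hsq : (36 : ℝ) ≤ m ^ 2 := by nlinarith
  have h := le_halfLogit_of_three_le (by norm_num) h₁ le_halfLogit_sub_sq_nodes.2.2.2.2.2.2
  have hr := tailLlr_zero_le_mul (by norm_num) h₁ (r := 0.2989)
    ((halfLogit_le_three (by norm_num)).trans (by norm_num))
  have hAB : 0.6573 + 0.0625 * m ^ 2 ≤ tailLlr m 0 ^ 2 :=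
    le_tailLlr_zero_sq hm h (by positivity) (by nlinarith)
  obtain ⟨ρ, hS, he⟩ := exists_slopeBounds (k := 0.5) (K := 0.5334) (e := 0.1495) (u := 0)
    (r := 0.2989)
    hm h₁ (by linarith [oddExcess_nonneg m]) (by norm_num) (by norm_num)
    (Or.inr ⟨hr, by norm_num⟩)
  have c₀ : g ≤ 1 * tailLlr m 0 := by linarith
  rcases le_total (0.957 * tailLlr m 0) g with c | c₁
  · exact exists_infRisk_lt_of_mul (ν := 1.3482) (β := 0.9007) (θ := 0.4751) (q₁ := 3.2716)
      (q₂ := 4.449) (z := 0.8704)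
      (ε := 0.11892) (u := 0) hm hg c c₀ hAB hS he (by norm_num) (Or.inr ⟨hr, by norm_num⟩)
      (Or.inr ⟨hr, by norm_num⟩) (by norm_num) (by norm_num) (by norm_num) (by norm_num; linarith)
      (by norm_num) (by norm_num) (by norm_num) (by norm_num; linarith) (by norm_num) (by norm_num)
      (by norm_num) (by norm_num)
  rcases le_total (0.905 * tailLlr m 0) g with c | c₂
  · exact exists_infRisk_lt_of_mul (ν := 1.3218) (β := 0.9166) (θ := 0.4671) (q₁ := 3.5073)
      (q₂ := 4.3885) (z := 0.8919)
      (ε := 0.09756) (u := 0) hm hg c c₁ hAB hS he (by norm_num) (Or.inr ⟨hr, by norm_num⟩)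
      (Or.inr ⟨hr, by norm_num⟩) (by norm_num) (by norm_num) (by norm_num) (by norm_num; linarith)
      (by norm_num) (by norm_num) (by norm_num) (by norm_num; linarith) (by norm_num) (by norm_num)
      (by norm_num) (by norm_num)
  exact exists_infRisk_lt_of_add (lam := 0) (ν := 1.2596) (β := 0.9343) (θ := 0.4574) (q₁ := 4.2507)
    (q₂ := 4.3253) (z := 0.9179)
    (ε := 0.04862) (u := 0) hm hg (g₁ := 0) (by linarith) c₂ hAB hS he (add_zero_le_evenLlr hm _ _)
      (by norm_num)
    (Or.inr ⟨hr, by norm_num⟩) (Or.inr ⟨hr, by norm_num⟩) (by norm_num) (by norm_num) (by norm_num)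
    (by norm_num; linarith) (by norm_num) (by norm_num) (by norm_num) (by norm_num; linarith)
    (by norm_num) (by norm_num) (by norm_num) (by norm_num)

/-- For `g ≤ tailLlr m 0`, no nonpositive first threshold is optimal. -/
lemma exists_infRisk_lt_of_nonpos_of_le {m g : ℝ} (hm : 0 < m) (hg : 0 < g)
    (hgl : g ≤ tailLlr m 0) :
    ∃ a₀ ∈ Ioo 0 g, ∀ a ≤ 0, infRisk m g a₀ < infRisk m g a := by
  rcases le_total m 1 with h | h1
  · exact exists_infRisk_lt_of_le_one hm h hg hgl
  rcases le_total m 1.5 with h | h2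
  · exact exists_infRisk_lt_of_one_le h1 h hg hgl
  rcases le_total m 2 with h | h3
  · exact exists_infRisk_lt_of_three_halves_le h2 h hg hgl
  rcases le_total m 2.5 with h | h4
  · exact exists_infRisk_lt_of_two_le h3 h hg hgl
  rcases le_total m 3 with h | h5
  · exact exists_infRisk_lt_of_five_halves_le h4 h hg hgl
  rcases le_total m 3.5 with h | h6
  · exact exists_infRisk_lt_of_three_le h5 h hg hgl
  rcases le_total m 4 with h | h7
  · exact exists_infRisk_lt_of_seven_halves_le h6 h hg hgl
  rcases le_total m 4.25 with h | h8
  · exact exists_infRisk_lt_of_four_le h7 h hg hgl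
  rcases le_total m 4.5 with h | h9
  · exact exists_infRisk_lt_of_seventeen_fourths_le h8 h hg hgl
  rcases le_total m 5 with h | h10
  · exact exists_infRisk_lt_of_nine_halves_le h9 h hg hgl
  rcases le_total m 6 with h | h11
  · exact exists_infRisk_lt_of_five_le h10 h hg hgl
  exact exists_infRisk_lt_of_six_le h11 hg hgl

/-! ### Optimal first thresholds -/

lemma curveRisk_neg (m g a b : ℝ) :
    curveRisk m g (-a) b = Real.exp (2 * m * g) * curveRisk m (-g) a (-b) := by
  have e : Real.exp (2 * m * -g) * Real.exp (2 * m * g) = 1 := by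
    rw [← Real.exp_add, ← Real.exp_zero]; ring_nf
  have h1 : thrOne m (-b) = -thrZero m b := by simp [thrOne, thrZero]; ring
  have h0 : thrZero m (-b) = -thrOne m b := by simp [thrOne, thrZero]; ring
  simp only [curveRisk, risk, h1, h0]
  have r1 : ∀ x, -m - -x = x - m := fun x => by ring
  have r2 : ∀ x, -x + m = m - x := fun x => by ring
  have r3 : ∀ x, -x - m = -m - x := fun x => by ring
  have r4 : m - -a = a + m := by ring
  rw [r1, r1, r1, r2, r3, r3, r3, r4]
  linear_combination -(ncdf (-m - a) * ncdf (thrZero m b - m) +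
    ncdf (a + m) * ncdf (thrOne m b - m)) * e

/-- Exchanging the two states reverses the signs of all thresholds. -/
lemma infRisk_neg (m g a : ℝ) :
    infRisk m g (-a) = Real.exp (2 * m * g) * infRisk m (-g) a := by
  rw [infRisk, infRisk, Real.mul_iInf_of_nonneg (Real.exp_pos _).le]
  simp_rw [curveRisk_neg m g a]
  exact (Equiv.neg ℝ).surjective.iInf_comp fun b => Real.exp (2 * m * g) * curveRisk m (-g) a b

lemma curveRisk_le_add (m g a a' b : ℝ) : curveRisk m g a b ≤ curveRisk m g a' b +
    (Real.exp (2 * m * g) * |ncdf (a + m) - ncdf (a' + m)| + |ncdf (a - m) - ncdf (a' - m)|) := by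
  have key : ∀ p q d : ℝ, 0 < p → p < 1 → 0 < q → q < 1 → d * (p - q) ≤ |d| :=
      fun p q d hp hp' hq hq' => by
    refine (le_abs_self _).trans ?_
    rw [abs_mul]
    exact mul_le_of_le_one_right (abs_nonneg d) (abs_le.2 ⟨by linarith, by linarith⟩)
  have h1 := key (ncdf (-m - thrZero m b)) (ncdf (-m - thrOne m b)) (ncdf (a + m) - ncdf (a' + m))
    (ncdf_pos _) (ncdf_lt_one _) (ncdf_pos _) (ncdf_lt_one _)
  have h2 := key (ncdf (thrZero m b - m)) (ncdf (thrOne m b - m)) (ncdf (a - m) - ncdf (a' - m))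
    (ncdf_pos _) (ncdf_lt_one _) (ncdf_pos _) (ncdf_lt_one _)
  have h3 := mul_le_mul_of_nonneg_left h1 (Real.exp_pos (2 * m * g)).le
  have e1 : ∀ x, ncdf (-m - x) = 1 - ncdf (x + m) := fun x => by rw [ncdf_add_eq, sub_sub_cancel]
  have e2 : ∀ x, ncdf (m - x) = 1 - ncdf (x - m) := fun x => ncdf_sub_eq x m
  simp only [curveRisk, risk]
  rw [e1 a, e1 a', e2 a, e2 a']
  linarith

/-- The risks `curveRisk m g · b` are equicontinuous. -/
lemma continuous_infRisk (m g : ℝ) : Continuous (infRisk m g) := by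
  have h : ∀ a a', infRisk m g a ≤ infRisk m g a' + (Real.exp (2 * m * g) *
      |ncdf (a + m) - ncdf (a' + m)| + |ncdf (a - m) - ncdf (a' - m)|) := fun a a' => by
    rw [← sub_le_iff_le_add]
    refine le_ciInf fun b => ?_
    rw [sub_le_iff_le_add]
    exact (infRisk_le m g a b).trans (curveRisk_le_add m g a a' b)
  rw [continuous_iff_continuousAt]
  intro a
  have hc : Tendsto (fun a' => Real.exp (2 * m * g) * |ncdf (a + m) - ncdf (a' + m)| +
      |ncdf (a - m) - ncdf (a' - m)|) (𝓝 a) (𝓝 0) := by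
    have hcont := continuous_ncdf
    have : Continuous fun a' => Real.exp (2 * m * g) * |ncdf (a + m) - ncdf (a' + m)| +
      |ncdf (a - m) - ncdf (a' - m)| := by fun_prop
    simpa using this.tendsto a
  rw [ContinuousAt, tendsto_iff_dist_tendsto_zero]
  refine squeeze_zero (fun _ => dist_nonneg) (fun a' => ?_) hc
  have h1 := h a a'
  have h2 := h a' a
  rw [abs_sub_comm (ncdf (a' + m)), abs_sub_comm (ncdf (a' - m))] at h2
  rw [Real.dist_eq, abs_le]
  constructor <;> linarith

/-- Nonpositive first thresholds are not optimal for `g > 0`. -/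
lemma exists_infRisk_lt_of_nonpos_of_pos {m g : ℝ} (hm : 0 < m) (hg : 0 < g) :
    ∃ a₀ ∈ Ioo 0 g, ∀ a ≤ 0, infRisk m g a₀ < infRisk m g a :=
  (le_or_gt g (tailLlr m 0)).elim (exists_infRisk_lt_of_nonpos_of_le hm hg)
    (exists_infRisk_lt_of_nonpos_of_lt hm)

lemma infRisk_minimizers_of_pos {m g : ℝ} (hm : 0 < m) (hg : 0 < g) :
    (∃ a, ∀ a', infRisk m g a ≤ infRisk m g a') ∧
      ∀ a, (∀ a', infRisk m g a ≤ infRisk m g a') → a ∈ Ioo 0 g := by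
  obtain ⟨a₁, h₁, hlt₁⟩ := exists_infRisk_lt_of_nonpos_of_pos hm hg
  obtain ⟨a₂, h₂, hlt₂⟩ := exists_infRisk_lt_of_ge hm hg
  constructor
  · obtain ⟨a, -, ha⟩ := isCompact_Icc.exists_isMinOn (nonempty_Icc.2 hg.le)
      (continuous_infRisk m g).continuousOn
    refine ⟨a, fun a' => ?_⟩
    rcases le_or_gt a' 0 with h | h
    · exact (ha (Ioo_subset_Icc_self h₁)).trans (hlt₁ a' h).le
    rcases le_or_gt g a' with h' | h'
    · exact (ha (Ioo_subset_Icc_self h₂)).trans (hlt₂ a' h').le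
    · exact ha ⟨h.le, h'.le⟩
  · intro a ha
    constructor
    · by_contra! h
      exact (hlt₁ a h).not_ge (ha a₁)
    · by_contra! h
      exact (hlt₂ a h).not_ge (ha a₂)

lemma forall_infRisk_le_neg {m g a : ℝ} :
    (∀ a', infRisk m g (-a) ≤ infRisk m g a') ↔ ∀ a', infRisk m (-g) a ≤ infRisk m (-g) a' := by
  rw [(Equiv.neg ℝ).surjective.forall]
  simp only [Equiv.neg_apply, infRisk_neg, mul_le_mul_iff_right₀ (Real.exp_pos _)]

lemma infRisk_zero_lt {m a : ℝ} (hm : 0 < m) (ha : a ≠ 0) : infRisk m 0 0 < infRisk m 0 a := by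
  rcases ha.lt_or_gt with h | h
  · have := infRisk_neg m 0 (-a)
    rw [neg_neg, neg_zero, mul_zero, Real.exp_zero, one_mul] at this
    rw [this]
    exact infRisk_zero_lt_of_pos hm (by linarith)
  · exact infRisk_zero_lt_of_pos hm h

/-- An optimal first threshold exists, and each one lies strictly between `0` and `g`, or equals
`0` if `g = 0`. -/
lemma infRisk_minimizers {m : ℝ} (hm : 0 < m) (g : ℝ) :
    (∃ a, ∀ a', infRisk m g a ≤ infRisk m g a') ∧
      ∀ a, (∀ a', infRisk m g a ≤ infRisk m g a') →
        (0 < g → 0 < a ∧ a < g) ∧ (g = 0 → a = 0) ∧ (g < 0 → g < a ∧ a < 0) := by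
  rcases lt_trichotomy g 0 with hg | rfl | hg
  · obtain ⟨⟨a, ha⟩, h⟩ := infRisk_minimizers_of_pos hm (neg_pos.2 hg)
    refine ⟨⟨-a, forall_infRisk_le_neg.2 ha⟩, fun a ha => ?_⟩
    have := h (-a) (forall_infRisk_le_neg.1 (by rwa [neg_neg]))
    refine ⟨fun h => (hg.not_gt h).elim, fun h => (hg.ne h).elim, fun _ => ?_⟩
    constructor <;> linarith [this.1, this.2]
  · refine ⟨⟨0, fun a' => ?_⟩, fun a ha => ?_⟩
    · rcases eq_or_ne a' 0 with rfl | h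
      · rfl
      · exact (infRisk_zero_lt hm h).le
    · refine ⟨fun h => (lt_irrefl _ h).elim, fun _ => ?_, fun h => (lt_irrefl _ h).elim⟩
      by_contra h
      exact (infRisk_zero_lt hm h).not_ge (ha 0)
  · obtain ⟨hex, h⟩ := infRisk_minimizers_of_pos hm hg
    exact ⟨hex, fun a ha => ⟨fun _ => h a ha, fun h => (hg.ne' h).elim,
      fun h => (hg.not_gt h).elim⟩⟩

/-! ### Reduction to thresholds -/

/-- The threshold on the normalized signal `(y - h₁ / 2) / σ` that corresponds to the belief `q`;
here `m = h₁ / (2 * σ)`. -/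
def threshold (c₁₀ c₀₁ m q : ℝ) : ℝ := Real.log (c₁₀ * q / (c₀₁ * (1 - q))) / (2 * m)

section Threshold

variable {c₁₀ c₀₁ m : ℝ}

lemma exp_threshold (hc₁₀ : 0 < c₁₀) (hc₀₁ : 0 < c₀₁) (hm : 0 < m) {q : ℝ}
    (hq : q ∈ Ioo (0 : ℝ) 1) :
    Real.exp (2 * m * threshold c₁₀ c₀₁ m q) = c₁₀ * q / (c₀₁ * (1 - q)) := by
  have h0 := hq.1
  have h1 : 0 < 1 - q := sub_pos.2 hq.2
  rw [threshold, mul_div_cancel₀ _ (by positivity), Real.exp_log (by positivity)]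

lemma threshold_lt_threshold (hc₁₀ : 0 < c₁₀) (hc₀₁ : 0 < c₀₁) (hm : 0 < m) {q q' : ℝ}
    (hq : q ∈ Ioo (0 : ℝ) 1) (hq' : q' ∈ Ioo (0 : ℝ) 1) :
    threshold c₁₀ c₀₁ m q < threshold c₁₀ c₀₁ m q' ↔ q < q' := by
  have h1 : 0 < 1 - q := sub_pos.2 hq.2
  have h1' : 0 < 1 - q' := sub_pos.2 hq'.2
  rw [← mul_lt_mul_iff_right₀ (by positivity : 0 < 2 * m), ← Real.exp_lt_exp,
    exp_threshold hc₁₀ hc₀₁ hm hq, exp_threshold hc₁₀ hc₀₁ hm hq',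
    div_lt_div_iff₀ (by positivity) (by positivity)]
  have : c₁₀ * q' * (c₀₁ * (1 - q)) - c₁₀ * q * (c₀₁ * (1 - q')) = c₁₀ * c₀₁ * (q' - q) := by ring
  rw [← sub_pos, this, mul_pos_iff_of_pos_left (by positivity), sub_pos]

lemma threshold_inj (hc₁₀ : 0 < c₁₀) (hc₀₁ : 0 < c₀₁) (hm : 0 < m) {q q' : ℝ}
    (hq : q ∈ Ioo (0 : ℝ) 1) (hq' : q' ∈ Ioo (0 : ℝ) 1) :
    threshold c₁₀ c₀₁ m q = threshold c₁₀ c₀₁ m q' ↔ q = q' := by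
  refine ⟨fun h => ?_, fun h => by rw [h]⟩
  have h1 := (threshold_lt_threshold hc₁₀ hc₀₁ hm hq hq').not.1 h.not_lt
  have h2 := (threshold_lt_threshold hc₁₀ hc₀₁ hm hq' hq).not.1 h.not_gt
  linarith

lemma exists_threshold_eq (hc₁₀ : 0 < c₁₀) (hc₀₁ : 0 < c₀₁) (hm : 0 < m) (a : ℝ) :
    ∃ q ∈ Ioo (0 : ℝ) 1, threshold c₁₀ c₀₁ m q = a := by
  have he := Real.exp_pos (2 * m * a)
  have hd : 0 < c₁₀ + c₀₁ * Real.exp (2 * m * a) := by positivity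
  refine ⟨c₀₁ * Real.exp (2 * m * a) / (c₁₀ + c₀₁ * Real.exp (2 * m * a)),
    ⟨by positivity, (div_lt_one hd).2 (by linarith)⟩, ?_⟩
  have : c₁₀ * (c₀₁ * Real.exp (2 * m * a) / (c₁₀ + c₀₁ * Real.exp (2 * m * a))) /
      (c₀₁ * (1 - c₀₁ * Real.exp (2 * m * a) / (c₁₀ + c₀₁ * Real.exp (2 * m * a)))) =
      Real.exp (2 * m * a) := by
    rw [one_sub_div hd.ne', add_sub_cancel_right]
    field_simp
  rw [threshold, this, Real.log_exp]
  field_simp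

lemma div_add_mem_Ioo (hc₁₀ : 0 < c₁₀) (hc₀₁ : 0 < c₀₁) : c₀₁ / (c₁₀ + c₀₁) ∈ Ioo (0 : ℝ) 1 :=
  ⟨by positivity, (div_lt_one (by positivity)).2 (by linarith)⟩

lemma threshold_div_add (hc₁₀ : 0 < c₁₀) (hc₀₁ : 0 < c₀₁) :
    threshold c₁₀ c₀₁ m (c₀₁ / (c₁₀ + c₀₁)) = 0 := by
  have : c₁₀ * (c₀₁ / (c₁₀ + c₀₁)) / (c₀₁ * (1 - c₀₁ / (c₁₀ + c₀₁))) = 1 := by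
    rw [one_sub_div (by positivity), add_sub_cancel_right]
    field_simp
  rw [threshold, this, Real.log_one, zero_div]

/-- Multiplying the likelihoods of the two states by `u` and `v` shifts the threshold. -/
lemma threshold_update (hc₁₀ : 0 < c₁₀) (hc₀₁ : 0 < c₀₁) {q u v : ℝ}
    (hq : q ∈ Ioo (0 : ℝ) 1) (hu : 0 < u) (hv : 0 < v) :
    q * u / (q * u + (1 - q) * v) ∈ Ioo (0 : ℝ) 1 ∧
    threshold c₁₀ c₀₁ m (q * u / (q * u + (1 - q) * v)) =
      threshold c₁₀ c₀₁ m q + (Real.log u - Real.log v) / (2 * m) := by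
  have h0 := hq.1
  have h1 : 0 < 1 - q := sub_pos.2 hq.2
  have hd : 0 < q * u + (1 - q) * v := by positivity
  have hv' : 0 < (1 - q) * v := by positivity
  refine ⟨⟨by positivity, (div_lt_one hd).2 (by linarith)⟩, ?_⟩
  have : c₁₀ * (q * u / (q * u + (1 - q) * v)) / (c₀₁ * (1 - q * u / (q * u + (1 - q) * v))) =
      c₁₀ * q / (c₀₁ * (1 - q)) * (u / v) := by
    rw [one_sub_div hd.ne', add_sub_cancel_left]
    field_simp
  rw [threshold, this, Real.log_mul (by positivity) (by positivity), Real.log_div hu.ne' hv.ne',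
    add_div, threshold]

end Threshold

section Signals

variable {c₁₀ c₀₁ h₁ σ : ℝ}

lemma lrtDecision_eq_one_iff (hc₁₀ : 0 < c₁₀) (hc₀₁ : 0 < c₀₁) (hh₁ : 0 < h₁) (hσ : 0 < σ) {q : ℝ}
    (hq : q ∈ Ioo (0 : ℝ) 1) (y : ℝ) : lrtDecision c₁₀ c₀₁ h₁ σ q y = 1 ↔
      h₁ / 2 + σ * threshold c₁₀ c₀₁ (h₁ / (2 * σ)) q < y := by
  have hm : 0 < h₁ / (2 * σ) := by positivity
  have hσ2 : ((Real.toNNReal (σ ^ 2) : NNReal) : ℝ) = σ ^ 2 := Real.coe_toNNReal _ (by positivity)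
  have hlr : likelihood h₁ σ 1 y / likelihood h₁ σ 0 y =
      Real.exp (2 * (h₁ / (2 * σ)) * ((y - h₁ / 2) / σ)) := by
    have hc : (√(2 * Real.pi * σ ^ 2))⁻¹ ≠ 0 := by positivity
    simp only [likelihood, signalMean, gaussianPDFReal, hσ2, if_true, one_ne_zero, if_false]
    rw [mul_div_mul_left _ _ hc, ← Real.exp_sub]
    congr 1
    field_simp
    ring
  rw [lrtDecision, hlr, ← exp_threshold hc₁₀ hc₀₁ hm hq]
  have : (if Real.exp (2 * (h₁ / (2 * σ)) * threshold c₁₀ c₀₁ (h₁ / (2 * σ)) q) <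
      Real.exp (2 * (h₁ / (2 * σ)) * ((y - h₁ / 2) / σ)) then (1 : Fin 2) else 0) = 1 ↔
      Real.exp (2 * (h₁ / (2 * σ)) * threshold c₁₀ c₀₁ (h₁ / (2 * σ)) q) <
      Real.exp (2 * (h₁ / (2 * σ)) * ((y - h₁ / 2) / σ)) := by
    split_ifs with h <;> simp [h]
  rw [this, Real.exp_lt_exp, mul_lt_mul_iff_right₀ (by positivity), lt_div_iff₀ hσ]
  constructor <;> intro h <;> linarith

lemma setOf_lrtDecision_eq_one (hc₁₀ : 0 < c₁₀) (hc₀₁ : 0 < c₀₁) (hh₁ : 0 < h₁) (hσ : 0 < σ) {q : ℝ}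
    (hq : q ∈ Ioo (0 : ℝ) 1) : {y | lrtDecision c₁₀ c₀₁ h₁ σ q y = 1} =
      Ioi (h₁ / 2 + σ * threshold c₁₀ c₀₁ (h₁ / (2 * σ)) q) :=
  ext fun y => lrtDecision_eq_one_iff hc₁₀ hc₀₁ hh₁ hσ hq y

lemma lrtDecision_eq_zero_iff {q y : ℝ} :
    lrtDecision c₁₀ c₀₁ h₁ σ q y = 0 ↔ ¬ lrtDecision c₁₀ c₀₁ h₁ σ q y = 1 := by
  rw [lrtDecision]
  split_ifs <;> simp

lemma setOf_lrtDecision_eq_zero (hc₁₀ : 0 < c₁₀) (hc₀₁ : 0 < c₀₁) (hh₁ : 0 < h₁) (hσ : 0 < σ)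
    {q : ℝ} (hq : q ∈ Ioo (0 : ℝ) 1) : {y | lrtDecision c₁₀ c₀₁ h₁ σ q y = 0} =
      Iic (h₁ / 2 + σ * threshold c₁₀ c₀₁ (h₁ / (2 * σ)) q) :=
  ext fun y => by
    rw [mem_ofPred_eq, lrtDecision_eq_zero_iff, lrtDecision_eq_one_iff hc₁₀ hc₀₁ hh₁ hσ hq, not_lt,
      mem_Iic]

lemma gaussianReal_Iic (hσ : 0 < σ) (μ x : ℝ) :
    (gaussianReal μ (Real.toNNReal (σ ^ 2))).real (Iic x) = ncdf ((x - μ) / σ) := by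
  have hmap : (gaussianReal 0 1).map (fun t => σ * t + μ) =
      gaussianReal μ (Real.toNNReal (σ ^ 2)) := by
    have : (fun t => σ * t + μ) = (· + μ) ∘ (σ * ·) := rfl
    rw [this, ← Measure.map_map (by fun_prop) (by fun_prop), gaussianReal_map_const_mul,
      gaussianReal_map_add_const]
    congr 1
    · simp
    · rw [mul_one]
      ext
      simp [Real.coe_toNNReal _ (sq_nonneg σ)]
  rw [← hmap, map_measureReal_apply (by fun_prop) measurableSet_Iic]
  have hpre : (fun t => σ * t + μ) ⁻¹' Iic x = Iic ((x - μ) / σ) := by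
    ext t
    rw [mem_preimage, mem_Iic, mem_Iic, le_div_iff₀ hσ]
    constructor <;> intro h <;> linarith
  rw [hpre, measureReal_def, gaussianReal_apply_eq_integral _ one_ne_zero, ENNReal.toReal_ofReal
    (integral_nonneg fun t => gaussianPDFReal_nonneg _ _ _), ← integral_Iic_nphi]
  simp_rw [nphi_eq_gaussianPDFReal]

instance (h : Fin 2) : IsProbabilityMeasure (signalLaw h₁ σ h) := by
  unfold signalLaw
  infer_instance

lemma signalLaw_zero_Iic (hσ : 0 < σ) (a : ℝ) :
    (signalLaw h₁ σ 0).real (Iic (h₁ / 2 + σ * a)) = ncdf (a + h₁ / (2 * σ)) := by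
  rw [signalLaw, gaussianReal_Iic hσ, signalMean, if_pos rfl]
  congr 1
  field_simp
  ring

lemma signalLaw_one_Iic (hσ : 0 < σ) (a : ℝ) :
    (signalLaw h₁ σ 1).real (Iic (h₁ / 2 + σ * a)) = ncdf (a - h₁ / (2 * σ)) := by
  rw [signalLaw, gaussianReal_Iic hσ, signalMean, if_neg (by decide)]
  congr 1
  field_simp
  ring

lemma signalLaw_zero_Ioi (hσ : 0 < σ) (a : ℝ) :
    (signalLaw h₁ σ 0).real (Ioi (h₁ / 2 + σ * a)) = ncdf (-(h₁ / (2 * σ)) - a) := by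
  rw [← compl_Iic, probReal_compl_eq_one_sub measurableSet_Iic, signalLaw_zero_Iic hσ, ncdf_add_eq,
    sub_sub_cancel]

lemma signalLaw_one_Ioi (hσ : 0 < σ) (a : ℝ) :
    (signalLaw h₁ σ 1).real (Ioi (h₁ / 2 + σ * a)) = ncdf (h₁ / (2 * σ) - a) := by
  rw [← compl_Iic, probReal_compl_eq_one_sub measurableSet_Iic, signalLaw_one_Iic hσ, ncdf_sub_eq,
    sub_sub_cancel]

lemma updatedBelief_one (hc₁₀ : 0 < c₁₀) (hc₀₁ : 0 < c₀₁) (hh₁ : 0 < h₁) (hσ : 0 < σ) {q : ℝ}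
    (hq : q ∈ Ioo (0 : ℝ) 1) : updatedBelief c₁₀ c₀₁ h₁ σ q 1 ∈ Ioo (0 : ℝ) 1 ∧
      threshold c₁₀ c₀₁ (h₁ / (2 * σ)) (updatedBelief c₁₀ c₀₁ h₁ σ q 1) =
        thrOne (h₁ / (2 * σ)) (threshold c₁₀ c₀₁ (h₁ / (2 * σ)) q) := by
  simp only [updatedBelief, decisionProb, setOf_lrtDecision_eq_one hc₁₀ hc₀₁ hh₁ hσ hq,
    signalLaw_zero_Ioi hσ, signalLaw_one_Ioi hσ]
  obtain ⟨h1, h2⟩ := threshold_update (m := h₁ / (2 * σ)) hc₁₀ hc₀₁ hq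
    (ncdf_pos (-(h₁ / (2 * σ)) - threshold c₁₀ c₀₁ (h₁ / (2 * σ)) q))
    (ncdf_pos (h₁ / (2 * σ) - threshold c₁₀ c₀₁ (h₁ / (2 * σ)) q))
  refine ⟨h1, h2.trans ?_⟩
  rw [thrOne, tailLlr]
  ring

lemma updatedBelief_zero (hc₁₀ : 0 < c₁₀) (hc₀₁ : 0 < c₀₁) (hh₁ : 0 < h₁) (hσ : 0 < σ) {q : ℝ}
    (hq : q ∈ Ioo (0 : ℝ) 1) : updatedBelief c₁₀ c₀₁ h₁ σ q 0 ∈ Ioo (0 : ℝ) 1 ∧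
      threshold c₁₀ c₀₁ (h₁ / (2 * σ)) (updatedBelief c₁₀ c₀₁ h₁ σ q 0) =
        thrZero (h₁ / (2 * σ)) (threshold c₁₀ c₀₁ (h₁ / (2 * σ)) q) := by
  simp only [updatedBelief, decisionProb, setOf_lrtDecision_eq_zero hc₁₀ hc₀₁ hh₁ hσ hq,
    signalLaw_zero_Iic hσ, signalLaw_one_Iic hσ]
  obtain ⟨h1, h2⟩ := threshold_update (m := h₁ / (2 * σ)) hc₁₀ hc₀₁ hq
    (ncdf_pos (threshold c₁₀ c₀₁ (h₁ / (2 * σ)) q + h₁ / (2 * σ)))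
    (ncdf_pos (threshold c₁₀ c₀₁ (h₁ / (2 * σ)) q - h₁ / (2 * σ)))
  refine ⟨h1, h2.trans ?_⟩
  rw [thrZero, tailLlr, sub_neg_eq_add, sub_neg_eq_add, neg_add_eq_sub, add_comm (h₁ / (2 * σ))]

lemma prod_real_union (μ : Measure ℝ) [IsProbabilityMeasure μ] {s t u v : Set ℝ}
    (hst : Disjoint s t) (ht : MeasurableSet t) (hv : MeasurableSet v) :
    (μ.prod μ).real (s ×ˢ u ∪ t ×ˢ v) = μ.real s * μ.real u + μ.real t * μ.real v := by
  rw [measureReal_union (hst.set_prod_left u v) (ht.prod hv), measureReal_prod_prod,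
    measureReal_prod_prod]

/-- The Bayes risk is a multiple of `curveRisk`. -/
lemma bayesRisk_eq (hc₁₀ : 0 < c₁₀) (hc₀₁ : 0 < c₀₁) (hh₁ : 0 < h₁) (hσ : 0 < σ) {p₀ q₁ q₂ : ℝ}
    (hp₀ : p₀ ∈ Ioo (0 : ℝ) 1) (hq₁ : q₁ ∈ Ioo (0 : ℝ) 1) (hq₂ : q₂ ∈ Ioo (0 : ℝ) 1) :
    bayesRisk c₁₀ c₀₁ p₀ h₁ σ q₁ q₂ = c₀₁ * (1 - p₀) *
      curveRisk (h₁ / (2 * σ)) (threshold c₁₀ c₀₁ (h₁ / (2 * σ)) p₀)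
        (threshold c₁₀ c₀₁ (h₁ / (2 * σ)) q₁) (threshold c₁₀ c₀₁ (h₁ / (2 * σ)) q₂) := by
  have hm : 0 < h₁ / (2 * σ) := by positivity
  obtain ⟨hu1, ht1⟩ := updatedBelief_one hc₁₀ hc₀₁ hh₁ hσ hq₂
  obtain ⟨hu0, ht0⟩ := updatedBelief_zero hc₁₀ hc₀₁ hh₁ hσ hq₂
  have hset : ∀ d, {y | finalDecision c₁₀ c₀₁ h₁ σ q₁ q₂ y = d} =
      {y | lrtDecision c₁₀ c₀₁ h₁ σ q₁ y = 1} ×ˢ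
        {y | lrtDecision c₁₀ c₀₁ h₁ σ (updatedBelief c₁₀ c₀₁ h₁ σ q₂ 1) y = d} ∪
      {y | lrtDecision c₁₀ c₀₁ h₁ σ q₁ y = 0} ×ˢ
        {y | lrtDecision c₁₀ c₀₁ h₁ σ (updatedBelief c₁₀ c₀₁ h₁ σ q₂ 0) y = d} := by
    intro d
    ext y
    by_cases h : lrtDecision c₁₀ c₀₁ h₁ σ q₁ y.1 = 1
    · simp [finalDecision, h]
    · have h0 := lrtDecision_eq_zero_iff.2 h
      simp [finalDecision, h0]
  rw [bayesRisk, hset, hset, setOf_lrtDecision_eq_one hc₁₀ hc₀₁ hh₁ hσ hq₁,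
    setOf_lrtDecision_eq_zero hc₁₀ hc₀₁ hh₁ hσ hq₁, setOf_lrtDecision_eq_one hc₁₀ hc₀₁ hh₁ hσ hu1,
    setOf_lrtDecision_eq_zero hc₁₀ hc₀₁ hh₁ hσ hu1, setOf_lrtDecision_eq_one hc₁₀ hc₀₁ hh₁ hσ hu0,
    setOf_lrtDecision_eq_zero hc₁₀ hc₀₁ hh₁ hσ hu0, ht1, ht0]
  have hdisj : Disjoint (Ioi (h₁ / 2 + σ * threshold c₁₀ c₀₁ (h₁ / (2 * σ)) q₁))
      (Iic (h₁ / 2 + σ * threshold c₁₀ c₀₁ (h₁ / (2 * σ)) q₁)) :=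
    (Iic_disjoint_Ioi le_rfl).symm
  rw [prod_real_union _ hdisj measurableSet_Iic measurableSet_Ioi,
    prod_real_union _ hdisj measurableSet_Iic measurableSet_Iic]
  simp only [signalLaw_zero_Ioi hσ, signalLaw_one_Ioi hσ, signalLaw_zero_Iic hσ,
    signalLaw_one_Iic hσ]
  rw [curveRisk, risk, exp_threshold hc₁₀ hc₀₁ hm hp₀]
  have h1 : 0 < 1 - p₀ := sub_pos.2 hp₀.2
  field_simp

lemma bestRisk_eq (hc₁₀ : 0 < c₁₀) (hc₀₁ : 0 < c₀₁) (hh₁ : 0 < h₁) (hσ : 0 < σ) {p₀ q₁ : ℝ}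
    (hp₀ : p₀ ∈ Ioo (0 : ℝ) 1) (hq₁ : q₁ ∈ Ioo (0 : ℝ) 1) :
    bestRisk c₁₀ c₀₁ p₀ h₁ σ q₁ = c₀₁ * (1 - p₀) *
      infRisk (h₁ / (2 * σ)) (threshold c₁₀ c₀₁ (h₁ / (2 * σ)) p₀)
        (threshold c₁₀ c₀₁ (h₁ / (2 * σ)) q₁) := by
  have hm : 0 < h₁ / (2 * σ) := by positivity
  have hsurj : Function.Surjective fun q : Ioo (0 : ℝ) 1 =>
      threshold c₁₀ c₀₁ (h₁ / (2 * σ)) q := fun a => by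
    obtain ⟨q, hq, h⟩ := exists_threshold_eq hc₁₀ hc₀₁ hm a
    exact ⟨⟨q, hq⟩, h⟩
  rw [bestRisk, infRisk, Real.mul_iInf_of_nonneg (mul_nonneg hc₀₁.le (sub_pos.2 hp₀.2).le)]
  simp_rw [fun q : Ioo (0 : ℝ) 1 => bayesRisk_eq hc₁₀ hc₀₁ hh₁ hσ hp₀ hq₁ q.2]
  exact hsurj.iInf_comp fun b => c₀₁ * (1 - p₀) * curveRisk (h₁ / (2 * σ))
    (threshold c₁₀ c₀₁ (h₁ / (2 * σ)) p₀) (threshold c₁₀ c₀₁ (h₁ / (2 * σ)) q₁) b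

lemma isOptimalFirstBelief_iff (hc₁₀ : 0 < c₁₀) (hc₀₁ : 0 < c₀₁) (hh₁ : 0 < h₁) (hσ : 0 < σ)
    {p₀ q₁ : ℝ} (hp₀ : p₀ ∈ Ioo (0 : ℝ) 1) :
    IsOptimalFirstBelief c₁₀ c₀₁ p₀ h₁ σ q₁ ↔ q₁ ∈ Ioo (0 : ℝ) 1 ∧
      ∀ a, infRisk (h₁ / (2 * σ)) (threshold c₁₀ c₀₁ (h₁ / (2 * σ)) p₀)
        (threshold c₁₀ c₀₁ (h₁ / (2 * σ)) q₁) ≤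
        infRisk (h₁ / (2 * σ)) (threshold c₁₀ c₀₁ (h₁ / (2 * σ)) p₀) a := by
  have hm : 0 < h₁ / (2 * σ) := by positivity
  have hC : 0 < c₀₁ * (1 - p₀) := mul_pos hc₀₁ (sub_pos.2 hp₀.2)
  refine and_congr_right fun hq₁ => ⟨fun h a => ?_, fun h q hq => ?_⟩
  · obtain ⟨q, hq, rfl⟩ := exists_threshold_eq hc₁₀ hc₀₁ hm a
    have := h q hq
    rwa [bestRisk_eq hc₁₀ hc₀₁ hh₁ hσ hp₀ hq₁, bestRisk_eq hc₁₀ hc₀₁ hh₁ hσ hp₀ hq,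
      mul_le_mul_iff_right₀ hC] at this
  · rw [bestRisk_eq hc₁₀ hc₀₁ hh₁ hσ hp₀ hq₁, bestRisk_eq hc₁₀ hc₀₁ hh₁ hσ hp₀ hq,
      mul_le_mul_iff_right₀ hC]
    exact h _

end Signals

end TwoAgents


end

theorem theorem2 (c₁₀ c₀₁ p₀ h₁ σ : ℝ) (hc₁₀ : 0 < c₁₀) (hc₀₁ : 0 < c₀₁)
    (hp₀ : p₀ ∈ Set.Ioo (0 : ℝ) 1) (hh₁ : 0 < h₁) (hσ : 0 < σ) :
    (∃ q₁ : ℝ, TwoAgents.IsOptimalFirstBelief c₁₀ c₀₁ p₀ h₁ σ q₁) ∧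
    ∀ q₁ : ℝ, TwoAgents.IsOptimalFirstBelief c₁₀ c₀₁ p₀ h₁ σ q₁ →
      (p₀ < c₀₁ / (c₁₀ + c₀₁) → p₀ < q₁ ∧ q₁ < c₀₁ / (c₁₀ + c₀₁)) ∧
      (p₀ = c₀₁ / (c₁₀ + c₀₁) → q₁ = p₀) ∧
      (c₀₁ / (c₁₀ + c₀₁) < p₀ → c₀₁ / (c₁₀ + c₀₁) < q₁ ∧ q₁ < p₀) := by
  open TwoAgents in
  have hm : 0 < h₁ / (2 * σ) := by positivity
  have hr := div_add_mem_Ioo hc₁₀ hc₀₁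
  have ht := threshold_div_add (m := h₁ / (2 * σ)) hc₁₀ hc₀₁
  obtain ⟨⟨a, ha⟩, h⟩ := infRisk_minimizers hm (threshold c₁₀ c₀₁ (h₁ / (2 * σ)) p₀)
  constructor
  · obtain ⟨q, hq, rfl⟩ := exists_threshold_eq hc₁₀ hc₀₁ hm a
    exact ⟨q, (isOptimalFirstBelief_iff hc₁₀ hc₀₁ hh₁ hσ hp₀).2 ⟨hq, ha⟩⟩
  · intro q hopt
    obtain ⟨hq, hmin⟩ := (isOptimalFirstBelief_iff hc₁₀ hc₀₁ hh₁ hσ hp₀).1 hopt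
    have key := h _ hmin
    rw [← ht] at key
    simp only [threshold_lt_threshold hc₁₀ hc₀₁ hm, threshold_inj hc₁₀ hc₀₁ hm, hp₀, hr, hq] at key
    refine ⟨fun h' => key.2.2 h', fun h' => (key.2.1 h').trans h'.symm, key.1⟩
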